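/- Let $m,\varepsilon,\beta>0$, $\mathcal H=L^2(\mathbb R^3;\mathbb C)$ (inner product antilinear in the first entry), $K=-\frac{\Delta}{2m}+\varepsilon$, $\Omega_0=(1-e^{-\beta K})^{-1}$, and let the thermal propagator be the $\beta$-periodic operator valued function with $$\Delta^\beta(u)=\frac{e^{-uK}}{1-e^{-\beta K}},\qquad u\in[0,\beta).$$ Let $\omega^\beta$ be the quasi-free (gauge invariant) equilibrium state on polynomials in the Bose fields $\Psi(f)$ (antilinear in $f\in\mathcal H$), $\Psi^*(h)$ (linear in $h\in\mathcal H$) and the Wick square $|\Psi|^2$ (normal ordered with respect to the vacuum), with $\omega^\beta(\Psi(f)\Psi^*(h))=\langle f,B_-h\rangle$, $\omega^\beta(\Psi^*(h)\Psi(f))=\langle f,B_+h\rangle$, $B_\pm=\mp(1-e^{\pm\beta K})^{-1}$. It is continued to fields at imaginary times in $[0,\beta)$: a field $\Psi$ at time $u$ and a field $\Psi^*$ at time $u'\neq u$ have the contraction $\Delta^\beta(u'-u)$, so that correlation functions are symmetric under exchange of factors at different times, while at equal times the operator order is kept. Let $\omega^\beta_C$ be the connected correlation functions, defined recursively by $$\omega^\beta(F_1\cdots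 F_n)=\sum_{\pi}\prod_{I\in\pi}\omega_C^\beta(F_{I_1};\dots;F_{I_{|I|}}),$$ the sum being over the partitions $\pi$ of $\{1,\dots,n\}$. Let $\phi_0\in\mathbb R$, and let $A:[0,\beta]\times\mathbb R^3\to\mathbb C$ be continuous and compactly supported; $A(u)$ denotes also the multiplication operator $(A(u)f)(x)=A(u,x)f(x)$. Put $$Q_A=Q_{A,1}+Q_{A,2},\qquad Q_{A,1}(u)=\int_{\mathbb R^3} A(u,x)\,(\Psi+\Psi^*)(x,u)\,\phi_0\,\mathrm d^3x,\qquad Q_{A,2}(u)=\int_{\mathbb R^3} A(u,x)\,|\Psi|^2(x,u)\,\mathrm d^3x .$$ Consider, as formal power series in a coupling constant $\lambda$ (with $\lambda A$ in place of $A$), $$\omega^{\beta A}(B)=\frac{\omega^\beta(B\,U_A)}{\omega^\beta(U_A)},\qquad \omega^\beta(B\,U_A)=\sum_{n\ge0}\frac{(-\lambda)^n}{n!}\int_{(0,\beta)^n}\omega^\beta\big(B\,Q_A(u_1)\cdots Q_A(u_n)\big)\,\mathrm d^nu,$$ and the truncated two-point function $\langle f,\Omega h\rangle=\omega^{\beta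 A}(\Psi(f)\Psi^*(h))-\omega^{\beta A}(\Psi(f))\,\omega^{\beta A}(\Psi^*(h))$, where $\Psi(f)$ and $\Psi^*(h)$ are taken at time $0$. **Proposition.** For all $f,h\in\mathcal H$ the integrands of the integrals over $(0,\beta)^n$ displayed above (for $B\in\{1,\Psi(f),\Psi^*(h),\Psi(f)\Psi^*(h)\}$) and below (jointly in $(u_0,u)$ in the first formula) are absolutely integrable, and the following identities of formal power series in $\lambda$ hold. 1. For $X=\Psi(f)$ and for $X=\Psi^*(h)$, $$\omega^{\beta A}(X)=-\sum_{n\ge0}\frac{(-1)^n}{n!}\lambda^{n+1}\int_0^\beta\mathrm du_0\int_{(0,\beta)^n}\mathrm d^nu\;\omega^\beta_C\big(X;Q_{A,2}(u_1);\dots;Q_{A,2}(u_n);Q_{A,1}(u_0)\big).$$ 2. The truncated two-point function involves only the quadratic part of $Q_A$: $$\langle f,\Omega h\rangle=\sum_{n\ge0}\frac{(-\lambda)^n}{n!}\int_{(0,\beta)^n}\mathrm d^nu\;\omega^\beta_C\big(\Psi(f)\Psi^*(h);Q_{A,2}(u_1);\dots;Q_{A,2}(u_n)\big).$$ In particular the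 linear part of $Q_A$ has no influence on $\Omega$: $\langle f,\Omega h\rangle$ is the same as for $\phi_0=0$. 3. $\Omega$ is given by the Dyson series $$\langle f,\Omega h\rangle=\langle f,\Omega_0h\rangle+\sum_{n\ge1}(-\lambda)^n\int_{(0,\beta)^n}\mathrm d^nu\,\big\langle f,\Delta^\beta(u_1)A(u_1)\Delta^\beta(u_2-u_1)\cdots\Delta^\beta(u_n-u_{n-1})A(u_n)\Delta^\beta(-u_n)h\big\rangle .$$ -/

import Mathlib

open MeasureTheory FourierTransform
open scoped ENNReal CompactlySupported

noncomputable section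

/-- The space `Σ = ℝ³`. -/
abbrev Space : Type := EuclideanSpace ℝ (Fin 3)

/-- The one-particle Hilbert space `L²(ℝ³; ℂ)`. -/
abbrev OneParticle : Type := Lp ℂ 2 (volume : Measure Space)

/-- The parameters of the free gas: the mass `m > 0`, the infrared regularisation `ε > 0`
(the chemical potential of the free theory is `-ε`) and the inverse temperature `β > 0`. -/
structure BoseGas where
  m : ℝ
  ε : ℝ
  β : ℝ
  m_pos : 0 < m
  ε_pos : 0 < ε
  β_pos : 0 < β

/-- The multiplication operator on `L²(ℝ³; ℂ)` by an essentially bounded function `g`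
(and `0` if `g` is not essentially bounded). -/
def mulOp (g : Space → ℂ) : OneParticle →L[ℂ] OneParticle :=
  open Classical in
  if hg : MemLp g ∞ (volume : Measure Space) then
    (ContinuousLinearMap.mul ℂ ℂ).holderL (volume : Measure Space) ∞ 2 2 (hg.toLp g)
  else 0

/-- The Fourier transform on `L²(ℝ³; ℂ)`, with kernel `exp (-2πi ⟨x, ξ⟩)`; the momentum is
`p = 2πξ`. -/
def fourierL2 : OneParticle ≃ₗᵢ[ℂ] OneParticle := Lp.fourierTransformₗᵢ Space ℂ

/-- The Fourier multiplier on `L²(ℝ³; ℂ)` with (bounded) symbol `s`. -/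
def fourierMultiplier (s : Space → ℂ) : OneParticle →L[ℂ] OneParticle :=
  (fourierL2.symm.toContinuousLinearEquiv : OneParticle →L[ℂ] OneParticle) ∘L
    mulOp s ∘L (fourierL2.toContinuousLinearEquiv : OneParticle →L[ℂ] OneParticle)

/-- A compactly supported continuous function as an element of `L²(ℝ³; ℂ)`. -/
def toL2 (g : C_c(Space, ℂ)) : OneParticle :=
  (g.continuous.memLp_of_hasCompactSupport g.hasCompactSupport :
    MemLp g 2 (volume : Measure Space)).toLp g

/-- Generators of the field algebra, at imaginary time `u`: the field `Ψ(f)` (antilinear in the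
smearing function), its adjoint `Ψ*(h)`, and the Wick square `:|Ψ|²:(g)`, normal ordered with
respect to the vacuum. -/
inductive FieldGen : Type
  | ann (u : ℝ) (f : OneParticle) : FieldGen
  | cre (u : ℝ) (h : OneParticle) : FieldGen
  | sq (u : ℝ) (g : C_c(Space, ℂ)) : FieldGen

namespace FieldGen

/-- The imaginary time of a generator. -/
def time : FieldGen → ℝ
  | ann u _ => u
  | cre u _ => u
  | sq u _ => u

/-- The generator contains a field `Ψ`. -/
def HasAnn : FieldGen → Prop
  | ann _ _ => True
  | cre _ _ => False
  | sq _ _ => True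

/-- The generator contains a field `Ψ*`. -/
def HasCre : FieldGen → Prop
  | ann _ _ => False
  | cre _ _ => True
  | sq _ _ => True

/-- The generator is a Wick square. -/
def IsSq : FieldGen → Prop
  | ann _ _ => False
  | cre _ _ => False
  | sq _ _ => True

/-- The smearing function of a Wick square (`1` for a linear field, where it is not used). -/
def weight : FieldGen → Space → ℂ
  | ann _ _ => fun _ => 1
  | cre _ _ => fun _ => 1
  | sq _ g => g

end FieldGen

/-- Polynomials in the fields, with complex coefficients: linear combinations of words in the
generators. -/
abbrev Observable : Type := MonoidAlgebra ℂ (FreeMonoid FieldGen)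

/-- A generator as an observable. -/
def obs (a : FieldGen) : Observable := MonoidAlgebra.of ℂ (FreeMonoid FieldGen) (FreeMonoid.of a)

/-- The field `Ψ(f)` at time `0`. -/
def Psi (f : OneParticle) : Observable := obs (.ann 0 f)

/-- The field `Ψ*(h)` at time `0`. -/
def PsiStar (h : OneParticle) : Observable := obs (.cre 0 h)

/-- The linear part `Q_{A,1}(u) = ∫ A(u,x) (Ψ(x,u) + Ψ*(x,u)) φ₀ dx`. The complex conjugate
compensates that `Ψ(f)` is antilinear in `f`. -/
def Q1 (φ₀ : ℝ) (A : ℝ → C_c(Space, ℂ)) (u : ℝ) : Observable :=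
  (φ₀ : ℂ) • (obs (.ann u (toL2 (star (A u)))) + obs (.cre u (toL2 (A u))))

/-- The quadratic part `Q_{A,2}(u) = ∫ A(u,x) |Ψ|²(x,u) dx`. -/
def Q2 (A : ℝ → C_c(Space, ℂ)) (u : ℝ) : Observable := obs (.sq u (A u))

/-- `Q_A(u) = Q_{A,1}(u) + Q_{A,2}(u)`. -/
def Q (φ₀ : ℝ) (A : ℝ → C_c(Space, ℂ)) (u : ℝ) : Observable := Q1 φ₀ A u + Q2 A u

namespace BoseGas

variable (G : BoseGas)

/-- The symbol `p²/(2m) + ε` (with `p = 2πξ`) of the one-particle Hamiltonian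
`K = -Δ/(2m) + ε`. -/
def energy (ξ : Space) : ℝ := (2 * Real.pi * ‖ξ‖) ^ 2 / (2 * G.m) + G.ε

/-- The symbol of `e^{-sK} (1 - e^{-βK})⁻¹`. -/
def symbol (s : ℝ) (ξ : Space) : ℂ :=
  ((Real.exp (-s * G.energy ξ) / (1 - Real.exp (-G.β * G.energy ξ)) : ℝ) : ℂ)

/-- The operator `e^{-sK} (1 - e^{-βK})⁻¹`, for `0 ≤ s ≤ β`. At `s = 0` this is the Bose factor
`B_- = (1 - e^{-βK})⁻¹`, at `s = β` the Bose factor `B_+ = -(1 - e^{βK})⁻¹`. -/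
def propagator (s : ℝ) : OneParticle →L[ℂ] OneParticle := fourierMultiplier (G.symbol s)

/-- The integral kernel, as a function of `x - y`, of `e^{-sK} (1 - e^{-βK})⁻¹`,
for `0 < s ≤ β`. -/
def kernel (s : ℝ) : Space → ℂ := 𝓕⁻ (G.symbol s)

/-- The representative in `[0, β)` of `u` modulo `β`. -/
def wrap (u : ℝ) : ℝ := G.β * Int.fract (u / G.β)

/-- The thermal propagator `Δ^β(u)`: it is `e^{-uK} (1 - e^{-βK})⁻¹` for `u ∈ [0, β)`, extended
with period `β`. -/
def thermal (u : ℝ) : OneParticle →L[ℂ] OneParticle := G.propagator (G.wrap u)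

/-- The operator `Ω₀ = (1 - e^{-βK})⁻¹`. -/
def Omega0 : OneParticle →L[ℂ] OneParticle :=
  fourierMultiplier fun ξ => ((1 / (1 - Real.exp (-G.β * G.energy ξ)) : ℝ) : ℂ)

/-- The imaginary time that separates a field `Ψ` in the `i`-th factor of a product, at time `u`,
from a field `Ψ*` in the `j`-th factor, at time `v`. At different times it is `v - u` modulo `β`.
At equal times the order of the factors decides: `0` (hence `B_-`) if `Ψ` stands first, `β`
(hence `B_+`) if `Ψ*` stands first, and also `β` inside one Wick square. -/
def lapse (i j : ℕ) (u v : ℝ) : ℝ :=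
  if u = v then (if i < j then 0 else G.β) else G.wrap (v - u)

/-- The contraction of a field `Ψ` in the `i`-th factor `a` with a field `Ψ*` in the `j`-th factor
`b`; `x` and `y` are the positions of these fields, and matter only for Wick squares. For two Wick
squares at the same time this is meant only inside one square, where it is
the constant `c_β`, the kernel of `B_+` on the diagonal: coinciding times of two different squares
are a null set in all the integrals below. -/
def contraction (i j : ℕ) (a b : FieldGen) (x y : Space) : ℂ :=
  match a, b with
  | .ann u f, .cre v h => inner ℂ f (G.propagator (G.lapse i j u v) h)
  | .ann u f, .sq v _ => starRingEnd ℂ (G.propagator (G.lapse i j u v) f y)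
  | .sq u _, .cre v h => G.propagator (G.lapse i j u v) h x
  | .sq u _, .sq v _ => G.kernel (G.lapse i j u v) (x - y)
  | _, _ => 0

open Classical in
/-- The value of the equilibrium state `ω^β` on a word in the generators. The state is quasi-free:
the value is the sum over all ways of contracting every `Ψ` with some `Ψ*`, integrated over the
positions of the Wick squares. -/
def wordValue (w : List FieldGen) : ℂ :=
  ∫ x : {i : Fin w.length // (w.get i).IsSq} → Space,
    (∏ i, (w.get i.1).weight (x i)) *
      ∑ σ : {i : Fin w.length // (w.get i).HasAnn} ≃ {j : Fin w.length // (w.get j).HasCre},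
        ∏ i, G.contraction i.1 (σ i).1 (w.get i.1) (w.get (σ i).1)
          (if h : (w.get i.1).IsSq then x ⟨i.1, h⟩ else 0)
          (if h : (w.get (σ i).1).IsSq then x ⟨(σ i).1, h⟩ else 0)

/-- The equilibrium state `ω^β`, continued to imaginary times in `[0, β)`: at equal times products
are the operator products in the order in which they are written, at different times they are
ordered by imaginary time, whatever the order in which they are written. So on increasing times it
is the analytic continuation of the correlation functions, and it is extended by symmetry. -/
def state (a : Observable) : ℂ := a.coeff.sum fun w c => c * G.wordValue w.toList

open Classical in
/-- Connected correlation functions of `ω^β` for the entries of `a` with index in `I`, in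
increasing order, defined recursively by
`ω^β(∏_{i ∈ I} a_i) = ∑_π ∏_{J ∈ π} ω^β_C(a_J)`, the sum being over the partitions `π` of `I`. -/
def connectedOn {n : ℕ} (a : Fin n → Observable) (I : Finset (Fin n)) : ℂ :=
  G.state ((I.sort (· ≤ ·)).map a).prod -
    ∑ π : {π : Finpartition I // π.parts ≠ {I}},
      ∏ J : {J : Finset (Fin n) // J ∈ π.1.parts}, connectedOn a J.1
termination_by I.card
decreasing_by
  obtain ⟨J, hJ⟩ := J
  obtain ⟨π, hπ⟩ := π
  refine Finset.card_lt_card ((π.le hJ).lt_of_ne fun h => hπ ?_)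
  refine Finset.eq_singleton_iff_unique_mem.2 ⟨h.subst (motive := (· ∈ π.parts)) hJ, fun L hL => ?_⟩
  by_contra hne
  have hd : Disjoint L J := π.disjoint hL hJ (fun h' => hne (h'.trans h))
  exact π.ne_bot hL (disjoint_self.1 (hd.mono_right ((π.le hL).trans h.ge)))

/-- The connected correlation function `ω^β_C(a₁; …; a_n)`. -/
def connected (l : List Observable) : ℂ := G.connectedOn l.get Finset.univ

/-- The cube `(0, β)ⁿ`. -/
def cube (n : ℕ) : Set (Fin n → ℝ) := Set.univ.pi fun _ => Set.Ioo 0 G.β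

/-- The integrand `ω^β(B Q_A(u₁) ⋯ Q_A(u_n))`. -/
def vertexCorr (φ₀ : ℝ) (A : ℝ → C_c(Space, ℂ)) (B : Observable) (n : ℕ) (u : Fin n → ℝ) : ℂ :=
  G.state (B * (List.ofFn fun i => Q φ₀ A (u i)).prod)

/-- `ω^β(B U_A(iβ))`, a formal power series in the coupling constant `λ` (that is, with `λA` in
place of `A`), where `U_A(iβ)` is the imaginary time ordered exponential of
`-λ ∫_0^β Q_A(u) du`. -/
def withU (φ₀ : ℝ) (A : ℝ → C_c(Space, ℂ)) (B : Observable) : PowerSeries ℂ :=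
  PowerSeries.mk fun n =>
    (-1) ^ n / (n.factorial : ℂ) * ∫ u in G.cube n, G.vertexCorr φ₀ A B n u

/-- The perturbed equilibrium state `ω^{βA}(B) = ω^β(B U_A(iβ)) / ω^β(U_A(iβ))`, a formal power
series in the coupling constant. -/
def perturbedState (φ₀ : ℝ) (A : ℝ → C_c(Space, ℂ)) (B : Observable) : PowerSeries ℂ :=
  G.withU φ₀ A B * (G.withU φ₀ A 1)⁻¹

/-- The truncated two-point function
`⟨f, Ω h⟩ = ω^{βA}(Ψ(f) Ψ*(h)) - ω^{βA}(Ψ(f)) ω^{βA}(Ψ*(h))`. -/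
def truncated (φ₀ : ℝ) (A : ℝ → C_c(Space, ℂ)) (f h : OneParticle) : PowerSeries ℂ :=
  G.perturbedState φ₀ A (Psi f * PsiStar h) -
    G.perturbedState φ₀ A (Psi f) * G.perturbedState φ₀ A (PsiStar h)

/-- `Δ^β(u₁ - s) A(u₁) Δ^β(u₂ - u₁) ⋯ Δ^β(u_n - u_{n-1}) A(u_n) Δ^β(-u_n)`. -/
def dysonChain (A : ℝ → C_c(Space, ℂ)) (s : ℝ) : List ℝ → (OneParticle →L[ℂ] OneParticle)
  | [] => G.thermal (-s)
  | u :: us => G.thermal (u - s) ∘L mulOp (A u) ∘L dysonChain A u us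

/-- `Δ^β(u₁) A(u₁) Δ^β(u₂ - u₁) ⋯ Δ^β(u_n - u_{n-1}) A(u_n) Δ^β(-u_n)`. -/
def dysonTerm (A : ℝ → C_c(Space, ℂ)) (n : ℕ) (u : Fin n → ℝ) : OneParticle →L[ℂ] OneParticle :=
  G.dysonChain A 0 (List.ofFn u)

end BoseGas

end

/-! Wick's theorem writes a correlation function of the free state as a sum over all pairings of the
fields Ψ with the fields Ψ*. A Wick square carries one field of each kind. So the contractions which
start from Ψ(f) trace a path: it runs through squares and ends either at the external Ψ*(h) or at
the Ψ* of a linear vertex. The vertices off the path form a correlation function of their own. Hence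
ω(X ∏_I Q) = ∑_{S ⊆ I} c(S) ω(∏_{I∖S} Q), where c(S) sums the paths that visit exactly S
(`gauss_ann_mul`, `gauss_cre_mul`); for X = Ψ(f)Ψ*(h) there is a further sum for the paths that miss
Ψ*(h) (`gauss_ann_mul_cre_mul`).

This expansion is used twice. Grouping partitions by the block of X shows that the coefficients c(S)
are the connected correlation functions (`connectedOn_insert_eq`). Integrating over the times turns
the sum over subsets into a product of exponential generating series (`series_sum_powerset`), so
that ω(U) divides out. For Ψ(f)Ψ*(h) the paths that miss Ψ*(h) contribute exactly the product of the
one-point functions, and truncation removes them (`Regular.truncated_eq`). The remaining paths join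
the two external fields and meet squares only, so φ₀ drops out. Such a path is an ordering of the
vertices; all orderings have the same integral, which cancels the factorial and leaves the Dyson
series (`Regular.coeff_truncated`). A path for a one-point function has its single linear vertex at
the end, which can be any of the n + 1 vertices.

The algebra is carried out on commuting polynomials: at times which differ modulo β the order of the
factors is irrelevant, and contraction with a field Ψ is a derivation (`gauss_ann_mul_prod`). Its
analytic core is `val_option`: integrating out the position of a square hit by Ψ(f) leaves another
field Ψ, with a new smearing function. Statements on Ψ* follow by taking adjoints (`gauss_adj`).

Absolute integrability splits in the same way. Paths are products of uniformly bounded operators,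
norm continuous at distinct times. The correlation functions off the path contain loops of integral
kernels, for which the supremum bound is available only at time lags bounded away from zero, while
their L¹ norms stay bounded. Since n times on a circle leave a gap, cutting there makes every
contraction either long, and bounded in supremum, or increasing in rank, and integrable one position
after the other (`exists_rank`, `lintegral_prod_chain_le`, `exists_lintegral_loopIntegrand_le`).
Linear vertices are then switched on one at a time (`Regular.memLp_gauss`). -/

noncomputable section

/-! ### Multiplication operators, the Fourier transform and Fourier multipliers on L² -/

section Multiplication

lemma memLp_top_cc (g : C_c(Space, ℂ)) : MemLp g ∞ (volume : Measure Space) :=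
  g.continuous.memLp_of_hasCompactSupport g.hasCompactSupport

lemma coeFn_mulOp {g : Space → ℂ} (hg : MemLp g ∞ (volume : Measure Space)) (f : OneParticle) :
    mulOp g f =ᵐ[volume] fun x => g x * f x := by
  have h1 : mulOp g f = (ContinuousLinearMap.mul ℂ ℂ).holder 2 (hg.toLp g) f := by
    rw [mulOp, dif_pos hg]; rfl
  rw [h1]
  filter_upwards [(ContinuousLinearMap.mul ℂ ℂ).coeFn_holder (r := 2) (hg.toLp g) f,
    hg.coeFn_toLp] with x hx hx'
  rw [hx, hx']; rfl

lemma norm_mulOp_le {g : Space → ℂ} {C : ℝ} (hC : 0 ≤ C) (h : ∀ x, ‖g x‖ ≤ C) :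
    ‖mulOp g‖ ≤ C := by
  by_cases hg : MemLp g ∞ (volume : Measure Space)
  · refine ContinuousLinearMap.opNorm_le_bound _ hC fun f => ?_
    refine Lp.norm_le_mul_norm_of_ae_le_mul ?_
    filter_upwards [coeFn_mulOp hg f] with x hx
    rw [hx, norm_mul]
    exact mul_le_mul_of_nonneg_right (h x) (norm_nonneg _)
  · rw [mulOp, dif_neg hg, norm_zero]; exact hC

lemma mulOp_sub {g₁ g₂ : Space → ℂ} (h₁ : MemLp g₁ ∞ (volume : Measure Space))
    (h₂ : MemLp g₂ ∞ (volume : Measure Space)) : mulOp g₁ - mulOp g₂ = mulOp (g₁ - g₂) := by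
  ext1 f
  refine Lp.ext ?_
  filter_upwards [coeFn_mulOp (h₁.sub h₂) f, coeFn_mulOp h₁ f, coeFn_mulOp h₂ f,
    Lp.coeFn_sub (mulOp g₁ f) (mulOp g₂ f)] with x hx hx1 hx2 hx3
  rw [_root_.sub_apply, hx3, hx, Pi.sub_apply, hx1, hx2, Pi.sub_apply, sub_mul]

lemma inner_mulOp {g : Space → ℂ} (hg : MemLp g ∞ (volume : Measure Space))
    (f h : OneParticle) : inner ℂ (mulOp (star g) f) h = inner ℂ f (mulOp g h) := by
  have hg' : MemLp (star g) ∞ (volume : Measure Space) := hg.star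
  rw [L2.inner_def, L2.inner_def]
  refine integral_congr_ae ?_
  filter_upwards [coeFn_mulOp hg h, coeFn_mulOp hg' f] with x hx hx'
  rw [hx, hx']
  simp [mul_assoc, mul_comm, mul_left_comm]

lemma inner_eq_integral (f h : OneParticle) :
    inner ℂ f h = ∫ x, starRingEnd ℂ (f x) * h x := by
  rw [L2.inner_def]
  simp [mul_comm]

/-- With `e` the indicator of a common support, norm estimates and continuity of `toL2` reduce to
those of the multiplication operators. -/
lemma toL2_eq_mulOp (g : C_c(Space, ℂ)) (e : OneParticle)
    (he : ∀ᵐ x, x ∈ tsupport g → e x = 1) : toL2 g = mulOp g e := by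
  refine Lp.ext ?_
  filter_upwards [coeFn_mulOp (memLp_top_cc g) e, he,
    (g.continuous.memLp_of_hasCompactSupport g.hasCompactSupport :
    MemLp g 2 (volume : Measure Space)).coeFn_toLp] with x hx hx' hx''
  rw [hx, toL2]
  refine Eq.trans hx'' ?_
  change g x = g x * e x
  by_cases h : x ∈ tsupport g
  · rw [hx' h, mul_one]
  · rw [image_eq_zero_of_notMem_tsupport h, zero_mul]

end Multiplication

section Fourier

lemma ae_eq_of_integral_schwartz_mul_eq {F F' : Space → ℂ} (hF : LocallyIntegrable F)
    (hF' : LocallyIntegrable F')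
    (h : ∀ φ : SchwartzMap Space ℂ, ∫ x, φ x * F x = ∫ x, φ x * F' x) : F =ᵐ[volume] F' := by
  refine ae_eq_of_integral_contDiff_smul_eq hF hF' fun g hg hgs => ?_
  have hg1 : ContDiff ℝ (⊤ : ℕ∞) (fun x => (g x : ℂ)) := Complex.ofRealCLM.contDiff.comp hg
  have hg2 : HasCompactSupport (fun x => (g x : ℂ)) := hgs.comp_left Complex.ofReal_zero
  have := h (hg2.toSchwartzMap hg1)
  simpa using this

/-- Both transforms have the same pairing with every Schwartz function: the L² one because it agrees
with the distributional one, the integral one by Fubini. -/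
lemma fourierL2_ae_eq (g : OneParticle) (hg : Integrable g) :
    fourierL2 g =ᵐ[volume] 𝓕 (g : Space → ℂ) := by
  refine ae_eq_of_integral_schwartz_mul_eq ?_ ?_ fun φ => ?_
  · exact (Lp.memLp (fourierL2 g)).locallyIntegrable (by norm_num)
  · exact (VectorFourier.fourierIntegral_continuous Real.continuous_fourierChar
      continuous_inner hg).locallyIntegrable
  · have h1 := congrArg (fun T => T φ) (Lp.fourier_toTemperedDistribution_eq g)
    simp only [TemperedDistribution.fourier_apply, Lp.toTemperedDistribution_apply] at h1
    have h2 := VectorFourier.integral_fourierIntegral_smul_eq_flip (L := innerₗ Space)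
      (μ := volume) (ν := volume) Real.continuous_fourierChar continuous_inner φ.integrable hg
    rw [flip_innerₗ] at h2
    calc ∫ x, φ x * fourierL2 g x = ∫ x, (𝓕 φ : SchwartzMap Space ℂ) x • g x := h1.symm
      _ = ∫ x, φ x * 𝓕 (g : Space → ℂ) x := by
        simpa [SchwartzMap.fourier_coe, VectorFourier.fourierIntegral, Real.fourier_eq] using h2

lemma continuous_neg_innerₗ : Continuous fun p : Space × Space => (-innerₗ Space) p.1 p.2 := by
  simp only [LinearMap.neg_apply, innerₗ_apply_apply]
  fun_prop

lemma fourierL2_symm_ae_eq (g : OneParticle) (hg : Integrable g) :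
    fourierL2.symm g =ᵐ[volume] 𝓕⁻ (g : Space → ℂ) := by
  have hcont : Continuous (𝓕⁻ (g : Space → ℂ)) := by
    have := VectorFourier.fourierIntegral_continuous (L := -innerₗ Space) Real.continuous_fourierChar
      continuous_neg_innerₗ hg
    convert this using 1
    ext w
    simp [VectorFourier.fourierIntegral, Real.fourierInv_eq]
  refine ae_eq_of_integral_schwartz_mul_eq ?_ ?_ fun φ => ?_
  · exact (Lp.memLp (fourierL2.symm g)).locallyIntegrable (by norm_num)
  · exact hcont.locallyIntegrable
  · have h1 := congrArg (fun T => T φ) (Lp.fourierInv_toTemperedDistribution_eq g)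
    simp only [TemperedDistribution.fourierInv_apply, Lp.toTemperedDistribution_apply] at h1
    have h2 := VectorFourier.integral_fourierIntegral_smul_eq_flip (L := -innerₗ Space)
      (μ := volume) (ν := volume) Real.continuous_fourierChar
      continuous_neg_innerₗ φ.integrable hg
    have h3 : (-innerₗ Space).flip = -innerₗ Space := by
      ext x y; simp [real_inner_comm]
    rw [h3] at h2
    calc ∫ x, φ x * fourierL2.symm g x = ∫ x, (𝓕⁻ φ : SchwartzMap Space ℂ) x • g x := h1.symm
      _ = ∫ x, φ x * 𝓕⁻ (g : Space → ℂ) x := by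
        simpa [SchwartzMap.fourierInv_coe, VectorFourier.fourierIntegral, Real.fourierInv_eq] using h2

end Fourier

section FourierMultiplier

lemma fourierMultiplier_apply (s : Space → ℂ) (g : OneParticle) :
    fourierMultiplier s g = fourierL2.symm (mulOp s (fourierL2 g)) := rfl

lemma norm_fourierMultiplier_le (s : Space → ℂ) : ‖fourierMultiplier s‖ ≤ ‖mulOp s‖ := by
  refine ContinuousLinearMap.opNorm_le_bound _ (norm_nonneg _) fun g => ?_
  rw [fourierMultiplier_apply, LinearIsometryEquiv.norm_map]
  exact (ContinuousLinearMap.le_opNorm _ _).trans_eq (by rw [LinearIsometryEquiv.norm_map])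

lemma fourierMultiplier_sub {s₁ s₂ : Space → ℂ} (h₁ : MemLp s₁ ∞ (volume : Measure Space))
    (h₂ : MemLp s₂ ∞ (volume : Measure Space)) :
    fourierMultiplier s₁ - fourierMultiplier s₂ = fourierMultiplier (s₁ - s₂) := by
  ext1 f
  rw [_root_.sub_apply, fourierMultiplier_apply, fourierMultiplier_apply, fourierMultiplier_apply,
    ← mulOp_sub h₁ h₂, _root_.sub_apply, map_sub]

lemma inner_fourierMultiplier {s : Space → ℂ} (hs : MemLp s ∞ (volume : Measure Space))
    (f h : OneParticle) :
    inner ℂ (fourierMultiplier (star s) f) h = inner ℂ f (fourierMultiplier s h) := by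
  rw [fourierMultiplier_apply, fourierMultiplier_apply, ← LinearIsometryEquiv.inner_map_map fourierL2,
    LinearIsometryEquiv.apply_symm_apply, inner_mulOp hs, ← LinearIsometryEquiv.inner_map_map fourierL2 f,
    LinearIsometryEquiv.apply_symm_apply]

/-- The convolution theorem. It links the two descriptions of a propagator, as an operator on
smearing functions and as a kernel between two Wick squares. -/
lemma fourierMultiplier_ae_eq {s : Space → ℂ} (hs : MemLp s ∞ (volume : Measure Space))
    (hs1 : Integrable s) (g : OneParticle) (hg : Integrable g) :
    fourierMultiplier s g =ᵐ[volume] fun x => ∫ y, 𝓕⁻ s (x - y) * g y := by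
  have hcont : Continuous (𝓕 (g : Space → ℂ)) := by
    have := VectorFourier.fourierIntegral_continuous (L := innerₗ Space)
      Real.continuous_fourierChar continuous_inner hg
    have e : 𝓕 (g : Space → ℂ) = VectorFourier.fourierIntegral Real.fourierChar volume
        (innerₗ Space) (g : Space → ℂ) := by
      ext w; simp [VectorFourier.fourierIntegral, Real.fourier_eq]
    rw [e]; exact this
  have hG : mulOp s (fourierL2 g) =ᵐ[volume] fun ξ => s ξ * 𝓕 (g : Space → ℂ) ξ := by
    filter_upwards [coeFn_mulOp hs (fourierL2 g), fourierL2_ae_eq g hg] with ξ h1 h2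
    rw [h1, h2]
  have hint : Integrable (fun ξ => s ξ * 𝓕 (g : Space → ℂ) ξ) := by
    refine hs1.mul_bdd (c := ∫ x, ‖g x‖) hcont.aestronglyMeasurable (ae_of_all _ fun ξ => ?_)
    rw [Real.fourier_eq]
    refine (norm_integral_le_integral_norm _).trans_eq ?_
    simp
  rw [fourierMultiplier_apply]
  refine (fourierL2_symm_ae_eq _ (hint.congr hG.symm)).trans (Filter.Eventually.of_forall fun x => ?_)
  -- Fubini in the form ∫ ĝ k = ∫ g k̂, with k the symbol times the plane wave of the point `x`;
  -- then k̂(y) is the inverse transform of the symbol at `x - y`.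
  have h2 := VectorFourier.integral_fourierIntegral_smul_eq_flip (L := innerₗ Space)
      (μ := volume) (ν := volume) Real.continuous_fourierChar continuous_inner hg
      (g := fun ξ => Real.fourierChar (inner ℝ ξ x) • s ξ)
      ((hs1.norm.mono' (by
        refine AEStronglyMeasurable.smul (𝕜 := Circle) ?_ hs1.aestronglyMeasurable
        exact (Real.continuous_fourierChar.comp (by fun_prop)).aestronglyMeasurable)
        (ae_of_all _ fun ξ => by simp)))
  rw [flip_innerₗ] at h2
  simp only [VectorFourier.fourierIntegral, innerₗ_apply_apply] at h2
  rw [Real.fourierInv_eq]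
  have e1 : ∫ v, Real.fourierChar (inner ℝ v x) • (mulOp s (fourierL2 g)) v
      = ∫ v, Real.fourierChar (inner ℝ v x) • (s v * 𝓕 (g : Space → ℂ) v) := by
    refine integral_congr_ae ?_
    filter_upwards [hG] with v hv
    rw [hv]
  rw [e1]
  refine Eq.trans ?_ (h2.trans ?_)
  · refine integral_congr_ae (ae_of_all _ fun v => ?_)
    simp only [Real.fourier_eq, Circle.smul_def, smul_eq_mul]
    ring
  · refine integral_congr_ae (ae_of_all _ fun y => ?_)
    simp only [Real.fourierInv_eq, smul_eq_mul]
    rw [mul_comm]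
    congr 1
    refine integral_congr_ae (ae_of_all _ fun ξ => ?_)
    simp only [inner_sub_right, smul_smul, ← AddChar.map_add_eq_mul]
    rw [real_inner_comm, neg_add_eq_sub]

end FourierMultiplier

/-! ### The thermal propagator and its integral kernel -/

namespace BoseGas

variable (G : BoseGas)

section Symbol

/-- The norm of `(1 - e^{-βK})⁻¹`. -/
def bound : ℝ := (1 - Real.exp (-G.β * G.ε))⁻¹

lemma energy_ge (ξ : Space) : G.ε ≤ G.energy ξ := by
  have := G.m_pos
  unfold energy
  have : 0 ≤ (2 * Real.pi * ‖ξ‖) ^ 2 / (2 * G.m) := by positivity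
  linarith

lemma energy_pos (ξ : Space) : 0 < G.energy ξ := G.ε_pos.trans_le (G.energy_ge ξ)

lemma continuous_energy : Continuous G.energy := by
  unfold energy; fun_prop

lemma one_sub_exp_pos : 0 < 1 - Real.exp (-G.β * G.ε) := by
  have : Real.exp (-G.β * G.ε) < 1 := by
    rw [Real.exp_lt_one_iff]; nlinarith [mul_pos G.β_pos G.ε_pos]
  linarith

lemma bound_pos : 0 < G.bound := inv_pos.2 G.one_sub_exp_pos

lemma denom_ge (ξ : Space) :
    1 - Real.exp (-G.β * G.ε) ≤ 1 - Real.exp (-G.β * G.energy ξ) := by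
  have := mul_le_mul_of_nonneg_left (G.energy_ge ξ) G.β_pos.le
  have : Real.exp (-G.β * G.energy ξ) ≤ Real.exp (-G.β * G.ε) := Real.exp_le_exp.2 (by linarith)
  linarith

lemma denom_pos (ξ : Space) : 0 < 1 - Real.exp (-G.β * G.energy ξ) :=
  G.one_sub_exp_pos.trans_le (G.denom_ge ξ)

lemma norm_symbol (s : ℝ) (ξ : Space) :
    ‖G.symbol s ξ‖ = Real.exp (-s * G.energy ξ) / (1 - Real.exp (-G.β * G.energy ξ)) := by
  rw [symbol, Complex.norm_real, Real.norm_of_nonneg]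
  exact div_nonneg (Real.exp_pos _).le (G.denom_pos ξ).le

lemma norm_symbol_le (s : ℝ) (ξ : Space) :
    ‖G.symbol s ξ‖ ≤ G.bound * Real.exp (-s * G.energy ξ) := by
  rw [norm_symbol, div_eq_mul_inv, mul_comm]
  exact mul_le_mul_of_nonneg_right (inv_anti₀ G.one_sub_exp_pos (G.denom_ge ξ)) (Real.exp_pos _).le

lemma norm_symbol_le_bound {s : ℝ} (hs : 0 ≤ s) (ξ : Space) : ‖G.symbol s ξ‖ ≤ G.bound := by
  refine (G.norm_symbol_le s ξ).trans (mul_le_of_le_one_right G.bound_pos.le ?_)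
  rw [Real.exp_le_one_iff]
  nlinarith [G.energy_pos ξ]

lemma continuous_symbol_uncurry : Continuous fun p : ℝ × Space => G.symbol p.1 p.2 := by
  unfold symbol
  refine Complex.continuous_ofReal.comp (Continuous.div ?_ ?_ fun p => (G.denom_pos p.2).ne')
  · exact Real.continuous_exp.comp (continuous_fst.neg.mul (G.continuous_energy.comp continuous_snd))
  · exact continuous_const.sub (Real.continuous_exp.comp
      (continuous_const.mul (G.continuous_energy.comp continuous_snd)))

lemma continuous_symbol (s : ℝ) : Continuous (G.symbol s) :=
  G.continuous_symbol_uncurry.comp (Continuous.prodMk_right s)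

lemma memLp_symbol {s : ℝ} (hs : 0 ≤ s) : MemLp (G.symbol s) ∞ (volume : Measure Space) :=
  memLp_top_of_bound (G.continuous_symbol s).aestronglyMeasurable G.bound
    (ae_of_all _ (G.norm_symbol_le_bound hs))

/-- The exponent of the Gaussian `e^{-tK}` in momentum space. -/
def width (t : ℝ) : ℝ := t * ((2 * Real.pi) ^ 2 / (2 * G.m))

lemma width_pos {t : ℝ} (ht : 0 < t) : 0 < G.width t := by
  have := G.m_pos; have := Real.pi_pos
  unfold width; positivity

lemma exp_energy (t : ℝ) (ξ : Space) :
    Real.exp (-t * G.energy ξ) = Real.exp (-t * G.ε) * Real.exp (-G.width t * ‖ξ‖ ^ 2) := by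
  rw [← Real.exp_add]
  congr 1
  unfold energy width
  ring

lemma integrable_exp_energy {t : ℝ} (ht : 0 < t) :
    Integrable fun ξ => Real.exp (-t * G.energy ξ) := by
  simp_rw [exp_energy]
  refine Integrable.const_mul ?_ _
  have h := GaussianFourier.integrable_cexp_neg_mul_sq_norm_add (V := Space) (b := G.width t)
    (by simpa using G.width_pos ht) 0 0
  refine (integrable_norm_iff h.1).2 h |>.congr (ae_of_all _ fun x => ?_)
  simp [Complex.norm_exp, ← Complex.ofReal_pow]

lemma integrable_symbol {s : ℝ} (hs : 0 < s) : Integrable (G.symbol s) :=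
  ((G.integrable_exp_energy hs).const_mul G.bound).mono'
    (G.continuous_symbol s).aestronglyMeasurable (ae_of_all _ fun ξ => G.norm_symbol_le s ξ)

lemma star_symbol (s : ℝ) : star (G.symbol s) = G.symbol s := by
  ext ξ; exact Complex.conj_ofReal _

end Symbol

section Propagator

lemma norm_propagator_le {s : ℝ} (hs : 0 ≤ s) : ‖G.propagator s‖ ≤ G.bound :=
  (norm_fourierMultiplier_le _).trans (norm_mulOp_le G.bound_pos.le (G.norm_symbol_le_bound hs))

lemma inner_propagator {s : ℝ} (hs : 0 ≤ s) (f h : OneParticle) :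
    inner ℂ (G.propagator s f) h = inner ℂ f (G.propagator s h) := by
  have := inner_fourierMultiplier (G.memLp_symbol hs) f h
  rwa [star_symbol] at this

/-- The energy E is unbounded, but the derivative E e^{-aE} of the exponential is at most 1/δ for a
≥ δ. Uniformity in the momentum is what gives continuity of the propagator in operator norm away
from time zero. -/
lemma norm_symbol_sub_le {δ s t : ℝ} (hδ : 0 < δ) (hs : δ ≤ s) (ht : δ ≤ t) (ξ : Space) :
    ‖G.symbol s ξ - G.symbol t ξ‖ ≤ G.bound * δ⁻¹ * |s - t| := by
  have key : ∀ a b : ℝ, δ ≤ a → a ≤ b →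
      |Real.exp (-a * G.energy ξ) - Real.exp (-b * G.energy ξ)| ≤ δ⁻¹ * (b - a) := by
    intro a b ha hab
    have hE := G.energy_pos ξ
    have h1 : Real.exp (-b * G.energy ξ) ≤ Real.exp (-a * G.energy ξ) :=
      Real.exp_le_exp.2 (by nlinarith)
    rw [abs_of_nonneg (by linarith)]
    have h2 : Real.exp (-b * G.energy ξ) =
        Real.exp (-a * G.energy ξ) * Real.exp (-((b - a) * G.energy ξ)) := by
      rw [← Real.exp_add]; congr 1; ring
    have h3 := Real.add_one_le_exp (-((b - a) * G.energy ξ))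
    have h4 : Real.exp (-a * G.energy ξ) ≤ Real.exp (-(δ * G.energy ξ)) :=
      Real.exp_le_exp.2 (by nlinarith)
    have h5 : δ * G.energy ξ * Real.exp (-(δ * G.energy ξ)) ≤ 1 := by
      rw [Real.exp_neg, ← div_eq_mul_inv, div_le_one (Real.exp_pos _)]
      linarith [Real.add_one_le_exp (δ * G.energy ξ)]
    have hab' : 0 ≤ (b - a) * G.energy ξ := mul_nonneg (by linarith) hE.le
    calc Real.exp (-a * G.energy ξ) - Real.exp (-b * G.energy ξ)
        = Real.exp (-a * G.energy ξ) * (1 - Real.exp (-((b - a) * G.energy ξ))) := by rw [h2]; ring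
      _ ≤ Real.exp (-a * G.energy ξ) * ((b - a) * G.energy ξ) :=
        mul_le_mul_of_nonneg_left (by linarith) (Real.exp_pos _).le
      _ ≤ Real.exp (-(δ * G.energy ξ)) * ((b - a) * G.energy ξ) :=
        mul_le_mul_of_nonneg_right h4 hab'
      _ = δ⁻¹ * (b - a) * (δ * G.energy ξ * Real.exp (-(δ * G.energy ξ))) := by
        field_simp
      _ ≤ δ⁻¹ * (b - a) * 1 := mul_le_mul_of_nonneg_left h5
        (mul_nonneg (inv_nonneg.2 hδ.le) (by linarith))
      _ = _ := mul_one _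
  have key' : |Real.exp (-s * G.energy ξ) - Real.exp (-t * G.energy ξ)| ≤ δ⁻¹ * |s - t| := by
    rcases le_total s t with h | h
    · rw [abs_sub_comm s t, abs_of_nonneg (sub_nonneg.2 h)]; exact key s t hs h
    · rw [abs_sub_comm, abs_of_nonneg (sub_nonneg.2 h)]; exact key t s ht h
  rw [symbol, symbol, ← Complex.ofReal_sub, Complex.norm_real, ← sub_div, Real.norm_eq_abs, abs_div,
    abs_of_pos (G.denom_pos ξ), div_eq_mul_inv, mul_comm, mul_assoc]
  exact mul_le_mul (inv_anti₀ G.one_sub_exp_pos (G.denom_ge ξ)) key' (abs_nonneg _) G.bound_pos.le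

lemma continuousOn_propagator : ContinuousOn G.propagator (Set.Ioi 0) := by
  intro s hs
  have hs' : 0 < s / 2 := half_pos hs
  refine ContinuousAt.continuousWithinAt ?_
  refine tendsto_iff_norm_sub_tendsto_zero.2 ?_
  have h0 : Filter.Tendsto (fun t => G.bound * (s / 2)⁻¹ * |t - s|) (nhds s) (nhds 0) := by
    have : Continuous fun t => G.bound * (s / 2)⁻¹ * |t - s| := by fun_prop
    simpa using this.tendsto s
  refine squeeze_zero' (Filter.Eventually.of_forall fun _ => norm_nonneg _) ?_ h0
  filter_upwards [lt_mem_nhds (half_lt_self hs)] with t ht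
  rw [propagator, propagator, fourierMultiplier_sub (G.memLp_symbol (hs'.trans ht).le)
    (G.memLp_symbol (le_of_lt hs))]
  exact (norm_fourierMultiplier_le _).trans (norm_mulOp_le
    (by have := G.bound_pos; positivity)
    (G.norm_symbol_sub_le hs' ht.le (half_le_self (le_of_lt hs))))

end Propagator

section Kernel

lemma kernel_eq (s : ℝ) (x : Space) :
    G.kernel s x = ∫ ξ, Real.fourierChar (inner ℝ ξ x) • G.symbol s ξ := by
  rw [kernel, Real.fourierInv_eq]

/-- A uniform bound for the kernels of `e^{-sK} (1 - e^{-βK})⁻¹` with `s ≥ t`. -/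
def kernelBound (t : ℝ) : ℝ := ∫ ξ, ‖G.symbol t ξ‖

/-- The symbol decreases with the time. This supremum bound serves contractions over times bounded
away from zero; the short ones need `lintegral_kernel_le`. -/
lemma norm_kernel_le {s t : ℝ} (ht : 0 < t) (hts : t ≤ s) (x : Space) :
    ‖G.kernel s x‖ ≤ G.kernelBound t := by
  rw [kernel_eq]
  refine (norm_integral_le_integral_norm _).trans ?_
  simp only [Circle.norm_smul]
  refine integral_mono (G.integrable_symbol (ht.trans_le hts)).norm (G.integrable_symbol ht).norm
    fun ξ => ?_
  simp only [norm_symbol]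
  refine div_le_div_of_nonneg_right (Real.exp_le_exp.2 ?_) (G.denom_pos ξ).le
  nlinarith [G.energy_pos ξ]

lemma stronglyMeasurable_kernel : StronglyMeasurable fun p : ℝ × Space => G.kernel p.1 p.2 := by
  simp_rw [kernel_eq]
  refine StronglyMeasurable.integral_prod_right'
    (f := fun q : (ℝ × Space) × Space => Real.fourierChar (inner ℝ q.2 q.1.2) • G.symbol q.1.1 q.2) ?_
  refine Continuous.stronglyMeasurable ?_
  simp only [Circle.smul_def]
  refine Continuous.smul (continuous_subtype_val.comp (Real.continuous_fourierChar.comp (by fun_prop))) ?_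
  exact G.continuous_symbol_uncurry.comp (by fun_prop : Continuous fun q : (ℝ × Space) × Space => (q.1.1, q.2))

lemma measurable_kernel (s : ℝ) : Measurable fun x => G.kernel s x := by
  have h : Measurable fun x : Space => (s, x) := measurable_prodMk_left
  have h2 := G.stronglyMeasurable_kernel.measurable.comp h
  simp only [Function.comp_def] at h2
  exact h2

lemma star_kernel (s : ℝ) (x : Space) : starRingEnd ℂ (G.kernel s x) = G.kernel s (-x) := by
  rw [kernel_eq, kernel_eq]
  refine (integral_conj (𝕜 := ℂ)).symm.trans (integral_congr_ae (ae_of_all _ fun ξ => ?_))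
  have h : starRingEnd ℂ (G.symbol s ξ) = G.symbol s ξ := congrFun (G.star_symbol s) ξ
  have h2 : starRingEnd ℂ (Real.fourierChar (inner ℝ ξ x) : ℂ) =
      (Real.fourierChar (inner ℝ ξ (-x)) : ℂ) := by
    rw [inner_neg_right, AddChar.map_neg_eq_inv, Circle.coe_inv_eq_conj]
  change starRingEnd ℂ ((Real.fourierChar (inner ℝ ξ x) : ℂ) * G.symbol s ξ) =
    (Real.fourierChar (inner ℝ ξ (-x)) : ℂ) * G.symbol s ξ
  rw [map_mul, h, h2]

lemma propagator_ae_eq {s : ℝ} (hs : 0 < s) (g : OneParticle) (hg : Integrable g) :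
    G.propagator s g =ᵐ[volume] fun x => ∫ y, G.kernel s (x - y) * g y :=
  fourierMultiplier_ae_eq (G.memLp_symbol hs.le) (G.integrable_symbol hs) g hg

/-- The heat kernel of `K`. -/
def heat (t : ℝ) : Space → ℂ := 𝓕⁻ fun ξ => ((Real.exp (-t * G.energy ξ) : ℝ) : ℂ)

lemma heat_eq {t : ℝ} (ht : 0 < t) (x : Space) :
    G.heat t x = ((Real.exp (-t * G.ε) * ((Real.pi / G.width t) ^ (3 / 2 : ℝ) *
      Real.exp (-(Real.pi ^ 2 / G.width t) * ‖x‖ ^ 2)) : ℝ) : ℂ) := by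
  have hw := G.width_pos ht
  have h := fourier_gaussian_innerProductSpace (V := Space) (b := G.width t) (by simpa using hw) (-x)
  have h1 : (fun ξ => ((Real.exp (-t * G.energy ξ) : ℝ) : ℂ)) = (Real.exp (-t * G.ε) : ℂ) •
      (fun v : Space => Complex.exp (-(G.width t) * ‖v‖ ^ 2)) := by
    ext ξ
    rw [exp_energy]
    simp
  rw [heat, Real.fourierInv_eq_fourier_neg, h1, Real.fourier_eq]
  rw [Real.fourier_eq] at h
  simp only [Pi.smul_apply, smul_comm _ (Real.exp (-t * G.ε) : ℂ)]
  rw [integral_smul, h]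
  have h3 : Complex.exp (-(Real.pi : ℂ) ^ 2 * (‖-x‖ : ℂ) ^ 2 / (G.width t : ℂ)) =
      ((Real.exp (-(Real.pi ^ 2 / G.width t) * ‖x‖ ^ 2) : ℝ) : ℂ) := by
    rw [norm_neg]; push_cast; congr 1; ring
  rw [h3]
  rw [finrank_euclideanSpace, Fintype.card_fin, ← Complex.ofReal_div,
    show (((3 : ℕ) : ℂ) / 2) = (((3 / 2 : ℝ)) : ℂ) by push_cast; rfl,
    ← Complex.ofReal_cpow (by have := Real.pi_pos; positivity)]
  simp only [smul_eq_mul, Complex.ofReal_mul]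

/-- The heat kernel is a positive Gaussian, so its L¹ norm is its symbol at zero momentum, where the
energy is `G.ε`. -/
lemma lintegral_heat {t : ℝ} (ht : 0 < t) :
    ∫⁻ x, ‖G.heat t x‖ₑ = ENNReal.ofReal (Real.exp (-t * G.ε)) := by
  have hw := G.width_pos ht
  have hpi := Real.pi_pos
  have hb : 0 < Real.pi ^ 2 / G.width t := by positivity
  have h0 := GaussianFourier.integral_rexp_neg_mul_sq_norm (V := Space) hb
  -- If the Gaussian were not integrable, its integral would have the default value 0, against the
  -- positive value in `h0`.
  have hi : Integrable fun x : Space => Real.exp (-(Real.pi ^ 2 / G.width t) * ‖x‖ ^ 2) := by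
    by_contra hc
    rw [integral_undef hc] at h0
    have : 0 < (Real.pi / (Real.pi ^ 2 / G.width t)) ^ (Module.finrank ℝ Space / 2 : ℝ) := by positivity
    linarith
  have h1 : ∀ x, ‖G.heat t x‖ₑ = ENNReal.ofReal (Real.exp (-t * G.ε) *
      ((Real.pi / G.width t) ^ (3 / 2 : ℝ) * Real.exp (-(Real.pi ^ 2 / G.width t) * ‖x‖ ^ 2))) := by
    intro x
    rw [heat_eq G ht, ← ofReal_norm, Complex.norm_real, Real.norm_of_nonneg (by positivity)]
  simp_rw [h1]
  rw [← ofReal_integral_eq_lintegral_ofReal ((hi.const_mul _).const_mul _)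
    (ae_of_all _ fun x => by positivity), integral_const_mul, integral_const_mul, h0,
    finrank_euclideanSpace, Fintype.card_fin, Nat.cast_ofNat,
    ← Real.mul_rpow (by positivity) (by positivity)]
  have : Real.pi / G.width t * (Real.pi / (Real.pi ^ 2 / G.width t)) = 1 := by field_simp
  rw [this, Real.one_rpow, mul_one]

lemma hasSum_symbol (s : ℝ) (ξ : Space) :
    HasSum (fun k : ℕ => Real.exp (-(s + k * G.β) * G.energy ξ))
      (Real.exp (-s * G.energy ξ) / (1 - Real.exp (-G.β * G.energy ξ))) := by
  have h := (hasSum_geometric_of_lt_one (Real.exp_pos (-G.β * G.energy ξ)).le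
    (by linarith [G.denom_pos ξ])).mul_left (Real.exp (-s * G.energy ξ))
  rw [← div_eq_mul_inv] at h
  refine h.congr_fun ?_ |> fun h => h
  intro k
  rw [← Real.exp_nat_mul, ← Real.exp_add]
  congr 1; ring

lemma hasSum_kernel {s : ℝ} (hs : 0 < s) (x : Space) :
    HasSum (fun k : ℕ => G.heat (s + k * G.β) x) (G.kernel s x) := by
  have hpos : ∀ k : ℕ, 0 < s + k * G.β := fun k => by have := G.β_pos; positivity
  have h := hasSum_integral_of_summable_integral_norm (μ := (volume : Measure Space))
    (F := fun (k : ℕ) ξ => Real.fourierChar (inner ℝ ξ x) •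
      ((Real.exp (-(s + k * G.β) * G.energy ξ) : ℝ) : ℂ)) ?_ ?_
  · have e1 : (fun k : ℕ => G.heat (s + k * G.β) x) = fun k : ℕ => ∫ ξ, Real.fourierChar (inner ℝ ξ x) •
        ((Real.exp (-(s + k * G.β) * G.energy ξ) : ℝ) : ℂ) := by
      ext k
      simp only [heat, Real.fourierInv_eq]
    rw [e1]
    convert! h using 1
    · rw [kernel_eq]
      refine integral_congr_ae (ae_of_all _ fun ξ => ?_)
      have := (Complex.hasSum_ofReal.2 (G.hasSum_symbol s ξ)).const_smul (Real.fourierChar (inner ℝ ξ x))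
      exact this.tsum_eq.symm
  · intro k
    refine (G.integrable_exp_energy (hpos k)).mono' ?_ (ae_of_all _ fun ξ => ?_)
    · refine Continuous.aestronglyMeasurable ?_
      simp only [Circle.smul_def]
      refine Continuous.smul (continuous_subtype_val.comp (Real.continuous_fourierChar.comp (by fun_prop))) ?_
      exact Complex.continuous_ofReal.comp (Real.continuous_exp.comp (continuous_const.mul G.continuous_energy))
    · rw [Circle.norm_smul, Complex.norm_real, Real.norm_of_nonneg (Real.exp_pos _).le]
  -- Energies are at least `G.ε`, so each further period β costs a factor e^{-βε}: a geometric
  -- majorant for the exchange of sum and Fourier integral.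
  · have hq : Summable fun k : ℕ => (Real.exp (-G.β * G.ε)) ^ k *
        ∫ ξ, Real.exp (-s * G.energy ξ) :=
      (summable_geometric_of_lt_one (Real.exp_pos _).le (by linarith [G.one_sub_exp_pos])).mul_right _
    refine hq.of_nonneg_of_le (fun k => integral_nonneg fun _ => norm_nonneg _) fun k => ?_
    rw [← integral_const_mul]
    simp only [Circle.norm_smul, Complex.norm_real, Real.norm_of_nonneg (Real.exp_pos _).le]
    refine integral_mono (G.integrable_exp_energy (hpos k))
      ((G.integrable_exp_energy hs).const_mul _) fun ξ => ?_
    simp only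
    rw [← Real.exp_nat_mul, ← Real.exp_add]
    refine Real.exp_le_exp.2 ?_
    have := mul_le_mul_of_nonneg_left (G.energy_ge ξ) (mul_nonneg k.cast_nonneg G.β_pos.le)
    nlinarith

/-- Expanding (1 - e^{-βK})⁻¹ geometrically makes the kernel a sum of heat kernels at the times s +
kβ, with L¹ norms at most e^{-kβε}. The bound does not depend on `s`, so it survives when two times
collide. -/
lemma lintegral_kernel_le {s : ℝ} (hs : 0 < s) :
    ∫⁻ x, ‖G.kernel s x‖ₑ ≤ ENNReal.ofReal G.bound := by
  have hpos : ∀ k : ℕ, 0 < s + k * G.β := fun k => by have := G.β_pos; positivity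
  have hm : ∀ k : ℕ, Measurable (G.heat (s + k * G.β)) := by
    intro k
    have : G.heat (s + k * G.β) = fun x => _ := funext fun x => G.heat_eq (hpos k) x
    rw [this]
    exact (by fun_prop : Continuous _).measurable
  have hsum := hasSum_geometric_of_lt_one (Real.exp_pos (-G.β * G.ε)).le (by linarith [G.one_sub_exp_pos])
  calc ∫⁻ x, ‖G.kernel s x‖ₑ ≤ ∫⁻ x, ∑' k : ℕ, ‖G.heat (s + k * G.β) x‖ₑ := by
        refine lintegral_mono fun x => ?_
        rw [← (G.hasSum_kernel hs x).tsum_eq]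
        exact enorm_tsum_le_tsum_enorm
    _ = ∑' k : ℕ, ∫⁻ x, ‖G.heat (s + k * G.β) x‖ₑ :=
        lintegral_tsum fun k => (hm k).enorm.aemeasurable
    _ ≤ ∑' k : ℕ, ENNReal.ofReal (Real.exp (-G.β * G.ε) ^ k) := by
        refine ENNReal.tsum_le_tsum fun k => ?_
        rw [G.lintegral_heat (hpos k)]
        refine ENNReal.ofReal_le_ofReal ?_
        rw [← Real.exp_nat_mul]
        refine Real.exp_le_exp.2 ?_
        have := mul_pos hs G.ε_pos
        nlinarith
    _ = ENNReal.ofReal G.bound := by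
        rw [← ENNReal.ofReal_tsum_of_nonneg (fun k => by positivity) hsum.summable, hsum.tsum_eq, bound]

end Kernel

end BoseGas

/-! ### Times on the circle, and sums of full contractions -/

namespace BoseGas

variable (G : BoseGas)

section Times

lemma wrap_nonneg (u : ℝ) : 0 ≤ G.wrap u := mul_nonneg G.β_pos.le (Int.fract_nonneg _)

lemma wrap_zero : G.wrap 0 = 0 := by simp [wrap]

lemma wrap_of_mem {u : ℝ} (h0 : 0 ≤ u) (h1 : u < G.β) : G.wrap u = u := by
  have := G.β_pos
  rw [wrap, Int.fract_eq_self.2 ⟨by positivity, (div_lt_one this).2 h1⟩]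
  field_simp

lemma wrap_of_neg {u : ℝ} (h0 : -G.β ≤ u) (h1 : u < 0) : G.wrap u = u + G.β := by
  have hβ := G.β_pos
  have : u / G.β = (u + G.β) / G.β - 1 := by field_simp; ring
  rw [wrap, this, Int.fract_sub_one]
  exact G.wrap_of_mem (by linarith) (by linarith)

/-- The times `u` and `v` differ modulo `β`. -/
def Apart (u v : ℝ) : Prop := G.wrap (v - u) ≠ 0

variable {G} in
lemma Apart.pos {u v : ℝ} (h : G.Apart u v) : 0 < G.wrap (v - u) :=
  lt_of_le_of_ne (G.wrap_nonneg _) (Ne.symm h)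

variable {G} in
lemma Apart.ne {u v : ℝ} (h : G.Apart u v) : u ≠ v := by
  rintro rfl; exact h (by rw [sub_self, wrap_zero])

variable {G} in
lemma Apart.symm {u v : ℝ} (h : G.Apart u v) : G.Apart v u := by
  intro h'
  apply h
  rw [wrap, mul_eq_zero] at h' ⊢
  right
  have h1 := h'.resolve_left G.β_pos.ne'
  rw [Int.fract_eq_zero_iff] at h1 ⊢
  obtain ⟨z, hz⟩ := h1
  exact ⟨-z, by push_cast; rw [hz]; ring⟩

variable {G} in
lemma Apart.neg {u v : ℝ} (h : G.Apart u v) : G.Apart (-u) (-v) := by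
  have := h.symm
  unfold Apart at this ⊢
  rwa [show -v - -u = u - v by ring]

lemma apart_of_mem {u v : ℝ} (hu : u ∈ Set.Ico 0 G.β) (hv : v ∈ Set.Ico 0 G.β) (h : u ≠ v) :
    G.Apart u v := by
  unfold Apart
  rcases lt_or_gt_of_ne h with h' | h'
  · rw [G.wrap_of_mem (by linarith) (by linarith [hu.1, hv.2])]; linarith
  · rw [G.wrap_of_neg (by linarith [hu.2, hv.1]) (by linarith)]; linarith [hu.2, hv.1]

/-- The imaginary time between two Wick squares; it is `β` inside one Wick square. -/
def lag (u v : ℝ) : ℝ := if u = v then G.β else G.wrap (v - u)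

lemma lag_pos {u v : ℝ} (h : u = v ∨ G.Apart u v) : 0 < G.lag u v := by
  unfold lag
  split_ifs with h'
  · exact G.β_pos
  · exact (h.resolve_left h').pos

variable {G} in
lemma Apart.lag_eq {u v : ℝ} (h : G.Apart u v) : G.lag u v = G.wrap (v - u) := if_neg h.ne

lemma lag_neg (u v : ℝ) : G.lag (-v) (-u) = G.lag u v := by
  unfold lag
  rw [show -u - -v = v - u by ring]
  simp [eq_comm]

lemma norm_thermal_le (u : ℝ) : ‖G.thermal u‖ ≤ G.bound := G.norm_propagator_le (G.wrap_nonneg u)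

lemma inner_thermal (u : ℝ) (f h : OneParticle) :
    inner ℂ (G.thermal u f) h = inner ℂ f (G.thermal u h) := G.inner_propagator (G.wrap_nonneg u) f h

end Times

section Permanent

variable {α κ ι : Type*}

/-- The contraction of a row (a field `Ψ`, by itself or in a Wick square) with a column (a field
`Ψ*`); `x` are the positions of the Wick squares. -/
def entry (a : α → ℝ × OneParticle) (c : κ → ℝ × OneParticle) (s : ι → ℝ × C_c(Space, ℂ))
    (x : ι → Space) : α ⊕ ι → κ ⊕ ι → ℂ
  | .inl i, .inl j => inner ℂ (a i).2 (G.thermal ((c j).1 - (a i).1) (c j).2)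
  | .inl i, .inr j => starRingEnd ℂ (G.thermal ((s j).1 - (a i).1) (a i).2 (x j))
  | .inr i, .inl j => G.thermal ((c j).1 - (s i).1) (c j).2 (x i)
  | .inr i, .inr j => G.kernel (G.lag (s i).1 (s j).1) (x i - x j)

lemma measurable_entry (a : α → ℝ × OneParticle) (c : κ → ℝ × OneParticle)
    (s : ι → ℝ × C_c(Space, ℂ)) (r : α ⊕ ι) (y : κ ⊕ ι) :
    Measurable fun x => G.entry a c s x r y := by
  rcases r with i | i <;> rcases y with j | j
  · exact measurable_const
  · exact RCLike.continuous_conj.measurable.comp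
      ((Lp.stronglyMeasurable _).measurable.comp (measurable_pi_apply j))
  · exact (Lp.stronglyMeasurable _).measurable.comp (measurable_pi_apply i)
  · exact (G.measurable_kernel _).comp ((measurable_pi_apply i).sub (measurable_pi_apply j))

lemma entry_reindex {α' κ' ι' : Type*} (a : α → ℝ × OneParticle) (c : κ → ℝ × OneParticle)
    (s : ι → ℝ × C_c(Space, ℂ)) (ea : α' ≃ α) (ec : κ' ≃ κ) (es : ι' ≃ ι) (x : ι → Space)
    (r : α' ⊕ ι') (y : κ' ⊕ ι') :
    G.entry (a ∘ ea) (c ∘ ec) (s ∘ es) (x ∘ es) r y =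
      G.entry a c s x (Equiv.sumCongr ea es r) (Equiv.sumCongr ec es y) := by
  rcases r with i | i <;> rcases y with j | j <;> rfl

variable [Fintype α] [Fintype κ] [Fintype ι]

/-- The integrand of a full contraction. -/
def integrand (a : α → ℝ × OneParticle) (c : κ → ℝ × OneParticle) (s : ι → ℝ × C_c(Space, ℂ))
    (σ : α ⊕ ι ≃ κ ⊕ ι) (x : ι → Space) : ℂ :=
  (∏ i, (s i).2 (x i)) * ∏ r, G.entry a c s x r (σ r)

/-- The value of a full contraction. -/
def term (a : α → ℝ × OneParticle) (c : κ → ℝ × OneParticle) (s : ι → ℝ × C_c(Space, ℂ))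
    (σ : α ⊕ ι ≃ κ ⊕ ι) : ℂ := ∫ x, G.integrand a c s σ x

open Classical in
/-- The sum of all full contractions of fields `Ψ`, fields `Ψ*` and Wick squares. -/
def val (a : α → ℝ × OneParticle) (c : κ → ℝ × OneParticle) (s : ι → ℝ × C_c(Space, ℂ)) : ℂ :=
  ∑ σ : α ⊕ ι ≃ κ ⊕ ι, G.term a c s σ

omit [Fintype κ] in
lemma measurable_integrand (a : α → ℝ × OneParticle) (c : κ → ℝ × OneParticle)
    (s : ι → ℝ × C_c(Space, ℂ)) (σ : α ⊕ ι ≃ κ ⊕ ι) : Measurable (G.integrand a c s σ) := by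
  refine Measurable.mul ?_ ?_
  · exact Finset.measurable_prod _ fun i _ =>
      ((s i).2.continuous.measurable.comp (measurable_pi_apply i))
  · exact Finset.measurable_prod _ fun r _ => G.measurable_entry a c s r _

/-- At the position of one Wick square there is a compactly supported weight and at most one L²
factor for each of its two fields. The weight lies in every Lʳ, so Hölder applies in all four cases.
-/
lemma integrable_weight_mul_mul (w : C_c(Space, ℂ)) {p q : Space → ℝ}
    (hp : MemLp p 2 (volume : Measure Space) ∨ p = fun _ => 1)
    (hq : MemLp q 2 (volume : Measure Space) ∨ q = fun _ => 1) :
    Integrable fun x => ‖w x‖ * (p x * q x) := by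
  have hw : ∀ r : ℝ≥0∞, MemLp (fun x => ‖w x‖) r (volume : Measure Space) := fun r =>
    (w.continuous.memLp_of_hasCompactSupport w.hasCompactSupport).norm
  rcases hp with hp | rfl <;> rcases hq with hq | rfl
  · have := hp.integrable_mul hq
    exact memLp_one_iff_integrable.1 ((memLp_one_iff_integrable.2 this).mul (p := ∞) (hw ∞))
  · simpa using! (hw 2).integrable_mul hp
  · simpa using! (hw 2).integrable_mul hq
  · simpa using memLp_one_iff_integrable.1 (hw 1)

/-- All lags between squares are positive, so the kernels joining them are bounded. What remains is
dominated by a product of functions of one position each. -/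
lemma integrable_integrand (a : α → ℝ × OneParticle) (c : κ → ℝ × OneParticle)
    (s : ι → ℝ × C_c(Space, ℂ)) (hs : ∀ i j, i ≠ j → G.Apart (s i).1 (s j).1)
    (σ : α ⊕ ι ≃ κ ⊕ ι) : Integrable (G.integrand a c s σ) := by
  -- `k` collects the constants: contractions of two linear fields and the suprema of kernels. At
  -- the position of a square, `p` is the L² function from its Ψ contracted with a linear Ψ*, and
  -- `q` the one from its Ψ* contracted with a linear Ψ; both are 1 if the partner lies in a square.
  let k : α ⊕ ι → κ ⊕ ι → ℝ := fun r y => match r, y with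
    | .inl i, .inl j => ‖inner ℂ (a i).2 (G.thermal ((c j).1 - (a i).1) (c j).2)‖
    | .inl _, .inr _ => 1
    | .inr _, .inl _ => 1
    | .inr i, .inr j => G.kernelBound (G.lag (s i).1 (s j).1)
  let p : ι → Space → ℝ := fun i => match σ (.inr i) with
    | .inl j => fun x => ‖G.thermal ((c j).1 - (s i).1) (c j).2 x‖
    | .inr _ => fun _ => 1
  let q : ι → Space → ℝ := fun j => match σ.symm (.inr j) with
    | .inl i => fun x => ‖G.thermal ((s j).1 - (a i).1) (a i).2 x‖
    | .inr _ => fun _ => 1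
  have hp : ∀ i, MemLp (p i) 2 (volume : Measure Space) ∨ p i = fun _ => 1 := by
    intro i
    rcases h : σ (.inr i) with j | j
    · left; simp only [p, h]; exact (Lp.memLp _).norm
    · right; simp only [p, h]
  have hq : ∀ i, MemLp (q i) 2 (volume : Measure Space) ∨ q i = fun _ => 1 := by
    intro i
    rcases h : σ.symm (.inr i) with j | j
    · left; simp only [q, h]; exact (Lp.memLp _).norm
    · right; simp only [q, h]
  let P : α ⊕ ι → (ι → Space) → ℝ := fun r x => Sum.elim (fun _ => 1) (fun i => p i (x i)) r
  let Q : κ ⊕ ι → (ι → Space) → ℝ := fun r x => Sum.elim (fun _ => 1) (fun i => q i (x i)) r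
  have key : ∀ x r, ‖G.entry a c s x r (σ r)‖ ≤ k r (σ r) * (P r x * Q (σ r) x) := by
    intro x r
    rcases r with i | i
    · rcases h : σ (.inl i) with j | j
      · simp [entry, k, P, Q]
      · have h' : σ.symm (.inr j) = .inl i := by rw [← h, Equiv.symm_apply_apply]
        simp [entry, k, P, Q, q, h']
    · rcases h : σ (.inr i) with j | j
      · simp [entry, k, P, Q, p, h]
      · have h' : σ.symm (.inr j) = .inr i := by rw [← h, Equiv.symm_apply_apply]
        have hl : 0 < G.lag (s i).1 (s j).1 := by
          refine G.lag_pos ?_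
          by_cases hij : i = j
          · left; rw [hij]
          · right; exact hs i j hij
        simpa [entry, k, P, Q, p, q, h, h'] using G.norm_kernel_le hl le_rfl _
  have hint : Integrable fun x : ι → Space => (∏ r, k r (σ r)) *
      ∏ i, (‖(s i).2 (x i)‖ * (p i (x i) * q i (x i))) :=
    (Integrable.fintype_prod (f := fun i (y : Space) => ‖(s i).2 y‖ * (p i y * q i y))
      fun i => integrable_weight_mul_mul _ (hp i) (hq i)).const_mul _
  refine hint.mono' (G.measurable_integrand a c s σ).aestronglyMeasurable (ae_of_all _ fun x => ?_)
  rw [integrand, norm_mul, norm_prod, norm_prod, Finset.prod_mul_distrib, mul_left_comm]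
  refine mul_le_mul_of_nonneg_left ?_ (Finset.prod_nonneg fun _ _ => norm_nonneg _)
  refine (Finset.prod_le_prod (fun _ _ => norm_nonneg _) fun r _ => key x r).trans_eq ?_
  rw [Finset.prod_mul_distrib, Finset.prod_mul_distrib, Equiv.prod_comp σ (fun y => Q y x),
    Fintype.prod_sum_type (fun r => P r x), Fintype.prod_sum_type (fun y => Q y x),
    Finset.prod_mul_distrib]
  simp [P, Q]

section Reindex

variable {α' κ' ι' : Type*} [Fintype α'] [Fintype κ'] [Fintype ι']

omit [Fintype κ] [Fintype κ'] in
lemma term_reindex (a : α → ℝ × OneParticle) (c : κ → ℝ × OneParticle)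
    (s : ι → ℝ × C_c(Space, ℂ)) (ea : α' ≃ α) (ec : κ' ≃ κ) (es : ι' ≃ ι)
    (σ : α' ⊕ ι' ≃ κ' ⊕ ι') :
    G.term (a ∘ ea) (c ∘ ec) (s ∘ es) σ =
      G.term a c s ((Equiv.sumCongr ea es).symm.trans (σ.trans (Equiv.sumCongr ec es))) := by
  have hmp := (volume_measurePreserving_piCongrLeft (fun _ : ι => Space) es)
  rw [term, term, ← hmp.integral_comp (MeasurableEquiv.measurableEmbedding _)]
  refine integral_congr_ae (ae_of_all _ fun x => ?_)
  have key : ∀ z : ι → Space, z ∘ es = x → G.integrand (a ∘ ea) (c ∘ ec) (s ∘ es) σ x =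
      G.integrand a c s ((Equiv.sumCongr ea es).symm.trans (σ.trans (Equiv.sumCongr ec es))) z := by
    rintro z rfl
    simp only [integrand, entry_reindex]
    congr 1
    · exact Equiv.prod_comp es fun i => (s i).2 (z i)
    · refine Fintype.prod_equiv (Equiv.sumCongr ea es) _ _ fun r => ?_
      simp
  refine key _ (funext fun i => ?_)
  exact Equiv.piCongrLeft_apply_apply (fun _ : ι => Space) es x i

lemma val_reindex (a : α → ℝ × OneParticle) (c : κ → ℝ × OneParticle)
    (s : ι → ℝ × C_c(Space, ℂ)) (ea : α' ≃ α) (ec : κ' ≃ κ) (es : ι' ≃ ι) :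
    G.val (a ∘ ea) (c ∘ ec) (s ∘ es) = G.val a c s := by
  classical
  refine Fintype.sum_equiv (Equiv.equivCongr (Equiv.sumCongr ea es) (Equiv.sumCongr ec es)) _ _
    fun σ => ?_
  rw [term_reindex]
  rfl

end Reindex

end Permanent

end BoseGas

/-! ### Contracting one field Ψ: absorption of Wick squares, and complex conjugation -/

section Combinatorics

/-- Expansion of a sum over bijections along one element of the domain. -/
lemma sum_equiv_option {A B M : Type*} [Fintype A] [Fintype B] [DecidableEq A] [DecidableEq B]
    [AddCommMonoid M] (F : (Option A ≃ B) → M) :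
    ∑ e, F e = ∑ y : B, ∑ e : A ≃ {z : B // z ≠ y}, F ((Equiv.optionSubtype y).symm e).1 := by
  rw [← Fintype.sum_fiberwise (fun e : Option A ≃ B => e none) F]
  refine Finset.sum_congr rfl fun y _ => ?_
  exact Fintype.sum_equiv (Equiv.optionSubtype y) _ _ fun e => by simp

/-- `Option α ⊕ ι` is `α ⊕ ι` with one more element. -/
def optionSumEquiv (α ι : Type*) : Option α ⊕ ι ≃ Option (α ⊕ ι) where
  toFun := Sum.elim (fun o => o.map Sum.inl) (fun i => some (.inr i))
  invFun o := o.elim (.inl none) (Sum.map some id)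
  left_inv r := by rcases r with (_ | i) | i <;> rfl
  right_inv o := by rcases o with _ | i | i <;> rfl

variable {α κ ι : Type*} [DecidableEq κ] [DecidableEq ι]

/-- Removing an element of the first summand. -/
def sumNeInl (k : κ) : {z : κ ⊕ ι // z ≠ .inl k} ≃ {k' : κ // k' ≠ k} ⊕ ι where
  toFun z := match z with
    | ⟨.inl k', h⟩ => .inl ⟨k', fun h' => h (by rw [h'])⟩
    | ⟨.inr i, _⟩ => .inr i
  invFun := Sum.elim (fun k' => ⟨.inl k'.1, fun h => k'.2 (Sum.inl.inj h)⟩)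
    (fun i => ⟨.inr i, by simp⟩)
  left_inv z := by rcases z with ⟨k' | i, h⟩ <;> rfl
  right_inv z := by rcases z with k' | i <;> rfl

/-- Removing an element of the second summand. -/
def sumNeInr (j : ι) : {z : κ ⊕ ι // z ≠ .inr j} ≃ κ ⊕ {i : ι // i ≠ j} where
  toFun z := match z with
    | ⟨.inl k, _⟩ => .inl k
    | ⟨.inr i, h⟩ => .inr ⟨i, fun h' => h (by rw [h'])⟩
  invFun := Sum.elim (fun k => ⟨.inl k, by simp⟩)
    (fun i => ⟨.inr i.1, fun h => i.2 (Sum.inr.inj h)⟩)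
  left_inv z := by rcases z with ⟨k' | i, h⟩ <;> rfl
  right_inv z := by rcases z with k' | i <;> rfl

/-- Moving an element of the second summand to the first one. -/
def sumMove (j : ι) : α ⊕ ι ≃ Option α ⊕ {i : ι // i ≠ j} where
  toFun := Sum.elim (fun a => .inl (some a))
    (fun i => if h : i = j then .inl none else .inr ⟨i, h⟩)
  invFun := Sum.elim (fun o => o.elim (.inr j) .inl) (fun i => .inr i.1)
  left_inv z := by
    rcases z with a | i
    · rfl
    · by_cases h : i = j
      · simp [h]
      · simp [h]
  right_inv z := by
    rcases z with (_ | a) | i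
    · simp
    · rfl
    · simp [i.2]

end Combinatorics

section Glue

variable {ι : Type*} [Fintype ι]

variable [DecidableEq ι]

/-- The configuration which is `t` at `j` and `y` elsewhere. -/
def glue (j : ι) (t : Space) (y : {i : ι // i ≠ j} → Space) : ι → Space :=
  fun i => if h : i = j then t else y ⟨i, h⟩

lemma integral_glue (j : ι) {F : (ι → Space) → ℂ} (hF : Integrable F) :
    ∫ x, F x = ∫ y, ∫ t, F (glue j t y) := by
  have h1 := (volume_preserving_piEquivPiSubtypeProd (fun _ : ι => Space) (fun i => i = j)).symm
  have h2 : MeasurePreserving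
      (Prod.map (MeasurableEquiv.funUnique {i : ι // i = j} Space).symm
        (id : ({i : ι // ¬ i = j} → Space) → _)) (volume.prod volume) volume :=
    ((volume_preserving_funUnique {i : ι // i = j} Space).symm).prod (MeasurePreserving.id volume)
  have h3 : MeasurePreserving
      ((MeasurableEquiv.piEquivPiSubtypeProd (fun _ : ι => Space) (fun i => i = j)).symm ∘
        Prod.map (MeasurableEquiv.funUnique {i : ι // i = j} Space).symm id)
      (volume.prod volume) volume := by
    refine h1.comp ?_
    convert! h2
  have he : MeasurableEmbedding
      ((MeasurableEquiv.piEquivPiSubtypeProd (fun _ : ι => Space) (fun i => i = j)).symm ∘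
        Prod.map (MeasurableEquiv.funUnique {i : ι // i = j} Space).symm id) :=
    (MeasurableEquiv.measurableEmbedding _).comp
      ((MeasurableEquiv.prodCongr (MeasurableEquiv.funUnique {i : ι // i = j} Space).symm
        (MeasurableEquiv.refl _)).measurableEmbedding)
  rw [← h3.integral_comp he]
  have h4 := (h3.integrable_comp_emb he).2 hF
  refine (integral_prod_symm _ h4).trans ?_
  rfl

end Glue

namespace BoseGas

variable (G : BoseGas)

section Absorption

variable {α κ ι : Type*} [Fintype α] [Fintype κ] [Fintype ι]

omit [Fintype κ] in
-- A contraction of two linear fields does not depend on the positions, so it leaves the integral;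
-- `τ` is `σ` without this pair.
lemma val_option_aux_cre (a : Option α → ℝ × OneParticle) (c : κ → ℝ × OneParticle)
    (s : ι → ℝ × C_c(Space, ℂ)) (k : κ) (σ : Option α ⊕ ι ≃ κ ⊕ ι)
    (τ : α ⊕ ι ≃ {k' : κ // k' ≠ k} ⊕ ι) (h0 : σ (.inl none) = .inl k)
    (h1 : ∀ r, σ (Sum.map some id r) = Sum.map (↑) id (τ r)) :
    G.term a c s σ = inner ℂ (a none).2 (G.thermal ((c k).1 - (a none).1) (c k).2) *
      G.term (a ∘ some) (fun k' : {k' : κ // k' ≠ k} => c k') s τ := by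
  classical
  rw [term, term, ← integral_const_mul]
  refine integral_congr_ae (ae_of_all _ fun x => ?_)
  simp only [integrand]
  rw [mul_left_comm]
  congr 1
  rw [← Equiv.prod_comp (optionSumEquiv α ι).symm, Fintype.prod_option]
  congr 1
  · change G.entry a c s x (.inl none) (σ (.inl none)) = _
    rw [h0]; rfl
  · refine Finset.prod_congr rfl fun r _ => ?_
    change G.entry a c s x (Sum.map some id r) (σ (Sum.map some id r)) = _
    rw [h1]
    rcases r with i | i <;> rcases τ _ with j | j <;> rfl

/-- The field `Ψ` which results when the field `Ψ*` of a Wick square with weight `w` is contracted;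
`g` is the propagated smearing function of the contracted field. -/
def absorb (w : C_c(Space, ℂ)) (g : OneParticle) : OneParticle := mulOp (star (w : Space → ℂ)) g

lemma coeFn_absorb (w : C_c(Space, ℂ)) (g : OneParticle) :
    absorb w g =ᵐ[volume] fun x => starRingEnd ℂ (w x) * g x :=
  coeFn_mulOp (memLp_top_cc w).star g

lemma integrable_absorb (w : C_c(Space, ℂ)) (g : OneParticle) : Integrable (absorb w g) := by
  have hw : MemLp (fun x => starRingEnd ℂ (w x)) 2 (volume : Measure Space) :=
    (w.continuous.memLp_of_hasCompactSupport w.hasCompactSupport).star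
  exact (hw.integrable_mul (Lp.memLp g)).congr (coeFn_absorb w g).symm

lemma inner_absorb (w : C_c(Space, ℂ)) (g h : OneParticle) :
    inner ℂ (absorb w g) h = ∫ t, w t * (starRingEnd ℂ (g t) * h t) := by
  rw [inner_eq_integral]
  refine integral_congr_ae ?_
  filter_upwards [coeFn_absorb w g] with t ht
  rw [ht, map_mul, Complex.conj_conj, mul_assoc]

/-- Before absorption the contraction of two squares is a kernel with pointwise values, afterwards
it is an element of L². Both agree for almost every position `z` of the second square. -/
lemma propagator_absorb_ae {d : ℝ} (hd : 0 < d) (w : C_c(Space, ℂ)) (g : OneParticle) :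
    ∀ᵐ z, starRingEnd ℂ (G.propagator d (absorb w g) z) =
      ∫ t, w t * (starRingEnd ℂ (g t) * G.kernel d (t - z)) := by
  filter_upwards [G.propagator_ae_eq hd _ (integrable_absorb w g)] with z hz
  rw [hz]
  refine (integral_conj (𝕜 := ℂ)).symm.trans (integral_congr_ae ?_)
  filter_upwards [coeFn_absorb w g] with t ht
  rw [ht, map_mul, map_mul, Complex.conj_conj, star_kernel, neg_sub]
  ring

/-- Only three factors depend on the position of the square `j`: its weight, the contraction of the
distinguished Ψ with its Ψ*, and the contraction leaving from its own Ψ. As its Ψ* is already taken,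
it is not contracted with itself. The integral over this position is the contraction of the absorbed
field, and `τ` continues the pairing from there. -/
lemma val_option_aux_sq [DecidableEq ι] (a : Option α → ℝ × OneParticle) (c : κ → ℝ × OneParticle)
    (s : ι → ℝ × C_c(Space, ℂ)) (hs : ∀ i j, i ≠ j → G.Apart (s i).1 (s j).1) (j : ι)
    (σ : Option α ⊕ ι ≃ κ ⊕ ι) (τ : Option α ⊕ {i : ι // i ≠ j} ≃ κ ⊕ {i : ι // i ≠ j})
    (h0 : σ (.inl none) = .inr j)
    (hj : σ (.inr j) = Sum.map id (↑) (τ (.inl none)))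
    (ha : ∀ i, σ (.inl (some i)) = Sum.map id (↑) (τ (.inl (some i))))
    (hi : ∀ i : {i : ι // i ≠ j}, σ (.inr i) = Sum.map id (↑) (τ (.inr i))) :
    G.term a c s σ = G.term
      (fun o => o.elim ((s j).1, absorb (s j).2 (G.thermal ((s j).1 - (a none).1) (a none).2))
        (a ∘ some)) c (fun i : {i : ι // i ≠ j} => s i) τ := by
  classical
  set g := G.thermal ((s j).1 - (a none).1) (a none).2 with hg
  set a' : Option α → ℝ × OneParticle :=
    fun o => o.elim ((s j).1, absorb (s j).2 g) (a ∘ some) with ha'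
  set s' : {i : ι // i ≠ j} → ℝ × C_c(Space, ℂ) := fun i => s i with hs'
  have gj : ∀ t y, glue j t y j = t := fun t y => by simp [glue]
  have gi : ∀ t y (i : {i : ι // i ≠ j}), glue j t y i = y i := fun t y i => by
    simp [glue, i.2]
  -- The outgoing contraction ends at a linear Ψ*, giving an inner product, or at another square,
  -- giving the kernel identity for almost all positions.
  have hae : ∀ᵐ y : {i : ι // i ≠ j} → Space,
      G.entry a' c s' y (.inl none) (τ (.inl none)) =
        ∫ t, (s j).2 t * (starRingEnd ℂ (g t) *
          G.entry a c s (glue j t y) (.inr j) (σ (.inr j))) := by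
    rw [hj]
    rcases τ (.inl none) with k | k
    · refine ae_of_all _ fun y => ?_
      simp only [Sum.map_inl, id, entry, gj]
      exact inner_absorb _ _ _
    · have h := hs j k k.2.symm
      have := (Measure.tendsto_eval_ae_ae (μ := fun _ : {i : ι // i ≠ j} => (volume : Measure Space))
        (i := k)).eventually (G.propagator_absorb_ae h.pos (s j).2 g)
      filter_upwards [this] with y hy
      simp only [Sum.map_inr, entry, gj, gi, h.lag_eq]
      exact hy
  rw [term, integral_glue j (G.integrable_integrand a c s hs σ), term]
  refine integral_congr_ae ?_
  filter_upwards [hae] with y hy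
  have e1 : ∀ t, G.integrand a c s σ (glue j t y) =
      ((∏ i : {i : ι // i ≠ j}, (s i).2 (y i)) *
        ((∏ i : α, G.entry a' c s' y (.inl (some i)) (τ (.inl (some i)))) *
          ∏ i : {i : ι // i ≠ j}, G.entry a' c s' y (.inr i) (τ (.inr i)))) *
      ((s j).2 t * (starRingEnd ℂ (g t) * G.entry a c s (glue j t y) (.inr j) (σ (.inr j)))) := by
    intro t
    have p1 : ∀ F : ι → ℂ, ∏ i, F i = F j * ∏ i : {i : ι // i ≠ j}, F i := fun F => by
      rw [← Fintype.prod_equiv (Equiv.optionSubtypeNe j) (fun o => F (Equiv.optionSubtypeNe j o)) F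
        (fun _ => rfl), Fintype.prod_option]
      simp
    rw [integrand, p1 fun i => (s i).2 (glue j t y i), Fintype.prod_sum_type, Fintype.prod_option,
      p1 fun i => G.entry a c s (glue j t y) (.inr i) (σ (.inr i)), gj, h0]
    have q0 : G.entry a c s (glue j t y) (.inl none) (.inr j) = starRingEnd ℂ (g t) := by
      simp only [entry, gj]; rfl
    have q1 : ∀ i : α, G.entry a c s (glue j t y) (.inl (some i)) (σ (.inl (some i))) =
        G.entry a' c s' y (.inl (some i)) (τ (.inl (some i))) := by
      intro i
      rw [ha]
      rcases τ _ with k | k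
      · rfl
      · simp only [Sum.map_inr, entry, gi]; rfl
    have q2 : ∀ i : {i : ι // i ≠ j}, G.entry a c s (glue j t y) (.inr i) (σ (.inr i)) =
        G.entry a' c s' y (.inr i) (τ (.inr i)) := by
      intro i
      rw [hi]
      rcases τ _ with k | k
      · simp only [Sum.map_inl, entry, gi]; rfl
      · simp only [Sum.map_inr, entry, gi]; rfl
    simp only [q0, q1, q2, gi]
    ring
  simp only [e1]
  rw [integral_const_mul, ← hy, integrand, Fintype.prod_sum_type, Fintype.prod_option]
  ring

/-- Expansion of the sum of all contractions along one field `Ψ`. -/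
lemma val_option [DecidableEq κ] [DecidableEq ι] (a : Option α → ℝ × OneParticle) (c : κ → ℝ × OneParticle)
    (s : ι → ℝ × C_c(Space, ℂ)) (hs : ∀ i j, i ≠ j → G.Apart (s i).1 (s j).1) :
    G.val a c s = ∑ k, inner ℂ (a none).2 (G.thermal ((c k).1 - (a none).1) (c k).2) *
        G.val (a ∘ some) (fun k' : {k' : κ // k' ≠ k} => c k') s +
      ∑ j, G.val (fun o : Option α =>
        o.elim ((s j).1, absorb (s j).2 (G.thermal ((s j).1 - (a none).1) (a none).2)) (a ∘ some)) c
        (fun i : {i : ι // i ≠ j} => s i) := by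
  classical
  have h := sum_equiv_option (fun e : Option (α ⊕ ι) ≃ κ ⊕ ι =>
    G.term a c s ((optionSumEquiv α ι).trans e))
  have h' : G.val a c s = ∑ e : Option (α ⊕ ι) ≃ κ ⊕ ι,
      G.term a c s ((optionSumEquiv α ι).trans e) :=
    Finset.sum_equiv (Equiv.equivCongr (optionSumEquiv α ι) (Equiv.refl _)) (by simp) fun σ _ => by
      congr 1; ext r; simp
  rw [h', h, Fintype.sum_sum_type]
  congr 1
  · refine Finset.sum_congr rfl fun k _ => ?_
    unfold val
    rw [Finset.mul_sum]
    refine Finset.sum_equiv (Equiv.equivCongr (Equiv.refl _) (sumNeInl k)) (by simp) fun e _ => ?_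
    refine G.val_option_aux_cre a c s k _ _ ?_ ?_
    · simp [optionSumEquiv]
    · intro r
      have : (optionSumEquiv α ι) (Sum.map some id r) = some r := by
        rcases r with i | i <;> rfl
      rw [Equiv.trans_apply, this, Equiv.optionSubtype_symm_apply_apply_some]
      simp only [Equiv.equivCongr_apply_apply, Equiv.refl_symm, Equiv.refl_apply]
      rcases e r with ⟨j | j, hj⟩ <;> rfl
  · refine Finset.sum_congr rfl fun j _ => ?_
    refine Finset.sum_equiv (Equiv.equivCongr (sumMove j) (sumNeInr j)) (by simp) fun e _ => ?_
    have key : ∀ z : {z : κ ⊕ ι // z ≠ .inr j}, z.1 = Sum.map id (↑) (sumNeInr j z) := by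
      rintro ⟨k | k, hk⟩ <;> rfl
    refine G.val_option_aux_sq a c s hs j _ _ ?_ ?_ ?_ ?_
    · simp [optionSumEquiv]
    · have h1 : (sumMove j).symm (.inl (none : Option α)) = .inr j := rfl
      have h2 : optionSumEquiv α ι (.inr j) = some (.inr j) := rfl
      rw [Equiv.trans_apply, h2, Equiv.optionSubtype_symm_apply_apply_some,
        Equiv.equivCongr_apply_apply, h1, key]
    · intro i
      have h1 : (sumMove j).symm (.inl (some i)) = .inl i := rfl
      have h2 : optionSumEquiv α ι (.inl (some i)) = some (.inl i) := rfl
      rw [Equiv.trans_apply, h2, Equiv.optionSubtype_symm_apply_apply_some,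
        Equiv.equivCongr_apply_apply, h1, key]
    · intro i
      have h1 : (sumMove j).symm (.inr i : Option α ⊕ _) = .inr i.1 := rfl
      have h2 : optionSumEquiv α ι (.inr i.1) = some (.inr i.1) := rfl
      rw [Equiv.trans_apply, h2, Equiv.optionSubtype_symm_apply_apply_some,
        Equiv.equivCongr_apply_apply, h1, key]

end Absorption

section Conj

variable {α κ ι : Type*}

/-- The propagators are self-adjoint, so conjugation exchanges Ψ with Ψ*. Negating all times
restores the differences once the roles are exchanged. -/
lemma entry_conj (a : α → ℝ × OneParticle) (c : κ → ℝ × OneParticle)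
    (s : ι → ℝ × C_c(Space, ℂ)) (x : ι → Space) (r : α ⊕ ι) (y : κ ⊕ ι) :
    starRingEnd ℂ (G.entry a c s x r y) = G.entry (fun k => (-(c k).1, (c k).2))
      (fun i => (-(a i).1, (a i).2)) (fun j => (-(s j).1, star (s j).2)) x y r := by
  rcases r with i | i <;> rcases y with j | j
  · simp only [entry]
    rw [inner_conj_symm, inner_thermal, show -(a i).1 - -(c j).1 = (c j).1 - (a i).1 by ring]
  · simp only [entry]
    rw [Complex.conj_conj, show -(a i).1 - -(s j).1 = (s j).1 - (a i).1 by ring]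
  · simp only [entry]
    rw [show -(s i).1 - -(c j).1 = (c j).1 - (s i).1 by ring]
  · simp only [entry]
    rw [star_kernel, neg_sub, lag_neg]

variable [Fintype α] [Fintype κ] [Fintype ι]

lemma val_conj (a : α → ℝ × OneParticle) (c : κ → ℝ × OneParticle)
    (s : ι → ℝ × C_c(Space, ℂ)) :
    starRingEnd ℂ (G.val a c s) = G.val (fun k => (-(c k).1, (c k).2))
      (fun i => (-(a i).1, (a i).2)) (fun j => (-(s j).1, star (s j).2)) := by
  classical
  rw [val, map_sum]
  -- With rows and columns exchanged, a pairing becomes its inverse.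
  refine Fintype.sum_equiv (Equiv.symmEquiv _ _) _ _ fun σ => ?_
  rw [term]
  refine (integral_conj (𝕜 := ℂ)).symm.trans (integral_congr_ae (ae_of_all _ fun x => ?_))
  simp only [integrand, map_mul, map_prod, entry_conj]
  congr 1
  refine Fintype.prod_equiv σ _ _ fun r => ?_
  simp

end Conj

end BoseGas

/-! ### The free state on commuting polynomials -/

section Families

/-- Fibres over each value have equal cardinality. This frees `gauss` from the enumeration of the
generators of a monomial that enters its definition. -/
lemma exists_equiv_of_map_univ_eq {ι ι' F : Type*} [Fintype ι] [Fintype ι'] (g : ι → F) (g' : ι' → F)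
    (h : Finset.univ.val.map g = Finset.univ.val.map g') : ∃ e : ι ≃ ι', g' ∘ e = g := by
  classical
  have hc : ∀ x, Nonempty ({i // g i = x} ≃ {i // g' i = x}) := by
    intro x
    refine ⟨Fintype.equivOfCardEq ?_⟩
    have := congrArg (Multiset.count x) h
    rw [Multiset.count_map, Multiset.count_map] at this
    rw [Fintype.card_subtype, Fintype.card_subtype]
    simpa [Finset.card_def, eq_comm] using this
  let e := fun x => (hc x).some
  exact ⟨Equiv.ofFiberEquiv e, funext fun i => Equiv.ofFiberEquiv_map e i⟩

lemma Derivation.map_prod_eq_sum {ι R A : Type*} [DecidableEq ι] [CommSemiring R] [CommSemiring A]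
    [Algebra R A] (D : Derivation R A A) (s : Finset ι) (f : ι → A) :
    D (∏ i ∈ s, f i) = ∑ i ∈ s, (∏ j ∈ s.erase i, f j) * D (f i) := by
  induction s using Finset.induction_on with
  | empty => simp
  | insert a s ha ih =>
    rw [Finset.prod_insert ha, D.leibniz, ih, Finset.sum_insert ha, Finset.erase_insert ha,
      smul_eq_mul, smul_eq_mul, Finset.mul_sum, add_comm]
    congr 1
    refine Finset.sum_congr rfl fun i hi => ?_
    have hne : a ≠ i := fun h => ha (h ▸ hi)
    rw [Finset.erase_insert_of_ne hne, Finset.prod_insert (fun h => ha (Finset.mem_of_mem_erase h)),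
      mul_assoc]

end Families

namespace FieldGen

/-- The generator is a field `Ψ`. -/
def IsAnn : FieldGen → Prop
  | ann _ _ => True
  | cre _ _ => False
  | sq _ _ => False

/-- The generator is a field `Ψ*`. -/
def IsCre : FieldGen → Prop
  | ann _ _ => False
  | cre _ _ => True
  | sq _ _ => False

/-- Time and smearing function of a linear field. -/
def linData : FieldGen → ℝ × OneParticle
  | ann u f => (u, f)
  | cre u h => (u, h)
  | sq u _ => (u, 0)

/-- Time and smearing function of a Wick square. -/
def sqData : FieldGen → ℝ × C_c(Space, ℂ)
  | ann u _ => (u, 0)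
  | cre u _ => (u, 0)
  | sq u g => (u, g)

/-- The generator `Ψ(f)` at time `u`, from the pair `(u, f)`. -/
def mkAnn (a : ℝ × OneParticle) : FieldGen := ann a.1 a.2

/-- The generator `Ψ*(h)` at time `u`, from the pair `(u, h)`. -/
def mkCre (a : ℝ × OneParticle) : FieldGen := cre a.1 a.2

/-- The Wick square at time `u` with weight `g`, from the pair `(u, g)`. -/
def mkSq (a : ℝ × C_c(Space, ℂ)) : FieldGen := sq a.1 a.2

lemma IsAnn.mkAnn_eq {g : FieldGen} (h : g.IsAnn) : mkAnn g.linData = g := by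
  cases g
  · rfl
  · exact h.elim
  · exact h.elim

lemma IsCre.mkCre_eq {g : FieldGen} (h : g.IsCre) : mkCre g.linData = g := by
  cases g
  · exact h.elim
  · rfl
  · exact h.elim

lemma IsSq.mkSq_eq {g : FieldGen} (h : g.IsSq) : mkSq g.sqData = g := by
  cases g
  · exact h.elim
  · exact h.elim
  · rfl

/-- Brings a product into the normal form fields Ψ, fields Ψ*, squares, on which `gauss` is given by
`val`. -/
lemma prod_split {ι M : Type*} [Fintype ι] [CommMonoid M] (g : ι → FieldGen) (F : FieldGen → M)
    [Fintype {i // (g i).IsAnn}] [Fintype {i // (g i).IsCre}] [Fintype {i // (g i).IsSq}] :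
    ∏ i, F (g i) = (∏ i : {i // (g i).IsAnn}, F (mkAnn (g i).linData)) *
      (∏ i : {i // (g i).IsCre}, F (mkCre (g i).linData)) *
      ∏ i : {i // (g i).IsSq}, F (mkSq (g i).sqData) := by
  classical
  have h1 : ∏ i : {i // (g i).IsAnn}, F (mkAnn (g i).linData) =
      ∏ i with (g i).IsAnn, F (g i) := by
    rw [Finset.prod_subtype (p := fun i => (g i).IsAnn) _ (by simp)]
    exact Finset.prod_congr rfl fun i _ => by rw [i.2.mkAnn_eq]
  have h2 : ∏ i : {i // (g i).IsCre}, F (mkCre (g i).linData) =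
      ∏ i with (g i).IsCre, F (g i) := by
    rw [Finset.prod_subtype (p := fun i => (g i).IsCre) _ (by simp)]
    exact Finset.prod_congr rfl fun i _ => by rw [i.2.mkCre_eq]
  have h3 : ∏ i : {i // (g i).IsSq}, F (mkSq (g i).sqData) =
      ∏ i with (g i).IsSq, F (g i) := by
    rw [Finset.prod_subtype (p := fun i => (g i).IsSq) _ (by simp)]
    exact Finset.prod_congr rfl fun i _ => by rw [i.2.mkSq_eq]
  rw [h1, h2, h3, Finset.prod_filter, Finset.prod_filter, Finset.prod_filter,
    ← Finset.prod_mul_distrib, ← Finset.prod_mul_distrib]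
  refine Finset.prod_congr rfl fun i _ => ?_
  cases g i <;> simp [IsAnn, IsCre, IsSq]

end FieldGen

namespace BoseGas

variable (G : BoseGas)

open FieldGen

section Gaussian

open Classical in
/-- The sum of all contractions of a family of generators, irrespective of their order. -/
def gval {ι : Type*} [Fintype ι] (g : ι → FieldGen) : ℂ :=
  G.val (fun i : {i // (g i).IsAnn} => (g i).linData) (fun i : {i // (g i).IsCre} => (g i).linData)
    (fun i : {i // (g i).IsSq} => (g i).sqData)

lemma gval_reindex {ι ι' : Type*} [Fintype ι] [Fintype ι'] (g : ι → FieldGen) (e : ι' ≃ ι) :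
    G.gval (g ∘ e) = G.gval g := by
  classical
  exact G.val_reindex (fun i : {i // (g i).IsAnn} => (g i).linData)
    (fun i : {i // (g i).IsCre} => (g i).linData) (fun i : {i // (g i).IsSq} => (g i).sqData)
    (e.subtypeEquiv fun _ => Iff.rfl) (e.subtypeEquiv fun _ => Iff.rfl)
    (e.subtypeEquiv fun _ => Iff.rfl)

/-- The polynomial functional of the free state on commuting generators. -/
def gauss : MvPolynomial FieldGen ℂ →ₗ[ℂ] ℂ :=
  (MvPolynomial.basisMonomials FieldGen ℂ).constr ℂ
    fun m => G.gval (Finsupp.toMultiset m).toList.get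

lemma gauss_prod {ι : Type*} [Fintype ι] (g : ι → FieldGen) :
    G.gauss (∏ i, MvPolynomial.X (g i)) = G.gval g := by
  classical
  have h1 : ∏ i, MvPolynomial.X (g i) =
      MvPolynomial.basisMonomials FieldGen ℂ (∑ i, Finsupp.single (g i) 1) := by
    exact (MvPolynomial.monomial_sum_one Finset.univ fun i => Finsupp.single (g i) 1).symm
  rw [h1, gauss, Module.Basis.constr_basis]
  obtain ⟨e, he⟩ := exists_equiv_of_map_univ_eq g
    (Finsupp.toMultiset (∑ i, Finsupp.single (g i) 1)).toList.get (by
      rw [Fin.univ_val_map, List.ofFn_get, Multiset.coe_toList, map_sum]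
      simp only [Finsupp.toMultiset_single, one_smul]
      exact ((congrArg Multiset.sum (Multiset.map_map (fun a => ({a} : Multiset FieldGen)) g _).symm
        ).trans (Multiset.sum_map_singleton _)).symm)
  rw [← G.gval_reindex _ e, he]

variable {α κ ι : Type*} [Fintype α] [Fintype κ] [Fintype ι]

lemma gauss_eq_val (a : α → ℝ × OneParticle) (c : κ → ℝ × OneParticle)
    (s : ι → ℝ × C_c(Space, ℂ)) :
    G.gauss ((∏ i, MvPolynomial.X (mkAnn (a i))) * (∏ i, MvPolynomial.X (mkCre (c i))) *
      ∏ i, MvPolynomial.X (mkSq (s i))) = G.val a c s := by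
  classical
  let g : (α ⊕ κ) ⊕ ι → FieldGen :=
    Sum.elim (Sum.elim (fun i => mkAnn (a i)) (fun i => mkCre (c i))) (fun i => mkSq (s i))
  have h := G.gauss_prod g
  rw [Fintype.prod_sum_type, Fintype.prod_sum_type] at h
  refine h.trans ?_
  let ea : α ≃ {i // (g i).IsAnn} := Equiv.ofBijective (fun i => ⟨.inl (.inl i), trivial⟩) (by
    constructor
    · intro i j hij; simpa using congrArg Subtype.val hij
    · rintro ⟨(i | i) | i, hi⟩
      · exact ⟨i, rfl⟩
      · exact hi.elim
      · exact hi.elim)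
  let ec : κ ≃ {i // (g i).IsCre} := Equiv.ofBijective (fun i => ⟨.inl (.inr i), trivial⟩) (by
    constructor
    · intro i j hij; simpa using congrArg Subtype.val hij
    · rintro ⟨(i | i) | i, hi⟩
      · exact hi.elim
      · exact ⟨i, rfl⟩
      · exact hi.elim)
  let es : ι ≃ {i // (g i).IsSq} := Equiv.ofBijective (fun i => ⟨.inr i, trivial⟩) (by
    constructor
    · intro i j hij; simpa using congrArg Subtype.val hij
    · rintro ⟨(i | i) | i, hi⟩
      · exact hi.elim
      · exact hi.elim
      · exact ⟨i, rfl⟩)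
  exact (G.val_reindex (fun i : {i // (g i).IsAnn} => (g i).linData)
    (fun i : {i // (g i).IsCre} => (g i).linData) (fun i : {i // (g i).IsSq} => (g i).sqData)
    ea ec es).symm

/-- Contraction of a field `Ψ(f)` at time `u` with one generator. -/
def contract (u : ℝ) (f : OneParticle) :
    Derivation ℂ (MvPolynomial FieldGen ℂ) (MvPolynomial FieldGen ℂ) :=
  MvPolynomial.mkDerivation ℂ fun g => match g with
    | .ann _ _ => 0
    | .cre v h => MvPolynomial.C (inner ℂ f (G.thermal (v - u) h))
    | .sq v w => MvPolynomial.X (.ann v (absorb w (G.thermal (v - u) f)))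

lemma contract_X (u : ℝ) (f : OneParticle) (g : FieldGen) :
    G.contract u f (MvPolynomial.X g) = match g with
    | .ann _ _ => 0
    | .cre v h => MvPolynomial.C (inner ℂ f (G.thermal (v - u) h))
    | .sq v w => MvPolynomial.X (.ann v (absorb w (G.thermal (v - u) f))) :=
  MvPolynomial.mkDerivation_X _ _ _

lemma contract_ann (u : ℝ) (f : OneParticle) (a : ℝ × OneParticle) :
    G.contract u f (MvPolynomial.X (mkAnn a)) = 0 := G.contract_X u f (mkAnn a)

lemma contract_cre (u : ℝ) (f : OneParticle) (c : ℝ × OneParticle) :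
    G.contract u f (MvPolynomial.X (mkCre c)) =
      MvPolynomial.C (inner ℂ f (G.thermal (c.1 - u) c.2)) := G.contract_X u f (mkCre c)

lemma contract_sq (u : ℝ) (f : OneParticle) (s : ℝ × C_c(Space, ℂ)) :
    G.contract u f (MvPolynomial.X (mkSq s)) =
      MvPolynomial.X (mkAnn (s.1, absorb s.2 (G.thermal (s.1 - u) f))) := G.contract_X u f (mkSq s)

lemma prod_erase_eq_prod_ne {M β : Type*} [CommMonoid M] [Fintype β] [DecidableEq β] (j : β)
    (F : β → M) : ∏ i ∈ Finset.univ.erase j, F i = ∏ i : {i // i ≠ j}, F i :=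
  Finset.prod_subtype _ (by simp) _

lemma gauss_ann_mul_eq_val (b : ℝ × OneParticle) (a : α → ℝ × OneParticle)
    (c : κ → ℝ × OneParticle) (s : ι → ℝ × C_c(Space, ℂ)) :
    G.gauss (MvPolynomial.X (mkAnn b) * ((∏ i, MvPolynomial.X (mkAnn (a i))) *
      (∏ i, MvPolynomial.X (mkCre (c i))) * ∏ i, MvPolynomial.X (mkSq (s i)))) =
    G.val (fun o : Option α => o.elim b a) c s := by
  rw [← G.gauss_eq_val, Fintype.prod_option, ← mul_assoc, ← mul_assoc]
  rfl

lemma val_elim [DecidableEq κ] [DecidableEq ι] (b : ℝ × OneParticle) (a : α → ℝ × OneParticle)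
    (c : κ → ℝ × OneParticle) (s : ι → ℝ × C_c(Space, ℂ))
    (hs : ∀ i j, i ≠ j → G.Apart (s i).1 (s j).1) :
    G.val (fun o : Option α => o.elim b a) c s =
      ∑ k, inner ℂ b.2 (G.thermal ((c k).1 - b.1) (c k).2) *
        G.val a (fun k' : {k' : κ // k' ≠ k} => c k') s +
      ∑ j, G.val (fun o : Option α =>
        o.elim ((s j).1, absorb (s j).2 (G.thermal ((s j).1 - b.1) b.2)) a) c
        (fun i : {i : ι // i ≠ j} => s i) :=
  G.val_option (fun o : Option α => o.elim b a) c s hs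

/-- The Leibniz rule reproduces the two sums of `val_option`: a factor Ψ* is replaced by a number, a
square by the field Ψ that absorbs it, and a factor Ψ contributes nothing. -/
lemma gauss_contract (b : ℝ × OneParticle) (a : α → ℝ × OneParticle)
    (c : κ → ℝ × OneParticle) (s : ι → ℝ × C_c(Space, ℂ)) [DecidableEq α] [DecidableEq κ]
    [DecidableEq ι] :
    G.gauss (G.contract b.1 b.2 ((∏ i, MvPolynomial.X (mkAnn (a i))) *
      (∏ i, MvPolynomial.X (mkCre (c i))) * ∏ i, MvPolynomial.X (mkSq (s i)))) =
    ∑ k, inner ℂ b.2 (G.thermal ((c k).1 - b.1) (c k).2) *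
        G.gauss ((∏ i, MvPolynomial.X (mkAnn (a i))) *
          (∏ i : {k' : κ // k' ≠ k}, MvPolynomial.X (mkCre (c i))) * ∏ i, MvPolynomial.X (mkSq (s i))) +
      ∑ j, G.gauss (MvPolynomial.X
          (mkAnn ((s j).1, absorb (s j).2 (G.thermal ((s j).1 - b.1) b.2))) *
        ((∏ i, MvPolynomial.X (mkAnn (a i))) * (∏ i, MvPolynomial.X (mkCre (c i))) *
          ∏ i : {i : ι // i ≠ j}, MvPolynomial.X (mkSq (s i)))) := by
  have hA : G.contract b.1 b.2 (∏ i, MvPolynomial.X (mkAnn (a i))) = 0 := by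
    rw [Derivation.map_prod_eq_sum]
    refine Finset.sum_eq_zero fun i _ => ?_
    rw [contract_ann, mul_zero]
  have h : G.contract b.1 b.2 ((∏ i, MvPolynomial.X (mkAnn (a i))) *
      (∏ i, MvPolynomial.X (mkCre (c i))) * ∏ i, MvPolynomial.X (mkSq (s i))) =
      ∑ k, MvPolynomial.C (inner ℂ b.2 (G.thermal ((c k).1 - b.1) (c k).2)) *
        ((∏ i, MvPolynomial.X (mkAnn (a i))) *
          (∏ i : {k' : κ // k' ≠ k}, MvPolynomial.X (mkCre (c i))) * ∏ i, MvPolynomial.X (mkSq (s i))) +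
      ∑ j, MvPolynomial.X
          (mkAnn ((s j).1, absorb (s j).2 (G.thermal ((s j).1 - b.1) b.2))) *
        ((∏ i, MvPolynomial.X (mkAnn (a i))) * (∏ i, MvPolynomial.X (mkCre (c i))) *
          ∏ i : {i : ι // i ≠ j}, MvPolynomial.X (mkSq (s i))) := by
    rw [Derivation.leibniz, Derivation.leibniz, hA, Derivation.map_prod_eq_sum,
      Derivation.map_prod_eq_sum, smul_zero, add_zero]
    simp only [smul_eq_mul, Finset.mul_sum, contract_sq, contract_cre, prod_erase_eq_prod_ne]
    rw [add_comm]
    refine congrArg₂ (· + ·) (Finset.sum_congr rfl fun k _ => ?_) (Finset.sum_congr rfl fun j _ => ?_)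
    · generalize ∏ i, (MvPolynomial.X (mkAnn (a i)) : MvPolynomial FieldGen ℂ) = A
      ring
    · generalize ∏ i, (MvPolynomial.X (mkAnn (a i)) : MvPolynomial FieldGen ℂ) = A
      ring
  rw [h, map_add, map_sum, map_sum]
  refine congrArg₂ (· + ·) (Finset.sum_congr rfl fun k _ => ?_) rfl
  rw [← MvPolynomial.smul_eq_C_mul, map_smul, smul_eq_mul]

lemma gauss_ann_mul_aux (b : ℝ × OneParticle) (a : α → ℝ × OneParticle)
    (c : κ → ℝ × OneParticle) (s : ι → ℝ × C_c(Space, ℂ))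
    (hs : ∀ i j, i ≠ j → G.Apart (s i).1 (s j).1) :
    G.gauss (MvPolynomial.X (mkAnn b) * ((∏ i, MvPolynomial.X (mkAnn (a i))) *
      (∏ i, MvPolynomial.X (mkCre (c i))) * ∏ i, MvPolynomial.X (mkSq (s i)))) =
    G.gauss (G.contract b.1 b.2 ((∏ i, MvPolynomial.X (mkAnn (a i))) *
      (∏ i, MvPolynomial.X (mkCre (c i))) * ∏ i, MvPolynomial.X (mkSq (s i)))) := by
  classical
  rw [gauss_contract, gauss_ann_mul_eq_val, val_elim _ _ _ _ _ hs]
  simp only [gauss_ann_mul_eq_val, gauss_eq_val]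

/-- Expansion of the free state along a field `Ψ`. -/
lemma gauss_ann_mul_prod {β : Type*} [Fintype β] (u : ℝ) (f : OneParticle) (g : β → FieldGen)
    (hg : ∀ i j, i ≠ j → (g i).IsSq → (g j).IsSq → G.Apart (g i).time (g j).time) :
    G.gauss (MvPolynomial.X (.ann u f) * ∏ i, MvPolynomial.X (g i)) =
      G.gauss (G.contract u f (∏ i, MvPolynomial.X (g i))) := by
  classical
  rw [prod_split g]
  refine G.gauss_ann_mul_aux (u, f) _ _ _ fun i j hij => ?_
  have h := hg i j (fun h => hij (Subtype.ext h)) i.2 j.2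
  have ht : ∀ g : FieldGen, g.sqData.1 = g.time := fun g => by cases g <;> rfl
  rwa [ht, ht]

end Gaussian

section Adjoint

/-- The adjoint of a generator. -/
def _root_.FieldGen.adj : FieldGen → FieldGen
  | .ann u f => .cre (-u) f
  | .cre u h => .ann (-u) h
  | .sq u g => .sq (-u) (star g)

/-- The adjoint of a polynomial in commuting generators. -/
def adj : MvPolynomial FieldGen ℂ →+* MvPolynomial FieldGen ℂ :=
  MvPolynomial.eval₂Hom (MvPolynomial.C.comp (starRingEnd ℂ)) fun g => MvPolynomial.X g.adj

lemma adj_X (g : FieldGen) : adj (MvPolynomial.X g) = MvPolynomial.X g.adj :=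
  MvPolynomial.eval₂Hom_X' _ _ _

lemma adj_C (z : ℂ) : adj (MvPolynomial.C z) = MvPolynomial.C (starRingEnd ℂ z) :=
  MvPolynomial.eval₂Hom_C _ _ _

/-- Allows every expansion along Ψ* to be read off from one along Ψ. -/
lemma gauss_adj (p : MvPolynomial FieldGen ℂ) : G.gauss (adj p) = starRingEnd ℂ (G.gauss p) := by
  classical
  induction p using MvPolynomial.induction_on' with
  | add p q hp hq => rw [map_add, map_add, map_add, map_add, hp, hq]
  | monomial m z =>
    let g := (Finsupp.toMultiset m).toList.get
    have h1 : MvPolynomial.monomial m z = MvPolynomial.C z * ∏ i, MvPolynomial.X (g i) := by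
      have h2 : ∏ i, MvPolynomial.X (g i) =
          ((Finsupp.toMultiset m).map (MvPolynomial.X (R := ℂ))).prod := by
        refine (congrArg Multiset.prod (Multiset.map_map (MvPolynomial.X (R := ℂ)) g _).symm).trans ?_
        rw [Fin.univ_val_map, List.ofFn_get, Multiset.coe_toList]
      rw [h2, MvPolynomial.monomial_eq, Finsupp.toMultiset_map, Finsupp.prod_toMultiset,
        Finsupp.prod_mapDomain_index (by simp) (fun _ _ _ => pow_add _ _ _)]
    have h3 := prod_split g (MvPolynomial.X (R := ℂ))
    rw [h1, h3, map_mul, adj_C, ← MvPolynomial.smul_eq_C_mul, ← MvPolynomial.smul_eq_C_mul,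
      map_smul, map_smul, smul_eq_mul, smul_eq_mul, map_mul (starRingEnd ℂ), G.gauss_eq_val, G.val_conj,
      ← G.gauss_eq_val]
    congr 2
    simp only [map_mul, map_prod, adj_X]
    rw [mul_comm (∏ i, _) (∏ i, _)]
    rfl

end Adjoint

end BoseGas

/-! ### From words in the fields to commuting polynomials -/

namespace FieldGen

lemma linData_fst (a : FieldGen) : a.linData.1 = a.time := by cases a <;> rfl

lemma sqData_fst (a : FieldGen) : a.sqData.1 = a.time := by cases a <;> rfl

lemma IsAnn.hasAnn {a : FieldGen} (h : a.IsAnn) : a.HasAnn := by cases a <;> trivial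

lemma IsSq.hasAnn {a : FieldGen} (h : a.IsSq) : a.HasAnn := by cases a <;> trivial

lemma IsCre.hasCre {a : FieldGen} (h : a.IsCre) : a.HasCre := by cases a <;> trivial

lemma IsSq.hasCre {a : FieldGen} (h : a.IsSq) : a.HasCre := by cases a <;> trivial

lemma IsAnn.not_hasCre {a : FieldGen} (h : a.IsAnn) : ¬ a.HasCre := by
  cases a
  · exact id
  · exact h.elim
  · exact h.elim

lemma IsAnn.not_isSq {a : FieldGen} (h : a.IsAnn) : ¬ a.IsSq := by
  cases a
  · exact id
  · exact h.elim
  · exact h.elim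

lemma IsCre.not_isSq {a : FieldGen} (h : a.IsCre) : ¬ a.IsSq := by
  cases a
  · exact h.elim
  · exact id
  · exact h.elim

/-- The fields `Ψ` of a family of generators. -/
def rowEquiv {ι : Type*} (g : ι → FieldGen) :
    {i // (g i).IsAnn} ⊕ {i // (g i).IsSq} ≃ {i // (g i).HasAnn} :=
  Equiv.ofBijective (Sum.elim (fun i => ⟨i, i.2.hasAnn⟩) (fun i => ⟨i, i.2.hasAnn⟩)) (by
    constructor
    · rintro (i | i) (j | j) h
      · simpa [Subtype.ext_iff] using h
      · have h' : i.1 = j.1 := congrArg Subtype.val h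
        exact (i.2.not_isSq (h' ▸ j.2)).elim
      · have h' : i.1 = j.1 := congrArg Subtype.val h
        exact (j.2.not_isSq (h' ▸ i.2)).elim
      · simpa [Subtype.ext_iff] using h
    · rintro ⟨i, hi⟩
      rcases h : g i with _ | _ | _
      · exact ⟨.inl ⟨i, by rw [h]; trivial⟩, rfl⟩
      · rw [h] at hi; exact hi.elim
      · exact ⟨.inr ⟨i, by rw [h]; trivial⟩, rfl⟩)

/-- The fields `Ψ*` of a family of generators. -/
def colEquiv {ι : Type*} (g : ι → FieldGen) :
    {i // (g i).IsCre} ⊕ {i // (g i).IsSq} ≃ {i // (g i).HasCre} :=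
  Equiv.ofBijective (Sum.elim (fun i => ⟨i, i.2.hasCre⟩) (fun i => ⟨i, i.2.hasCre⟩)) (by
    constructor
    · rintro (i | i) (j | j) h
      · simpa [Subtype.ext_iff] using h
      · have h' : i.1 = j.1 := congrArg Subtype.val h
        exact (i.2.not_isSq (h' ▸ j.2)).elim
      · have h' : i.1 = j.1 := congrArg Subtype.val h
        exact (j.2.not_isSq (h' ▸ i.2)).elim
      · simpa [Subtype.ext_iff] using h
    · rintro ⟨i, hi⟩
      rcases h : g i with _ | _ | _
      · rw [h] at hi; exact hi.elim
      · exact ⟨.inl ⟨i, by rw [h]; trivial⟩, rfl⟩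
      · exact ⟨.inr ⟨i, by rw [h]; trivial⟩, rfl⟩)

end FieldGen

namespace BoseGas

variable (G : BoseGas)

open FieldGen

section Words

lemma contraction_ann_cre (i j : ℕ) {a b : FieldGen} (ha : a.IsAnn) (hb : b.IsCre) (x y : Space) :
    G.contraction i j a b x y =
      inner ℂ a.linData.2 (G.propagator (G.lapse i j a.time b.time) b.linData.2) := by
  rw [← ha.mkAnn_eq, ← hb.mkCre_eq]; rfl

lemma contraction_ann_sq (i j : ℕ) {a b : FieldGen} (ha : a.IsAnn) (hb : b.IsSq) (x y : Space) :
    G.contraction i j a b x y =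
      starRingEnd ℂ (G.propagator (G.lapse i j a.time b.time) a.linData.2 y) := by
  rw [← ha.mkAnn_eq, ← hb.mkSq_eq]; rfl

lemma contraction_sq_cre (i j : ℕ) {a b : FieldGen} (ha : a.IsSq) (hb : b.IsCre) (x y : Space) :
    G.contraction i j a b x y = G.propagator (G.lapse i j a.time b.time) b.linData.2 x := by
  rw [← ha.mkSq_eq, ← hb.mkCre_eq]; rfl

lemma contraction_sq_sq (i j : ℕ) {a b : FieldGen} (ha : a.IsSq) (hb : b.IsSq) (x y : Space) :
    G.contraction i j a b x y = G.kernel (G.lapse i j a.time b.time) (x - y) := by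
  rw [← ha.mkSq_eq, ← hb.mkSq_eq]; rfl

/-- The generators `a`, `b`, in this order, may stand in one word: their times differ, or a
field `Ψ` precedes a field `Ψ*`. -/
def Ordered (a b : FieldGen) : Prop :=
  G.Apart a.time b.time ∨ a.IsAnn ∧ b.IsCre ∧ a.time = b.time

variable {G} in
-- In such a word equal times occur only with Ψ to the left of Ψ*. There the order rule prescribes
-- the lapse 0, which is also the value of the periodic formula, so the order of the word leaves no
-- trace.
lemma lapse_eq_wrap {w : List FieldGen} (hw : w.Pairwise G.Ordered) {i j : Fin w.length}
    (hij : i ≠ j) (hj : (w.get j).HasCre) :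
    G.lapse i j (w.get i).time (w.get j).time = G.wrap ((w.get j).time - (w.get i).time) := by
  rw [List.pairwise_iff_get] at hw
  rcases lt_or_gt_of_ne hij with h | h
  · rcases hw i j h with h' | ⟨-, -, h'⟩
    · rw [lapse, if_neg h'.ne]
    · rw [lapse, if_pos h', if_pos (Fin.lt_def.1 h), h', sub_self, wrap_zero]
  · rcases hw j i h with h' | ⟨h', -, -⟩
    · rw [lapse, if_neg h'.symm.ne]
    · exact (h'.not_hasCre hj).elim

variable {G} in
lemma apart_of_isSq {w : List FieldGen} (hw : w.Pairwise G.Ordered) {i j : Fin w.length}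
    (hij : i ≠ j) (hi : (w.get i).IsSq) (hj : (w.get j).IsSq) :
    G.Apart (w.get i).time (w.get j).time := by
  rw [List.pairwise_iff_get] at hw
  rcases lt_or_gt_of_ne hij with h | h
  · exact (hw i j h).resolve_right fun h' => h'.1.not_isSq hi
  · exact ((hw j i h).resolve_right fun h' => h'.1.not_isSq hj).symm

lemma wordValue_eq_gval (w : List FieldGen) (hw : w.Pairwise G.Ordered) :
    G.wordValue w = G.gval w.get := by
  classical
  unfold gval val
  simp only [term]
  -- In `wordValue` the sum over pairings stands under the integral, in `val` outside; the exchange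
  -- needs every single pairing to be integrable.
  rw [← integral_finsetSum _ fun σ _ => G.integrable_integrand _ _ _ (fun i j hij => by
    rw [sqData_fst, sqData_fst]
    exact apart_of_isSq hw (fun h => hij (Subtype.ext h)) i.2 j.2) σ]
  unfold wordValue
  refine integral_congr_ae (ae_of_all _ fun x => ?_)
  simp only [integrand]
  rw [← Finset.mul_sum]
  congr 1
  · refine Finset.prod_congr rfl fun i _ => ?_
    rw [← i.2.mkSq_eq]; rfl
  · symm
    refine Finset.sum_equiv (Equiv.equivCongr (rowEquiv w.get) (colEquiv w.get)) (by simp)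
      fun σ _ => ?_
    refine Fintype.prod_equiv (rowEquiv w.get) _ _ fun r => ?_
    rw [Equiv.equivCongr_apply_apply, Equiv.symm_apply_apply]
    have hx : ∀ i : {i // (w.get i).IsSq},
        (if h : (w.get i.1).IsSq then x ⟨i.1, h⟩ else 0) = x i := fun i => dif_pos i.2
    rcases r with i | i <;> rcases σ _ with j | j
    · have hij : i.1 ≠ j.1 := fun h => i.2.not_hasCre (h ▸ j.2.hasCre)
      refine Eq.symm ((G.contraction_ann_cre i.1.1 j.1.1 i.2 j.2 _ _).trans ?_)
      rw [lapse_eq_wrap hw hij j.2.hasCre]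
      simp only [entry, linData_fst]; rfl
    · have hij : i.1 ≠ j.1 := fun h => i.2.not_isSq (h ▸ j.2)
      refine Eq.symm ((G.contraction_ann_sq i.1.1 j.1.1 i.2 j.2 _ _).trans ?_)
      rw [lapse_eq_wrap hw hij j.2.hasCre]
      refine Eq.trans (congrArg (fun z => starRingEnd ℂ ((G.propagator _ _ : OneParticle) z)) (hx j)) ?_
      simp only [entry, linData_fst, sqData_fst]; rfl
    · have hij : i.1 ≠ j.1 := fun h => j.2.not_isSq (h ▸ i.2)
      refine Eq.symm ((G.contraction_sq_cre i.1.1 j.1.1 i.2 j.2 _ _).trans ?_)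
      rw [lapse_eq_wrap hw hij j.2.hasCre]
      refine Eq.trans (congrArg (fun z => (G.propagator _ _ : OneParticle) z) (hx i)) ?_
      simp only [entry, linData_fst, sqData_fst]; rfl
    · refine Eq.symm ((G.contraction_sq_sq i.1.1 j.1.1 i.2 j.2 _ _).trans ?_)
      refine Eq.trans (congrArg₂ (fun z z' => G.kernel _ (z - z')) (hx i) (hx j)) ?_
      simp only [entry, sqData_fst]
      congr 1
      -- Inside one square `lapse` takes the branch `i < i`, which fails and yields β, in accordance
      -- with `lag`.
      by_cases hij : i.1 = j.1
      · rw [hij, lag, if_pos rfl, lapse, if_pos rfl, if_neg (lt_irrefl _)]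
      · rw [(apart_of_isSq hw hij i.2 j.2).lag_eq]
        exact lapse_eq_wrap hw hij j.2.hasCre

end Words

section State

lemma state_add (a b : Observable) : G.state (a + b) = G.state a + G.state b := by
  rw [state, MonoidAlgebra.coeff_add]
  exact Finsupp.sum_add_index' (by simp) (fun _ _ _ => add_mul _ _ _)

lemma state_smul (z : ℂ) (a : Observable) : G.state (z • a) = z * G.state a := by
  rw [state, MonoidAlgebra.coeff_smul, Finsupp.sum_smul_index (by simp), state, Finsupp.mul_sum]
  simp only [mul_assoc]

lemma state_of (w : FreeMonoid FieldGen) :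
    G.state (MonoidAlgebra.of ℂ (FreeMonoid FieldGen) w) = G.wordValue w.toList := by
  rw [state, MonoidAlgebra.of_apply, MonoidAlgebra.coeff_single, Finsupp.sum_single_index (by simp),
    one_mul]

/-- The image of an observable among the polynomials in commuting generators. -/
def comm : Observable →ₐ[ℂ] MvPolynomial FieldGen ℂ :=
  MonoidAlgebra.lift ℂ _ _ (FreeMonoid.lift MvPolynomial.X)

lemma comm_obs (g : FieldGen) : comm (obs g) = MvPolynomial.X g := by
  rw [comm, obs, MonoidAlgebra.lift_of, FreeMonoid.lift_eval_of]

lemma comm_of (w : FreeMonoid FieldGen) :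
    comm (MonoidAlgebra.of ℂ (FreeMonoid FieldGen) w) = ∏ i, MvPolynomial.X (w.toList.get i) := by
  rw [comm, MonoidAlgebra.lift_of, FreeMonoid.lift_apply, ← List.prod_ofFn]
  congr 1
  conv_lhs => rw [← List.ofFn_get w.toList]
  rw [List.map_ofFn]; rfl

lemma state_of_ordered (w : FreeMonoid FieldGen) (hw : w.toList.Pairwise G.Ordered) :
    G.state (MonoidAlgebra.of ℂ (FreeMonoid FieldGen) w) =
      G.gauss (comm (MonoidAlgebra.of ℂ (FreeMonoid FieldGen) w)) := by
  rw [state_of, wordValue_eq_gval _ _ hw, comm_of, gauss_prod]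

/-- Linear combinations of words whose letters have the given times. -/
def wordsAt (ts : List ℝ) : Submodule ℂ Observable :=
  Submodule.span ℂ {a | ∃ w : FreeMonoid FieldGen, w.toList.map time = ts ∧
    MonoidAlgebra.of ℂ (FreeMonoid FieldGen) w = a}

lemma one_mem_wordsAt : (1 : Observable) ∈ wordsAt [] :=
  Submodule.subset_span ⟨1, rfl, map_one _⟩

lemma obs_mem_wordsAt (g : FieldGen) : obs g ∈ wordsAt [g.time] :=
  Submodule.subset_span ⟨FreeMonoid.of g, rfl, rfl⟩

lemma mul_mem_wordsAt {a b : Observable} {ts ts' : List ℝ} (ha : a ∈ wordsAt ts)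
    (hb : b ∈ wordsAt ts') : a * b ∈ wordsAt (ts ++ ts') := by
  have h : a * b ∈ wordsAt ts * wordsAt ts' := Submodule.mul_mem_mul ha hb
  rw [wordsAt, wordsAt, Submodule.span_mul_span] at h
  refine Submodule.span_mono ?_ h
  rintro _ ⟨_, ⟨w, hw, rfl⟩, _, ⟨w', hw', rfl⟩, rfl⟩
  refine ⟨w * w', ?_, map_mul _ _ _⟩
  rw [FreeMonoid.toList_mul, List.map_append, hw, hw']

lemma prod_mem_wordsAt {ι : Type*} (l : List ι) (a : ι → Observable) (u : ι → ℝ)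
    (h : ∀ i ∈ l, a i ∈ wordsAt [u i]) : (l.map a).prod ∈ wordsAt (l.map u) := by
  induction l with
  | nil => exact one_mem_wordsAt
  | cons i l ih =>
    rw [List.map_cons, List.map_cons, List.prod_cons]
    have h1 := mul_mem_wordsAt (h i (by simp)) (ih fun j hj => h j (by simp [hj]))
    rwa [List.singleton_append] at h1

/-- Both sides are linear in `b`, and the condition on a word involves only its times once `w₀` is
fixed. So it can be checked on words although the vertices are sums of generators. -/
lemma state_mul_eq_gauss (w₀ : FreeMonoid FieldGen) {ts : List ℝ} {b : Observable}
    (hb : b ∈ wordsAt ts)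
    (h : ∀ w : List FieldGen, w.map time = ts → (w₀.toList ++ w).Pairwise G.Ordered) :
    G.state (MonoidAlgebra.of ℂ (FreeMonoid FieldGen) w₀ * b) =
      G.gauss (comm (MonoidAlgebra.of ℂ (FreeMonoid FieldGen) w₀ * b)) := by
  induction hb using Submodule.span_induction with
  | mem b hb =>
    obtain ⟨w, hw, rfl⟩ := hb
    rw [← map_mul]
    exact G.state_of_ordered _ (h _ hw)
  | zero => rw [mul_zero, map_zero, map_zero]; simp [state]
  | add b c _ _ hb hc => rw [mul_add, state_add, hb, hc, map_add, map_add]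
  | smul z b _ hb => rw [mul_smul_comm, state_smul, hb, map_smul, map_smul, smul_eq_mul]

lemma pairwise_ordered_of_times {w : List FieldGen} (h : (w.map time).Pairwise G.Apart) :
    w.Pairwise G.Ordered :=
  (List.pairwise_map.1 h).imp fun h => Or.inl h

end State

end BoseGas

/-! ### Paths through the vertices, and the expansion of correlation functions -/

section FinsetSums

variable {N : Type*} [DecidableEq N]

/-- Reindexing by T = S ∪ {j}. It joins the first step of a path, to `j`, with the rest of the path,
through `S`, into a path through `T`. -/
lemma sum_sum_powerset_erase (I : Finset N) (Φ : N → Finset N → ℂ) (Z : Finset N → ℂ) :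
    ∑ j ∈ I, ∑ S ∈ (I.erase j).powerset, Φ j S * Z (I.erase j \ S) =
      ∑ T ∈ I.powerset, (∑ j ∈ T, Φ j (T.erase j)) * Z (I \ T) := by
  simp only [Finset.sum_mul]
  rw [Finset.sum_sigma', Finset.sum_sigma']
  refine Finset.sum_bij' (fun x _ => ⟨insert x.1 x.2, x.1⟩) (fun y _ => ⟨y.2, y.1.erase y.2⟩)
    ?_ ?_ ?_ ?_ ?_
  · rintro ⟨j, S⟩ h
    simp only [Finset.mem_sigma, Finset.mem_powerset] at h ⊢
    exact ⟨Finset.insert_subset h.1 (h.2.trans (Finset.erase_subset _ _)), Finset.mem_insert_self _ _⟩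
  · rintro ⟨T, j⟩ h
    simp only [Finset.mem_sigma, Finset.mem_powerset] at h ⊢
    exact ⟨h.1 h.2, Finset.erase_subset_erase _ h.1⟩
  · rintro ⟨j, S⟩ h
    simp only [Finset.mem_sigma, Finset.mem_powerset] at h
    have : j ∉ S := fun hj => Finset.notMem_erase j I (h.2 hj)
    simp [Finset.erase_insert this]
  · rintro ⟨T, j⟩ h
    simp only [Finset.mem_sigma, Finset.mem_powerset] at h
    simp [Finset.insert_erase h.2]
  · rintro ⟨j, S⟩ h
    simp only [Finset.mem_sigma, Finset.mem_powerset] at h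
    have : j ∉ S := fun hj => Finset.notMem_erase j I (h.2 hj)
    simp only [Finset.erase_insert this]
    congr 2
    ext k
    simp only [Finset.mem_sdiff, Finset.mem_erase, Finset.mem_insert]
    tauto

lemma mul_eq_sum_powerset (I : Finset N) (z : ℂ) (Z : Finset N → ℂ) :
    z * Z I = ∑ T ∈ I.powerset, (if T = ∅ then z else 0) * Z (I \ T) := by
  rw [Finset.sum_eq_single ∅]
  · simp
  · intro T _ hT; simp [hT]
  · simp

lemma sum_mul_erase_eq (I : Finset N) (z : N → ℂ) (Z : Finset N → ℂ) :
    ∑ j ∈ I, z j * Z (I.erase j) =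
      ∑ T ∈ I.powerset, (∑ j ∈ T, if T.erase j = ∅ then z j else 0) * Z (I \ T) := by
  rw [← sum_sum_powerset_erase I (fun j S => if S = ∅ then z j else 0) Z]
  exact Finset.sum_congr rfl fun j _ => mul_eq_sum_powerset _ _ _

end FinsetSums

/-- Data of a family of vertices
`p_i Ψ(ḡ_i, u_i) + q_i Ψ*(g_i, u_i) + r_i :|Ψ|²:(g_i, u_i)`. -/
structure Vertices (N : Type*) where
  /-- The imaginary times. -/
  u : N → ℝ
  /-- The smearing functions. -/
  g : N → C_c(Space, ℂ)
  /-- The coefficients of the fields `Ψ`. -/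
  p : N → ℂ
  /-- The coefficients of the fields `Ψ*`. -/
  q : N → ℂ
  /-- The coefficients of the Wick squares. -/
  r : N → ℂ

lemma BoseGas.adj_linear (a b c : ℂ) (x y z : FieldGen) :
    BoseGas.adj (MvPolynomial.C a * MvPolynomial.X x + MvPolynomial.C b * MvPolynomial.X y +
      MvPolynomial.C c * MvPolynomial.X z) =
    MvPolynomial.C (starRingEnd ℂ b) * MvPolynomial.X y.adj +
      MvPolynomial.C (starRingEnd ℂ a) * MvPolynomial.X x.adj +
      MvPolynomial.C (starRingEnd ℂ c) * MvPolynomial.X z.adj := by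
  rw [map_add, map_add, map_mul, map_mul, map_mul, BoseGas.adj_C, BoseGas.adj_C, BoseGas.adj_C,
    BoseGas.adj_X, BoseGas.adj_X, BoseGas.adj_X]
  exact congrArg₂ (· + ·) (add_comm _ _) rfl

namespace Vertices

variable {N : Type*} (V : Vertices N)

/-- A vertex as a polynomial in commuting generators. -/
def poly (i : N) : MvPolynomial FieldGen ℂ :=
  MvPolynomial.C (V.p i) * MvPolynomial.X (.ann (V.u i) (toL2 (star (V.g i)))) +
    MvPolynomial.C (V.q i) * MvPolynomial.X (.cre (V.u i) (toL2 (V.g i))) +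
    MvPolynomial.C (V.r i) * MvPolynomial.X (.sq (V.u i) (V.g i))

/-- A vertex as an observable. -/
def observable (i : N) : Observable :=
  V.p i • obs (.ann (V.u i) (toL2 (star (V.g i)))) + V.q i • obs (.cre (V.u i) (toL2 (V.g i))) +
    V.r i • obs (.sq (V.u i) (V.g i))

lemma comm_observable (i : N) : BoseGas.comm (V.observable i) = V.poly i := by
  simp only [observable, poly, map_add, map_smul, BoseGas.comm_obs, MvPolynomial.smul_eq_C_mul]

lemma observable_mem (i : N) : V.observable i ∈ BoseGas.wordsAt [V.u i] := by
  have h : ∀ (c : ℂ) (a : FieldGen), a.time = V.u i → c • obs a ∈ BoseGas.wordsAt [V.u i] :=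
    fun c a ha => Submodule.smul_mem _ _ (ha ▸ BoseGas.obs_mem_wordsAt a)
  exact Submodule.add_mem _ (Submodule.add_mem _ (h _ _ rfl) (h _ _ rfl)) (h _ _ rfl)

/-- The operator with which a vertex contributes to a chain. -/
def op (i : N) : OneParticle →L[ℂ] OneParticle := V.r i • mulOp (V.g i)

/-- The adjoint vertices. -/
def adj : Vertices N where
  u i := -V.u i
  g i := star (V.g i)
  p i := starRingEnd ℂ (V.q i)
  q i := starRingEnd ℂ (V.p i)
  r i := starRingEnd ℂ (V.r i)

lemma adj_u (i : N) : V.adj.u i = -V.u i := rfl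

lemma adj_g (i : N) : V.adj.g i = star (V.g i) := rfl

lemma adj_p (i : N) : V.adj.p i = starRingEnd ℂ (V.q i) := rfl

lemma adj_q (i : N) : V.adj.q i = starRingEnd ℂ (V.p i) := rfl

lemma adj_r (i : N) : V.adj.r i = starRingEnd ℂ (V.r i) := rfl

lemma adj_poly (i : N) : BoseGas.adj (V.poly i) = V.adj.poly i := by
  rw [poly, poly, BoseGas.adj_linear, adj_u, adj_g, adj_p, adj_q, adj_r, star_star]
  rfl

end Vertices

namespace BoseGas

variable (G : BoseGas) {N : Type*} (V : Vertices N)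

section Chains

/-- The operator `Δ^β(u₁ - s) R₁ Δ^β(u₂ - u₁) ⋯ R_n Δ^β(v - u_n)` for a list of vertices. -/
def chain (v : ℝ) (s : ℝ) : List N → (OneParticle →L[ℂ] OneParticle)
  | [] => G.thermal (v - s)
  | i :: l => G.thermal (V.u i - s) ∘L V.op i ∘L chain v (V.u i) l

open Classical in
/-- The orderings of a finite set. -/
def orderings (S : Finset N) : Finset (List N) := S.val.lists.toFinset

open Classical in
lemma mem_orderings {S : Finset N} {l : List N} : l ∈ orderings S ↔ S.val = l := by
  rw [orderings, Multiset.mem_toFinset, Multiset.mem_lists_iff]; rfl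

/-- The sum of the chains over all orderings of a set of vertices. -/
def chainSum (v s : ℝ) (S : Finset N) : OneParticle →L[ℂ] OneParticle :=
  ∑ l ∈ orderings S, G.chain V v s l

lemma chainSum_empty (v s : ℝ) : G.chainSum V v s ∅ = G.thermal (v - s) := by
  have : orderings (∅ : Finset N) = {[]} := by
    ext l; simp [mem_orderings, eq_comm]
  rw [chainSum, this, Finset.sum_singleton, chain]

variable [DecidableEq N]

/-- Orderings of `S` are classified by their first element. -/
lemma chainSum_of_nonempty (v s : ℝ) {S : Finset N} (hS : S.Nonempty) :
    G.chainSum V v s S =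
      ∑ j ∈ S, G.thermal (V.u j - s) ∘L V.op j ∘L G.chainSum V v (V.u j) (S.erase j) := by
  have h1 : ∀ j ∈ S, G.thermal (V.u j - s) ∘L V.op j ∘L G.chainSum V v (V.u j) (S.erase j) =
      ∑ l ∈ orderings (S.erase j), G.chain V v s (j :: l) := by
    intro j _
    rw [chainSum]
    ext1 h
    simp [chain]
  rw [Finset.sum_congr rfl h1, Finset.sum_sigma', chainSum]
  symm
  refine Finset.sum_bij (fun x _ => x.1 :: x.2) ?_ ?_ ?_ ?_
  · rintro ⟨j, l⟩ h
    simp only [Finset.mem_sigma, mem_orderings] at h ⊢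
    rw [← Multiset.cons_coe, ← h.2, Finset.erase_val, Multiset.cons_erase h.1]
  · rintro ⟨j, l⟩ _ ⟨j', l'⟩ _ h
    simp only [List.cons.injEq] at h
    rw [h.1, h.2]
  · intro l hl
    rw [mem_orderings] at hl
    rcases l with _ | ⟨j, l⟩
    · exact absurd (Finset.val_eq_zero.1 hl) hS.ne_empty
    · have hj : j ∈ S := by rw [← Finset.mem_val, hl]; simp
      refine ⟨⟨j, l⟩, ?_, rfl⟩
      simp only [Finset.mem_sigma, mem_orderings]
      refine ⟨hj, ?_⟩
      rw [Finset.erase_val, hl]; simp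
  · rintro ⟨j, l⟩ _; rfl

/-- The sum of all contractions of a field `Ψ(f)` at time `s` through a set of vertices with a
field `Ψ*(h)` at time `v`. -/
def link (v : ℝ) (h : OneParticle) (s : ℝ) (f : OneParticle) (S : Finset N) : ℂ :=
  inner ℂ f (G.chainSum V v s S h)

/-- The sum of all contractions of a field `Ψ(f)` at time `s` with a field `Ψ*` of one vertex of a
set, through all the other ones. -/
def tail (s : ℝ) (f : OneParticle) (S : Finset N) : ℂ :=
  ∑ k ∈ S, V.q k * G.link V (V.u k) (toL2 (V.g k)) s f (S.erase k)

/-- The smearing function of the field `Ψ` which remains when `Ψ(f)` at time `s` has been contracted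
with a vertex. -/
def absorbAt (s : ℝ) (f : OneParticle) (j : N) : OneParticle :=
  absorb (V.g j) (G.thermal (V.u j - s) f)

lemma inner_absorb_eq (w : C_c(Space, ℂ)) (g h : OneParticle) :
    inner ℂ (absorb w g) h = inner ℂ g (mulOp w h) := inner_mulOp (memLp_top_cc w) g h

/-- The first contraction of Ψ(f) goes straight to Ψ*(h), if no vertex is left to visit, or absorbs
a square `j`. In the inner product absorption amounts to moving Δ^β and the multiplication operator
from the chain onto `f`. -/
lemma link_eq (v : ℝ) (h : OneParticle) (s : ℝ) (f : OneParticle) (S : Finset N) :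
    G.link V v h s f S = (if S = ∅ then inner ℂ f (G.thermal (v - s) h) else 0) +
      ∑ j ∈ S, V.r j * G.link V v h (V.u j) (G.absorbAt V s f j) (S.erase j) := by
  rcases S.eq_empty_or_nonempty with rfl | hS
  · simp [link, chainSum_empty]
  · rw [if_neg hS.ne_empty, zero_add, link, chainSum_of_nonempty G V v s hS]
    rw [sum_apply, inner_sum]
    refine Finset.sum_congr rfl fun j _ => ?_
    rw [link, absorbAt, inner_absorb_eq, inner_thermal, Vertices.op]
    simp [inner_smul_right]

/-- The same recursion when the end `k` of the path is also summed over; choosing the end and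
choosing the first step are interchanged. -/
lemma tail_eq (s : ℝ) (f : OneParticle) (S : Finset N) :
    G.tail V s f S = (∑ j ∈ S, if S.erase j = ∅ then
        V.q j * inner ℂ f (G.thermal (V.u j - s) (toL2 (V.g j))) else 0) +
      ∑ j ∈ S, V.r j * G.tail V (V.u j) (G.absorbAt V s f j) (S.erase j) := by
  have h1 : ∀ k ∈ S, V.q k * G.link V (V.u k) (toL2 (V.g k)) s f (S.erase k) =
      (if S.erase k = ∅ then V.q k * inner ℂ f (G.thermal (V.u k - s) (toL2 (V.g k))) else 0) +
      ∑ j ∈ S.erase k, V.q k * (V.r j * G.link V (V.u k) (toL2 (V.g k)) (V.u j) (G.absorbAt V s f j)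
        ((S.erase k).erase j)) := by
    intro k _
    rw [link_eq, mul_add, Finset.mul_sum, mul_ite, mul_zero]
  rw [tail, Finset.sum_congr rfl h1, Finset.sum_add_distrib]
  congr 1
  simp only [tail, Finset.mul_sum]
  rw [Finset.sum_sigma', Finset.sum_sigma']
  refine Finset.sum_bij' (fun x _ => ⟨x.2, x.1⟩) (fun x _ => ⟨x.2, x.1⟩) ?_ ?_ ?_ ?_ ?_
  · rintro ⟨k, j⟩ h
    simp only [Finset.mem_sigma, Finset.mem_erase] at h ⊢
    exact ⟨h.2.2, h.2.1.symm, h.1⟩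
  · rintro ⟨k, j⟩ h
    simp only [Finset.mem_sigma, Finset.mem_erase] at h ⊢
    exact ⟨h.2.2, h.2.1.symm, h.1⟩
  · rintro ⟨k, j⟩ _; rfl
  · rintro ⟨k, j⟩ _; rfl
  · rintro ⟨k, j⟩ _
    simp only
    rw [Finset.erase_right_comm]
    ring

end Chains

section Expansion

/-- The vertices of a set are at times which differ modulo `β`. -/
def ApartOn (I : Finset N) : Prop := ∀ i ∈ I, ∀ j ∈ I, i ≠ j → G.Apart (V.u i) (V.u j)

lemma poly_eq_sum (i : N) : V.poly i = ∑ k : Fin 3, MvPolynomial.C (![V.p i, V.q i, V.r i] k) *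
    MvPolynomial.X (![.ann (V.u i) (toL2 (star (V.g i))), .cre (V.u i) (toL2 (V.g i)),
      .sq (V.u i) (V.g i)] k) := by
  simp [Fin.sum_univ_three, Vertices.poly]

variable {V} {G} in
lemma ApartOn.mono {I J : Finset N} (hI : G.ApartOn V I) (h : J ⊆ I) : G.ApartOn V J :=
  fun i hi j hj => hI i (h hi) j (h hj)

lemma contract_poly (s : ℝ) (f : OneParticle) (i : N) :
    G.contract s f (V.poly i) =
      MvPolynomial.C (V.q i * inner ℂ f (G.thermal (V.u i - s) (toL2 (V.g i)))) +
        MvPolynomial.C (V.r i) * MvPolynomial.X (.ann (V.u i) (G.absorbAt V s f i)) := by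
  have h1 := G.contract_ann s f (V.u i, toL2 (star (V.g i)))
  have h2 := G.contract_cre s f (V.u i, toL2 (V.g i))
  have h3 := G.contract_sq s f (V.u i, V.g i)
  simp only [FieldGen.mkAnn, FieldGen.mkCre, FieldGen.mkSq] at h1 h2 h3
  simp only [Vertices.poly, ← MvPolynomial.smul_eq_C_mul, map_add, Derivation.map_smul, h1, h2, h3, smul_zero,
    zero_add, absorbAt]
  rw [MvPolynomial.smul_eq_C_mul, ← map_mul]

variable [DecidableEq N]

/-- Multilinear expansion of the vertices reduces this to products of generators. Each vertex
contributes one generator, so two squares in a product come from different vertices, at times apart.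
-/
lemma gauss_ann_mul_prod_poly {κ : Type*} [Fintype κ] (s : ℝ) (f : OneParticle)
    (c : κ → ℝ × OneParticle) {I : Finset N} (hI : G.ApartOn V I) :
    G.gauss (MvPolynomial.X (.ann s f) *
      ((∏ k, MvPolynomial.X (FieldGen.mkCre (c k))) * ∏ i ∈ I, V.poly i)) =
    G.gauss (G.contract s f
      ((∏ k, MvPolynomial.X (FieldGen.mkCre (c k))) * ∏ i ∈ I, V.poly i)) := by
  rw [← Finset.prod_coe_sort I]
  simp only [poly_eq_sum]
  rw [Finset.prod_univ_sum, Finset.mul_sum, Finset.mul_sum, map_sum, map_sum, map_sum]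
  refine Finset.sum_congr rfl fun t _ => ?_
  rw [Finset.prod_mul_distrib, ← map_prod, mul_left_comm _ (MvPolynomial.C _), mul_left_comm _
    (MvPolynomial.C _), ← MvPolynomial.smul_eq_C_mul, ← MvPolynomial.smul_eq_C_mul, map_smul,
    Derivation.map_smul, map_smul]
  congr 1
  let g : κ ⊕ I → FieldGen := Sum.elim (fun k => FieldGen.mkCre (c k)) fun i =>
    ![.ann (V.u i) (toL2 (star (V.g i))), .cre (V.u i) (toL2 (V.g i)), .sq (V.u i) (V.g i)] (t i)
  have h := G.gauss_ann_mul_prod s f g ?_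
  · rwa [Fintype.prod_sum_type] at h
  · have ht : ∀ i : I, (g (.inr i)).time = V.u i := by
      intro i
      have : ∀ k : Fin 3, FieldGen.time ((![.ann (V.u i) (toL2 (star (V.g i))),
          .cre (V.u i) (toL2 (V.g i)), .sq (V.u i) (V.g i)] : Fin 3 → FieldGen) k) = V.u i := by
        intro k
        fin_cases k <;> rfl
      exact this (t i)
    rintro (k | i) (l | j) hij hi hj
    · exact hi.elim
    · exact hi.elim
    · exact hj.elim
    · rw [ht, ht]
      exact hI i i.2 j j.2 fun h => hij (by rw [Subtype.ext h])

lemma gauss_ann_mul_step {κ : Type*} [Fintype κ] (s : ℝ) (f : OneParticle)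
    (c : κ → ℝ × OneParticle) {I : Finset N} (hI : G.ApartOn V I) :
    G.gauss (MvPolynomial.X (.ann s f) *
      ((∏ k, MvPolynomial.X (FieldGen.mkCre (c k))) * ∏ i ∈ I, V.poly i)) =
    G.gauss (G.contract s f (∏ k, MvPolynomial.X (FieldGen.mkCre (c k))) * ∏ i ∈ I, V.poly i) +
    ((∑ j ∈ I, (V.q j * inner ℂ f (G.thermal (V.u j - s) (toL2 (V.g j)))) *
      G.gauss ((∏ k, MvPolynomial.X (FieldGen.mkCre (c k))) * ∏ i ∈ I.erase j, V.poly i)) +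
    ∑ j ∈ I, V.r j * G.gauss (MvPolynomial.X (.ann (V.u j) (G.absorbAt V s f j)) *
      ((∏ k, MvPolynomial.X (FieldGen.mkCre (c k))) * ∏ i ∈ I.erase j, V.poly i))) := by
  rw [gauss_ann_mul_prod_poly G V s f c hI]
  generalize (∏ k, (MvPolynomial.X (FieldGen.mkCre (c k)) : MvPolynomial FieldGen ℂ)) = b
  rw [Derivation.leibniz, Derivation.map_prod_eq_sum, smul_eq_mul, smul_eq_mul, map_add, add_comm,
    mul_comm _ (G.contract s f b)]
  congr 1
  rw [Finset.mul_sum, map_sum, ← Finset.sum_add_distrib]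
  refine Finset.sum_congr rfl fun j _ => ?_
  rw [contract_poly, mul_add, mul_add, map_add]
  congr 1
  · rw [← smul_eq_mul (a := V.q j * _), ← map_smul, MvPolynomial.smul_eq_C_mul]
    congr 1
    ring
  · rw [← smul_eq_mul (a := V.r j), ← map_smul, MvPolynomial.smul_eq_C_mul]
    congr 1
    ring

/-- After one contraction either the path has ended at a linear vertex, or a square has become a new
field Ψ and one vertex fewer remains. The induction therefore runs over all `s` and `f`. -/
lemma gauss_ann_mul (s : ℝ) (f : OneParticle) {I : Finset N} (hI : G.ApartOn V I) :
    G.gauss (MvPolynomial.X (.ann s f) * ∏ i ∈ I, V.poly i) =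
      ∑ S ∈ I.powerset, G.tail V s f S * G.gauss (∏ i ∈ I \ S, V.poly i) := by
  induction I using Finset.strongInduction generalizing s f with
  | H I ih =>
    -- There is no external Ψ* here, so the family of external fields is empty.
    have h := G.gauss_ann_mul_step V s f (fun k : Empty => k.elim) hI
    simp only [Finset.univ_eq_empty, Finset.prod_empty, one_mul, Derivation.map_one_eq_zero,
      zero_mul, map_zero, zero_add] at h
    rw [h, sum_mul_erase_eq I
      (fun j => V.q j * inner ℂ f (G.thermal (V.u j - s) (toL2 (V.g j)))) fun J => G.gauss (∏ i ∈ J, V.poly i)]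
    have h2 : ∀ j ∈ I, V.r j * G.gauss (MvPolynomial.X (.ann (V.u j) (G.absorbAt V s f j)) *
        ∏ i ∈ I.erase j, V.poly i) = ∑ S ∈ (I.erase j).powerset,
          (V.r j * G.tail V (V.u j) (G.absorbAt V s f j) S) *
            G.gauss (∏ i ∈ I.erase j \ S, V.poly i) := by
      intro j hj
      rw [ih _ (Finset.erase_ssubset hj) _ _ (hI.mono (Finset.erase_subset _ _)), Finset.mul_sum]
      simp only [mul_assoc]
    rw [Finset.sum_congr rfl h2, sum_sum_powerset_erase I
      (fun j S => V.r j * G.tail V (V.u j) (G.absorbAt V s f j) S)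
      fun J => G.gauss (∏ i ∈ J, V.poly i), ← Finset.sum_add_distrib]
    refine Finset.sum_congr rfl fun S _ => ?_
    rw [G.tail_eq V s f S, add_mul]

/-- The path from Ψ(f) either reaches Ψ*(h), or ends at a linear vertex and leaves Ψ*(h) to the
remaining vertices. This dichotomy becomes the split into truncated part and product of one-point
functions. -/
lemma gauss_ann_mul_cre_mul (s : ℝ) (f : OneParticle) (v : ℝ) (h : OneParticle) {I : Finset N}
    (hI : G.ApartOn V I) :
    G.gauss (MvPolynomial.X (.ann s f) * (MvPolynomial.X (.cre v h) * ∏ i ∈ I, V.poly i)) =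
      ∑ S ∈ I.powerset, G.link V v h s f S * G.gauss (∏ i ∈ I \ S, V.poly i) +
      ∑ S ∈ I.powerset, G.tail V s f S *
        G.gauss (MvPolynomial.X (.cre v h) * ∏ i ∈ I \ S, V.poly i) := by
  induction I using Finset.strongInduction generalizing s f with
  | H I ih =>
    have h1 := G.gauss_ann_mul_step V s f (fun _ : Unit => (v, h)) hI
    simp only [Finset.univ_unique, Finset.prod_singleton, contract_cre] at h1
    simp only [FieldGen.mkCre] at h1
    rw [← MvPolynomial.smul_eq_C_mul, map_smul, smul_eq_mul] at h1
    rw [h1, sum_mul_erase_eq I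
      (fun j => V.q j * inner ℂ f (G.thermal (V.u j - s) (toL2 (V.g j))))
      (fun J => G.gauss (MvPolynomial.X (FieldGen.cre v h) * ∏ i ∈ J, V.poly i)),
      mul_eq_sum_powerset I _ (fun J => G.gauss (∏ i ∈ J, V.poly i))]
    have h2 : ∀ j ∈ I, V.r j * G.gauss (MvPolynomial.X (.ann (V.u j) (G.absorbAt V s f j)) *
        (MvPolynomial.X (.cre v h) * ∏ i ∈ I.erase j, V.poly i)) =
        ∑ S ∈ (I.erase j).powerset, (V.r j * G.link V v h (V.u j) (G.absorbAt V s f j) S) *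
            G.gauss (∏ i ∈ I.erase j \ S, V.poly i) +
        ∑ S ∈ (I.erase j).powerset, (V.r j * G.tail V (V.u j) (G.absorbAt V s f j) S) *
            G.gauss (MvPolynomial.X (.cre v h) * ∏ i ∈ I.erase j \ S, V.poly i) := by
      intro j hj
      rw [ih _ (Finset.erase_ssubset hj) _ _ (hI.mono (Finset.erase_subset _ _)), mul_add,
        Finset.mul_sum, Finset.mul_sum]
      simp only [mul_assoc]
    rw [Finset.sum_congr rfl h2, Finset.sum_add_distrib, sum_sum_powerset_erase I
      (fun j S => V.r j * G.tail V (V.u j) (G.absorbAt V s f j) S)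
      fun J => G.gauss (MvPolynomial.X (FieldGen.cre v h) * ∏ i ∈ J, V.poly i), sum_sum_powerset_erase I
      (fun j S => V.r j * G.link V v h (V.u j) (G.absorbAt V s f j) S)
      fun J => G.gauss (∏ i ∈ J, V.poly i)]
    simp only [G.tail_eq V s f, G.link_eq V v h s f, add_mul, Finset.sum_add_distrib]
    ring

/-- The sum of all contractions of a field `Ψ*(h)` at time `v` with a field `Ψ` of one vertex of a
set, through all the other ones. -/
def tailStar (v : ℝ) (h : OneParticle) (S : Finset N) : ℂ :=
  starRingEnd ℂ (G.tail V.adj (-v) h S)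

/-- The adjoint of a vertex is again a vertex, with the coefficients of Ψ and Ψ* exchanged and
conjugated, so this is the conjugate of `gauss_ann_mul` for the adjoint vertices. -/
lemma gauss_cre_mul (v : ℝ) (h : OneParticle) {I : Finset N} (hI : G.ApartOn V I) :
    G.gauss (MvPolynomial.X (.cre v h) * ∏ i ∈ I, V.poly i) =
      ∑ S ∈ I.powerset, G.tailStar V v h S * G.gauss (∏ i ∈ I \ S, V.poly i) := by
  have hI' : G.ApartOn V.adj I := fun i hi j hj hij => (hI i hi j hj hij).neg
  have h1 := G.gauss_ann_mul V.adj (-v) h hI'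
  have h2 : ∀ J : Finset N, ∏ i ∈ J, V.adj.poly i = adj (∏ i ∈ J, V.poly i) := by
    intro J
    rw [map_prod]
    exact Finset.prod_congr rfl fun i _ => (V.adj_poly i).symm
  have h3 : adj (MvPolynomial.X (.cre v h)) = MvPolynomial.X (.ann (-v) h) := adj_X _
  simp only [h2, ← h3, ← map_mul, gauss_adj] at h1
  have h4 := congrArg (starRingEnd ℂ) h1
  rw [Complex.conj_conj, map_sum] at h4
  rw [h4]
  refine Finset.sum_congr rfl fun S _ => ?_
  rw [map_mul, Complex.conj_conj, tailStar]

end Expansion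

end BoseGas

/-! ### Partitions and connected correlation functions -/

section Partitions

lemma sum_powerset_map {M N : Type*} (e : M ↪ N) (J : Finset M) (F : Finset N → ℂ) :
    ∑ T ∈ (J.map e).powerset, F T = ∑ S ∈ J.powerset, F (S.map e) := by
  symm
  refine Finset.sum_bij (fun S _ => S.map e) ?_ ?_ ?_ ?_
  · intro S hS
    rw [Finset.mem_powerset] at hS ⊢
    exact Finset.map_subset_map.2 hS
  · intro S _ T _ h
    exact Finset.map_injective e h
  · intro T hT
    obtain ⟨S, hS, rfl⟩ := Finset.subset_map_iff.1 (Finset.mem_powerset.1 hT)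
    exact ⟨S, Finset.mem_powerset.2 hS, rfl⟩
  · intro S _; rfl

variable {N : Type*} [DecidableEq N]

lemma Finpartition.exists_parts_eq_insert {I S : Finset N} {o : N} (hS : S ⊆ I.erase o)
    (ho : o ∈ I) (ρ : Finpartition (I.erase o \ S)) :
    ∃ π : Finpartition I, π.parts = insert (insert o S) ρ.parts := by
  refine ⟨ρ.extend (b := insert o S) (Finset.insert_ne_empty _ _) ?_ ?_, rfl⟩
  · rw [Finset.disjoint_left]
    intro x hx hx'
    simp only [Finset.mem_sdiff, Finset.mem_erase, Finset.mem_insert] at hx hx'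
    tauto
  · ext x
    have := @hS x
    simp only [Finset.sup_eq_union, Finset.mem_union, Finset.mem_sdiff, Finset.mem_erase,
      Finset.mem_insert] at this ⊢
    by_cases hx : x = o
    · subst hx; simp [ho]
    · tauto

lemma Finpartition.exists_parts_eq_erase {I T : Finset N} {o : N} (π : Finpartition I)
    (hT : T ∈ π.parts) (ho : o ∈ T) :
    ∃ ρ : Finpartition (I.erase o \ T.erase o), ρ.parts = π.parts.erase T := by
  refine ⟨π.ofSubset (Finset.erase_subset T _) ?_, rfl⟩
  ext x
  rw [Finset.mem_sup]
  simp only [Finset.mem_erase, Finset.mem_sdiff, id]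
  constructor
  · rintro ⟨J, ⟨hJ, hJ'⟩, hx⟩
    have h : x ∉ T := fun hxT => hJ (π.eq_of_mem_parts hJ' hT hx hxT)
    exact ⟨⟨fun hxo => h (hxo ▸ ho), π.subset hJ' hx⟩, fun h' => h h'.2⟩
  · rintro ⟨⟨hxo, hxI⟩, hxT⟩
    obtain ⟨J, hJ, hx⟩ := π.exists_mem hxI
    exact ⟨J, ⟨fun h => hxT ⟨hxo, h ▸ hx⟩, hJ⟩, hx⟩

/-- Sum over partitions, grouped by the block of one element. -/
lemma sum_finpartition_eq {I : Finset N} {o : N} (ho : o ∈ I) (κ : Finset N → ℂ) :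
    ∑ π : Finpartition I, ∏ J ∈ π.parts, κ J =
      ∑ S ∈ (I.erase o).powerset, κ (insert o S) *
        ∑ ρ : Finpartition (I.erase o \ S), ∏ J ∈ ρ.parts, κ J := by
  simp only [Finset.mul_sum]
  rw [Finset.sum_sigma']
  symm
  have hmem : ∀ {S : Finset N}, ∀ ρ : Finpartition (I.erase o \ S), ∀ J ∈ ρ.parts, o ∉ J := by
    intro S ρ J hJ h
    have := ρ.subset hJ h
    simp at this
  have hex : ∀ x : (S : Finset N) × Finpartition (I.erase o \ S),
      x ∈ (I.erase o).powerset.sigma (fun _ => Finset.univ) →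
      ∃ π : Finpartition I, π.parts = insert (insert o x.1) x.2.parts := fun x hx =>
    Finpartition.exists_parts_eq_insert (by simpa using hx) ho x.2
  refine Finset.sum_bij (fun x hx => (hex x hx).choose) (fun _ _ => Finset.mem_univ _) ?_ ?_ ?_
  · rintro ⟨S, ρ⟩ h ⟨T, ρ'⟩ h' he
    have he' := congrArg Finpartition.parts he
    rw [(hex _ h).choose_spec, (hex _ h').choose_spec] at he'
    have hS : o ∉ S := fun hh => by
      have := (Finset.mem_powerset.1 (Finset.mem_sigma.1 h).1) hh
      simp at this
    have hT : o ∉ T := fun hh => by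
      have := (Finset.mem_powerset.1 (Finset.mem_sigma.1 h').1) hh
      simp at this
    have h1 : insert o S ∈ insert (insert o T) ρ'.parts := he' ▸ Finset.mem_insert_self _ _
    have h2 : insert o S = insert o T := (Finset.mem_insert.1 h1).resolve_right fun h2 =>
      hmem ρ' _ h2 (Finset.mem_insert_self _ _)
    obtain rfl : S = T := by
      rw [← Finset.erase_insert hS, h2, Finset.erase_insert hT]
    have h3 : insert o S ∉ ρ.parts := fun hh => hmem ρ _ hh (Finset.mem_insert_self _ _)
    have h4 : insert o S ∉ ρ'.parts := fun hh => hmem ρ' _ hh (Finset.mem_insert_self _ _)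
    have h5 : ρ = ρ' := by
      apply Finpartition.ext
      change insert (insert o S) ρ.parts = insert (insert o S) ρ'.parts at he'
      rw [← Finset.erase_insert h3, he', Finset.erase_insert h4]
    rw [h5]
  · intro π _
    obtain ⟨T, hT, hoT⟩ := π.exists_mem ho
    obtain ⟨ρ, hρ⟩ := π.exists_parts_eq_erase hT hoT
    have hm : (⟨T.erase o, ρ⟩ : (S : Finset N) × Finpartition (I.erase o \ S)) ∈
        (I.erase o).powerset.sigma (fun _ => Finset.univ) := by
      simpa using Finset.erase_subset_erase _ (π.subset hT)
    refine ⟨_, hm, ?_⟩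
    apply Finpartition.ext
    rw [(hex _ hm).choose_spec]
    change insert (insert o (T.erase o)) ρ.parts = _
    rw [hρ, Finset.insert_erase hoT, Finset.insert_erase hT]
  · rintro ⟨S, ρ⟩ h
    rw [(hex _ h).choose_spec, Finset.prod_insert]
    exact fun hh => hmem ρ _ hh (Finset.mem_insert_self _ _)

end Partitions

namespace BoseGas

variable (G : BoseGas)

section Connected

lemma val_empty (a c : Empty → ℝ × OneParticle) (s : Empty → ℝ × C_c(Space, ℂ)) :
    G.val a c s = 1 := by
  classical
  rw [val, Fintype.sum_unique, term, integral_unique]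
  simp [integrand, Measure.real, volume_pi]

lemma gauss_one : G.gauss 1 = 1 := by
  have h := G.gauss_eq_val (fun i : Empty => i.elim) (fun i : Empty => i.elim)
    (fun i : Empty => i.elim)
  simp only [Finset.univ_eq_empty, Finset.prod_empty, mul_one] at h
  rw [h, val_empty]

lemma state_one : G.state 1 = 1 := by
  have h := G.state_of_ordered 1 List.Pairwise.nil
  rwa [map_one, map_one, gauss_one] at h

/-- The recursive definition subtracts all partitions but the one with a single block; restoring
this one gives the full sum. For empty `I` there is one partition, without blocks. -/
lemma state_prod_eq {n : ℕ} (a : Fin n → Observable) (I : Finset (Fin n)) :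
    G.state ((I.sort (· ≤ ·)).map a).prod =
      ∑ π : Finpartition I, ∏ J ∈ π.parts, G.connectedOn a J := by
  classical
  rcases I.eq_empty_or_nonempty with rfl | hI
  · rw [Finset.sort_empty, List.map_nil, List.prod_nil, state_one]
    have h : ∀ π : Finpartition (∅ : Finset (Fin n)), π.parts = ∅ := fun π =>
      π.parts_eq_empty_iff.2 rfl
    have h' : ∀ π ρ : Finpartition (∅ : Finset (Fin n)), π = ρ := fun π ρ =>
      Finpartition.ext (by rw [h, h])
    let ρ : Finpartition (∅ : Finset (Fin n)) := Finpartition.empty _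
    refine ((Fintype.sum_eq_single ρ fun π hπ => absurd (h' _ _) hπ).trans ?_).symm
    rw [h, Finset.prod_empty]
  · have hc : G.connectedOn a I = G.state ((I.sort (· ≤ ·)).map a).prod -
        ∑ π : {π : Finpartition I // π.parts ≠ {I}},
          ∏ J : {J : Finset (Fin n) // J ∈ π.1.parts}, G.connectedOn a J.1 := by
      conv_lhs => rw [connectedOn]
    have h1 : ∑ π : {π : Finpartition I // π.parts ≠ {I}},
        ∏ J : {J : Finset (Fin n) // J ∈ π.1.parts}, G.connectedOn a J.1 =
        ∑ π : Finpartition I with π.parts ≠ {I}, ∏ J ∈ π.parts, G.connectedOn a J := by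
      rw [Finset.sum_subtype (p := fun π : Finpartition I => π.parts ≠ {I}) _ (by simp)]
      refine Finset.sum_congr (by congr) fun π _ => ?_
      rw [Finset.prod_coe_sort π.1.parts (fun J => G.connectedOn a J)]
    rw [h1, eq_sub_iff_add_eq] at hc
    rw [← hc]
    have h2 : (Finpartition.indiscrete hI.ne_empty : Finpartition I).parts = {I} := rfl
    rw [← Finset.sum_filter_not_add_sum_filter Finset.univ
      (fun π : Finpartition I => π.parts ≠ {I})]
    refine congrArg₂ (· + ·) ?_ rfl
    rw [Finset.sum_eq_single (Finpartition.indiscrete hI.ne_empty : Finpartition I), h2,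
      Finset.prod_singleton]
    · intro π hπ hne
      refine absurd (Finpartition.ext ?_) hne
      simpa [h2] using hπ
    · intro h
      simp at h

/-- If all correlation functions with a distinguished factor are expanded in the correlation
functions without it, then the coefficients are the connected correlation functions. -/
lemma connectedOn_insert_eq {M : Type*} [DecidableEq M] {n : ℕ} (a : Fin n → Observable) (o : Fin n)
    (e : M ↪ Fin n) (ho : ∀ i, e i ≠ o) (c : Finset M → ℂ)
    (h : ∀ J : Finset M, G.state (((insert o (J.map e)).sort (· ≤ ·)).map a).prod =
      ∑ S ∈ J.powerset, c S * G.state ((((J \ S).map e).sort (· ≤ ·)).map a).prod) (J : Finset M) :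
    G.connectedOn a (insert o (J.map e)) = c J := by
  classical
  induction J using Finset.strongInduction with
  | H J ih =>
    have hJ : o ∉ J.map e := by simpa using fun i _ => ho i
    have h1 := h J
    rw [state_prod_eq, sum_finpartition_eq (Finset.mem_insert_self o _), Finset.erase_insert hJ,
      sum_powerset_map e J fun S => G.connectedOn a (insert o S) *
        ∑ ρ : Finpartition (J.map e \ S), ∏ J ∈ ρ.parts, G.connectedOn a J] at h1
    have h2 : ∀ S : Finset M, ∑ ρ : Finpartition (J.map e \ S.map e),
        ∏ J ∈ ρ.parts, G.connectedOn a J =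
          G.state ((((J \ S).map e).sort (· ≤ ·)).map a).prod := by
      intro S
      rw [state_prod_eq, Finset.map_sdiff]
    simp only [h2] at h1
    -- Both expansions are triangular in the block of `o`. The proper subsets agree by induction,
    -- and in the term `S = J` the complement is empty, with state value 1.
    rw [← Finset.add_sum_erase _ _ (Finset.mem_powerset_self J),
      ← Finset.add_sum_erase _ _ (Finset.mem_powerset_self J),
      Finset.sum_congr rfl fun S hS => ?_] at h1
    · have h3 := add_right_cancel h1
      rwa [sdiff_self, Finset.bot_eq_empty, Finset.map_empty, Finset.sort_empty, List.map_nil,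
        List.prod_nil, state_one, mul_one, mul_one] at h3
    · simp only [Finset.mem_erase, Finset.mem_powerset] at hS
      rw [ih S (Finset.ssubset_iff_subset_ne.2 ⟨hS.2, hS.1⟩)]

lemma connected_ofFn {n : ℕ} (a : Fin n → Observable) :
    G.connected (List.ofFn a) = G.connectedOn a Finset.univ := by
  have h : ∀ (l : List Observable) (hl : l.length = n) (_ : ∀ i : Fin n, l.get (i.cast hl.symm) =
      a i), G.connectedOn l.get Finset.univ = G.connectedOn a Finset.univ := by
    rintro l rfl hl
    rw [show l.get = a from funext hl]
  exact h _ (List.length_ofFn) fun i => by simp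

end Connected

section Vertices

variable {N : Type*} [DecidableEq N] (V : Vertices N)

lemma state_mul_prod_observable (w₀ : FreeMonoid FieldGen) (hw₀ : w₀.toList.Pairwise G.Ordered)
    {l : List N} (hl : l.Nodup) (hV : G.ApartOn V l.toFinset)
    (h₀ : ∀ b ∈ w₀.toList, ∀ i ∈ l, G.Apart b.time (V.u i)) :
    G.state (MonoidAlgebra.of ℂ (FreeMonoid FieldGen) w₀ * (l.map V.observable).prod) =
      G.gauss ((w₀.toList.map MvPolynomial.X).prod * ∏ i ∈ l.toFinset, V.poly i) := by
  rw [G.state_mul_eq_gauss w₀ (prod_mem_wordsAt l V.observable V.u fun i _ => V.observable_mem i),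
    map_mul, map_list_prod, List.map_map, List.prod_toFinset _ hl]
  · congr 3
    · rw [comm_of, ← List.prod_ofFn]
      conv_rhs => rw [← List.ofFn_get w₀.toList, List.map_ofFn]
      rfl
    · exact List.map_congr_left fun i _ => V.comm_observable i
  · intro w hw
    rw [List.pairwise_append]
    refine ⟨hw₀, G.pairwise_ordered_of_times (w := w) ?_, ?_⟩
    · rw [hw, List.pairwise_map]
      refine hl.pairwise_of_forall_ne fun i hi j hj hij => ?_
      exact hV i (List.mem_toFinset.2 hi) j (List.mem_toFinset.2 hj) hij
    · intro b hb b' hb'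
      have : b'.time ∈ l.map V.u := hw ▸ List.mem_map_of_mem hb'
      obtain ⟨i, hi, hib⟩ := List.mem_map.1 this
      exact Or.inl (hib ▸ h₀ b hb i hi)

/-- The distinguished factor receives the index 0, so that in increasing order it always stands
first, as the path expansions require. -/
lemma connected_cons_observable {n : ℕ} (V : Vertices (Fin n)) (w₀ : FreeMonoid FieldGen)
    (hw₀ : w₀.toList.Pairwise G.Ordered) (hV : G.ApartOn V Finset.univ)
    (h₀ : ∀ b ∈ w₀.toList, ∀ i, G.Apart b.time (V.u i)) (c : Finset (Fin n) → ℂ)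
    (hc : ∀ J : Finset (Fin n),
      G.gauss ((w₀.toList.map MvPolynomial.X).prod * ∏ i ∈ J, V.poly i) =
        ∑ S ∈ J.powerset, c S * G.gauss (∏ i ∈ J \ S, V.poly i)) :
    G.connected (MonoidAlgebra.of ℂ (FreeMonoid FieldGen) w₀ :: List.ofFn V.observable) =
      c Finset.univ := by
  have h1 : MonoidAlgebra.of ℂ (FreeMonoid FieldGen) w₀ :: List.ofFn V.observable =
      List.ofFn (Fin.cons (MonoidAlgebra.of ℂ (FreeMonoid FieldGen) w₀) V.observable :
        Fin (n + 1) → Observable) := by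
    rw [List.ofFn_cons]
  have h2 : (Finset.univ : Finset (Fin (n + 1))) =
      insert 0 ((Finset.univ : Finset (Fin n)).map (Fin.succEmb n)) := by
    ext i; refine Fin.cases ?_ (fun i => ?_) i <;> simp
  have h3 : ∀ J : Finset (Fin n), ((J.map (Fin.succEmb n)).sort (· ≤ ·)).map
      (Fin.cons (MonoidAlgebra.of ℂ (FreeMonoid FieldGen) w₀) V.observable :
        Fin (n + 1) → Observable) = (J.sort (· ≤ ·)).map V.observable := by
    intro J
    rw [← Finset.map_sort (r := (· ≤ ·)) (r' := (· ≤ ·)) (Fin.succEmb n) J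
      (fun i _ j _ => Fin.succ_le_succ_iff.symm), List.map_map]
    rfl
  have h4 : ∀ J : Finset (Fin n), (J.sort (· ≤ ·)).toFinset = J := fun J => J.sort_toFinset _
  rw [h1, connected_ofFn, h2]
  refine G.connectedOn_insert_eq _ 0 (Fin.succEmb n) (fun i => Fin.succ_ne_zero i) c ?_ _
  intro J
  rw [Finset.sort_insert _ (fun _ _ => Fin.zero_le _) (by simp), List.map_cons, List.prod_cons,
    Fin.cons_zero, h3, G.state_mul_prod_observable V w₀ hw₀ (J.sort_nodup _)
      (hV.mono (Finset.subset_univ _)) (fun b hb i _ => h₀ b hb i), h4, hc]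
  refine Finset.sum_congr rfl fun S _ => ?_
  have h5 := G.state_mul_prod_observable V 1 List.Pairwise.nil ((J \ S).sort_nodup (· ≤ ·))
    (hV.mono (Finset.subset_univ _)) (fun b hb => by cases hb)
  rw [map_one, one_mul, h4] at h5
  rw [h3, h5]
  simp

lemma chainSum_map {M : Type*} [DecidableEq M] (W : Vertices M) (e : M ↪ N) (v s : ℝ) (S : Finset M)
    (hu : ∀ i ∈ S, V.u (e i) = W.u i) (hop : ∀ i ∈ S, V.op (e i) = W.op i) :
    G.chainSum V v s (S.map e) = G.chainSum W v s S := by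
  induction S using Finset.strongInduction generalizing s with
  | H S ih =>
    rcases S.eq_empty_or_nonempty with rfl | hS
    · rw [Finset.map_empty, chainSum_empty, chainSum_empty]
    · rw [chainSum_of_nonempty _ _ _ _ hS, chainSum_of_nonempty _ _ _ _ (hS.map (f := e)),
        Finset.sum_map]
      refine Finset.sum_congr rfl fun j hj => ?_
      rw [← Finset.map_erase, hu j hj, hop j hj, ih _ (Finset.erase_ssubset hj) _
        (fun i hi => hu i (Finset.mem_of_mem_erase hi))
        (fun i hi => hop i (Finset.mem_of_mem_erase hi))]

end Vertices

end BoseGas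

/-! ### Uniform bounds for loops of Wick squares -/

section Chains

variable {ι : Type*} [Fintype ι]

/-- An integral over positions of a product of weights, each of which depends on its own position
and, if this is of higher rank, on the position of a successor. -/
lemma lintegral_prod_chain_le (w : ι → Space → Space → ℝ≥0∞)
    (hw : ∀ i, Measurable fun p : Space × Space => w i p.1 p.2) (σ : ι → ι) (t : ι → ℝ) (C : ℝ≥0∞)
    (hC : ∀ i y, ∫⁻ x, w i x y ≤ C)
    (hdep : ∀ i, t (σ i) ≤ t i → ∀ x y y', w i x y = w i x y') :
    ∫⁻ x : ι → Space, ∏ i, w i (x i) (x (σ i)) ≤ C ^ Fintype.card ι := by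
  classical
  have hmeas : ∀ J : Finset ι, Measurable fun x : ι → Space => ∏ i ∈ J, w i (x i) (x (σ i)) :=
    fun J => Finset.measurable_prod _ fun i _ => by
      have h : Measurable fun x : ι → Space => (x i, x (σ i)) := by fun_prop
      exact (hw i).comp h
  have key : ∀ J : Finset ι, ∀ x,
      (∫⋯∫⁻_J, (fun x => ∏ i ∈ J, w i (x i) (x (σ i))) ∂fun _ => (volume : Measure Space)) x ≤
        C ^ J.card := by
    intro J
    induction J using Finset.strongInduction with
    | H J ih =>
      intro x
      rcases J.eq_empty_or_nonempty with rfl | hJ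
      · simp
      -- Integrate the position of lowest rank first. A weight whose successor is `o` does not raise
      -- the rank, hence does not depend on this position. So only the weight of `o` itself is
      -- integrated, at a cost of at most `C`.
      · obtain ⟨o, ho, hmin⟩ := J.exists_min_image t hJ
        obtain ⟨J', hJ', rfl⟩ : ∃ J', o ∉ J' ∧ insert o J' = J :=
          ⟨J.erase o, Finset.notMem_erase _ _, Finset.insert_erase ho⟩
        rw [lmarginal_insert' _ (hmeas _) hJ']
        have h1 : ∀ x : ι → Space, ∫⁻ z, ∏ i ∈ insert o J',
            w i (Function.update x o z i) (Function.update x o z (σ i)) ≤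
              C * ∏ i ∈ J', w i (x i) (x (σ i)) := by
          intro x
          have h2 : ∀ z, ∏ i ∈ insert o J',
              w i (Function.update x o z i) (Function.update x o z (σ i)) =
              w o z (x (σ o)) * ∏ i ∈ J', w i (x i) (x (σ i)) := by
            intro z
            rw [Finset.prod_insert hJ', Function.update_self]
            congr 1
            · by_cases h : σ o = o
              · exact hdep o (by rw [h]) _ _ _
              · rw [Function.update_of_ne h]
            · refine Finset.prod_congr rfl fun i hi => ?_
              have hio : i ≠ o := fun h => hJ' (h ▸ hi)
              rw [Function.update_of_ne hio]
              by_cases h : σ i = o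
              · exact hdep i (by rw [h]; exact hmin i (Finset.mem_insert_of_mem hi)) _ _ _
              · rw [Function.update_of_ne h]
          simp only [h2]
          have h3 : Measurable fun z : Space => (z, x (σ o)) := by fun_prop
          rw [lintegral_mul_const _ (show Measurable fun z => w o z (x (σ o)) from (hw o).comp h3)]
          exact mul_le_mul_left (hC o _) _
        refine (lmarginal_mono (μ := fun _ => (volume : Measure Space)) (s := J')
          (f := fun x => ∫⁻ z, ∏ i ∈ insert o J',
            w i (Function.update x o z i) (Function.update x o z (σ i)))
          (g := fun x => C * ∏ i ∈ J', w i (x i) (x (σ i))) h1 x).trans ?_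
        have h3 : (∫⋯∫⁻_J', (fun x => C * ∏ i ∈ J', w i (x i) (x (σ i)))
            ∂fun _ => (volume : Measure Space)) x = C * (∫⋯∫⁻_J', (fun x =>
              ∏ i ∈ J', w i (x i) (x (σ i))) ∂fun _ => (volume : Measure Space)) x := by
          rw [lmarginal, lmarginal, lintegral_const_mul]
          exact (hmeas J').comp (measurable_updateFinset)
        rw [h3, Finset.card_insert_of_notMem hJ', pow_succ']
        gcongr
        exact ih J' (Finset.ssubset_insert hJ') x
  have h := key Finset.univ 0
  rwa [lmarginal_univ] at h

end Chains

namespace BoseGas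

variable (G : BoseGas)

section Loops

variable {ι : Type*} [Fintype ι]

lemma lag_eq_of_lt {u v : ℝ} (hu : u ∈ Set.Ioo 0 G.β) (hv : v ∈ Set.Ioo 0 G.β) (h : u < v) :
    G.lag u v = v - u := by
  rw [lag, if_neg h.ne, G.wrap_of_mem (by linarith) (by linarith [hu.1, hv.2])]

lemma lag_eq_of_gt {u v : ℝ} (hu : u ∈ Set.Ioo 0 G.β) (hv : v ∈ Set.Ioo 0 G.β) (h : v < u) :
    G.lag u v = v - u + G.β := by
  rw [lag, if_neg h.ne', G.wrap_of_neg (by linarith [hu.2, hv.1]) (by linarith)]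

lemma lag_self (u : ℝ) : G.lag u u = G.β := if_pos rfl

/-- Finitely many times on the circle leave a gap. Ranked from this gap on, every contraction
which does not raise the rank is over a long time. -/
lemma exists_rank (u : ι → ℝ) (hu : ∀ i, u i ∈ Set.Ioo 0 G.β) :
    ∃ t : ι → ℝ, ∀ i j, t j ≤ t i → (i ≠ j → u i ≠ u j) →
      G.β / (Fintype.card ι + 1) ≤ G.lag (u i) (u j) := by
  set δ := G.β / (Fintype.card ι + 1) with hδ
  have hc : (0 : ℝ) < Fintype.card ι + 1 := by positivity
  have hβ := G.β_pos
  have hδ0 : 0 < δ := by positivity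
  have hδβ : δ * (Fintype.card ι + 1) = G.β := by rw [hδ]; field_simp
  -- Pigeonhole: one more window of length δ than there are times, so some window is empty.
  obtain ⟨k, hk, hgap⟩ : ∃ k : ℕ, k ≤ Fintype.card ι ∧ ∀ i, ⌊u i / δ⌋₊ ≠ k := by
    by_contra! hcon
    have h1 : Finset.range (Fintype.card ι + 1) ⊆ Finset.univ.image fun i => ⌊u i / δ⌋₊ := by
      intro k hk
      obtain ⟨i, hi⟩ := hcon k (by simpa [Nat.lt_succ_iff] using hk)
      exact Finset.mem_image.2 ⟨i, Finset.mem_univ _, hi⟩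
    have h2 := (Finset.card_le_card h1).trans Finset.card_image_le
    simp at h2
  have hside : ∀ i, u i < k * δ ∨ (k + 1) * δ ≤ u i := by
    intro i
    rcases lt_or_gt_of_ne (hgap i) with h | h
    · left
      have := (Nat.floor_lt (by have := (hu i).1; positivity)).1 h
      rwa [div_lt_iff₀ hδ0] at this
    · right
      have h' : k + 1 ≤ ⌊u i / δ⌋₊ := h
      have := (Nat.le_floor_iff (by have := (hu i).1; positivity)).1 h'
      rw [le_div_iff₀ hδ0] at this
      exact_mod_cast this
  have hk' : (k : ℝ) * δ ≤ G.β - δ := by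
    have : (k : ℝ) ≤ Fintype.card ι := by exact_mod_cast hk
    nlinarith
  have hkδ : 0 ≤ (k : ℝ) * δ := by positivity
  -- The circle is cut at the empty window: times before it are moved to the next period. A step
  -- between distinct times that does not raise this rank must pass the window, hence takes at least
  -- δ.
  refine ⟨fun i => if u i < k * δ then u i + G.β else u i, fun i j hij hne => ?_⟩
  have hi := hu i
  have hj := hu j
  by_cases hije : i = j
  · subst hije
    rw [lag_self]
    nlinarith
  have hd := hne hije
  simp only at hij
  rcases lt_or_gt_of_ne hd with hlt | hgt
  · rw [G.lag_eq_of_lt hi hj hlt]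
    split_ifs at hij with h1 h2 h2
    · linarith
    · have := (hside i).resolve_left h2
      linarith [hj.1, hi.2]
    · have := (hside j).resolve_left h1
      linarith
    · linarith
  · rw [G.lag_eq_of_gt hi hj hgt]
    split_ifs at hij with h1 h2 h2
    · linarith [hj.1]
    · linarith [hj.1, hi.2]
    · linarith [hj.1, hi.2]
    · have := (hside j).resolve_left h1
      linarith [hi.2]

/-- The integrand of a contraction of Wick squares, along a permutation. -/
def loopIntegrand (a : ι → Space → ℂ) (u : ι → ℝ) (τ : ι → ι) (x : ι → Space) : ℂ :=
  (∏ i, a i (x i)) * ∏ i, G.kernel (G.lag (u i) (u (τ i))) (x i - x (τ i))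

/-- The constant must not depend on the times. Kernels along steps that do not raise the rank are
estimated in supremum, the others in L¹; this is the structure needed for `lintegral_prod_chain_le`.
-/
lemma exists_lintegral_loopIntegrand_le {S : Set Space} (hS : IsCompact S) (M : ℝ) (τ : ι → ι) :
    ∃ C : ℝ, ∀ (a : ι → Space → ℂ) (u : ι → ℝ), (∀ i x, ‖a i x‖ ≤ M) → (∀ i, ∀ x ∉ S, a i x = 0) →
      (∀ i, u i ∈ Set.Ioo 0 G.β) → Function.Injective u →
      ∫⁻ x, ‖G.loopIntegrand a u τ x‖ₑ ≤ ENNReal.ofReal C := by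
  classical
  set δ := G.β / (Fintype.card ι + 1) with hδ
  have hδ0 : 0 < δ := by have := G.β_pos; positivity
  -- The two summands bound one integration in the two cases: a constant kernel over the support of
  -- the weight, or a bounded weight against a kernel in L¹.
  set C₁ : ℝ≥0∞ := ENNReal.ofReal M * ENNReal.ofReal (G.kernelBound δ) * volume S +
    ENNReal.ofReal M * ENNReal.ofReal G.bound with hC₁
  have hC₁' : C₁ ≠ ∞ := by
    rw [hC₁]
    exact ENNReal.add_ne_top.2 ⟨ENNReal.mul_ne_top (ENNReal.mul_ne_top ENNReal.ofReal_ne_top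
      ENNReal.ofReal_ne_top) hS.measure_lt_top.ne, ENNReal.mul_ne_top ENNReal.ofReal_ne_top
      ENNReal.ofReal_ne_top⟩
  refine ⟨(C₁ ^ Fintype.card ι).toReal, fun a u ha haS hu hinj => ?_⟩
  rw [ENNReal.ofReal_toReal (ENNReal.pow_ne_top hC₁')]
  obtain ⟨t, ht⟩ := G.exists_rank u hu
  let w : ι → Space → Space → ℝ≥0∞ := fun i x y =>
    S.indicator (fun _ => ENNReal.ofReal M) x *
      if t (τ i) ≤ t i then ENNReal.ofReal (G.kernelBound δ)
      else ‖G.kernel (G.lag (u i) (u (τ i))) (x - y)‖ₑ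
  have hlag : ∀ i, 0 < G.lag (u i) (u (τ i)) := by
    intro i
    refine G.lag_pos ?_
    by_cases h : i = τ i
    · exact Or.inl (congrArg u h)
    · exact Or.inr (G.apart_of_mem ⟨(hu i).1.le, (hu i).2⟩ ⟨(hu _).1.le, (hu _).2⟩ (hinj.ne h))
  have hSm : MeasurableSet S := hS.isClosed.measurableSet
  have hle : ∀ x, ‖G.loopIntegrand a u τ x‖ₑ ≤ ∏ i, w i (x i) (x (τ i)) := by
    intro x
    have he : ∀ z : ι → ℂ, ‖∏ i, z i‖ₑ = ∏ i, ‖z i‖ₑ := fun z => by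
      simp only [← ofReal_norm, norm_prod, ENNReal.ofReal_prod_of_nonneg fun i _ =>
        norm_nonneg (z i)]
    rw [loopIntegrand, ← Finset.prod_mul_distrib, he]
    refine Finset.prod_le_prod' fun i _ => ?_
    rw [enorm_mul]
    refine mul_le_mul' ?_ ?_
    · by_cases hx : x i ∈ S
      · rw [Set.indicator_of_mem hx, ← ofReal_norm]
        exact ENNReal.ofReal_le_ofReal (ha i _)
      · rw [haS i _ hx]; simp
    · split_ifs with h
      · rw [← ofReal_norm]
        exact ENNReal.ofReal_le_ofReal
          (G.norm_kernel_le hδ0 (ht i (τ i) h fun hne => hinj.ne hne) _)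
      · exact le_rfl
  refine (lintegral_mono hle).trans (lintegral_prod_chain_le w ?_ τ t C₁ ?_ ?_)
  · intro i
    refine Measurable.mul ((measurable_const.indicator hSm).comp measurable_fst) ?_
    split_ifs
    · exact measurable_const
    · exact ((G.measurable_kernel _).comp (measurable_fst.sub measurable_snd)).enorm
  · intro i y
    simp only [w]
    split_ifs with h
    · rw [lintegral_mul_const _ (measurable_const.indicator hSm), lintegral_indicator hSm,
        setLIntegral_const, hC₁, mul_right_comm]
      exact le_self_add
    · calc ∫⁻ x, S.indicator (fun _ => ENNReal.ofReal M) x *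
            ‖G.kernel (G.lag (u i) (u (τ i))) (x - y)‖ₑ
          ≤ ∫⁻ x, ENNReal.ofReal M * ‖G.kernel (G.lag (u i) (u (τ i))) (x - y)‖ₑ :=
            lintegral_mono fun x => mul_le_mul_left (Set.indicator_le_self _ _ x) _
        _ = ENNReal.ofReal M * ∫⁻ x, ‖G.kernel (G.lag (u i) (u (τ i))) x‖ₑ := by
            rw [lintegral_const_mul' _ _ ENNReal.ofReal_ne_top, lintegral_sub_right_eq_self
              (fun x => ‖G.kernel (G.lag (u i) (u (τ i))) x‖ₑ)]
        _ ≤ C₁ := by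
            rw [hC₁]
            exact (mul_le_mul_right (G.lintegral_kernel_le (hlag i)) _).trans le_add_self
  · intro i h x y y'
    simp only [w, if_pos h]

lemma measurable_wrap : Measurable G.wrap :=
  measurable_const.mul (measurable_fract.comp (measurable_id.div_const _))

lemma measurable_lag : Measurable fun p : ℝ × ℝ => G.lag p.1 p.2 :=
  Measurable.ite (measurableSet_eq_fun measurable_fst measurable_snd) measurable_const
    (G.measurable_wrap.comp (measurable_snd.sub measurable_fst))

lemma stronglyMeasurable_integral_loopIntegrand (a : ℝ → Space → ℂ)
    (ha : Measurable fun p : ℝ × Space => a p.1 p.2) (τ : ι → ι) :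
    StronglyMeasurable fun u : ι → ℝ => ∫ x, G.loopIntegrand (fun i => a (u i)) u τ x := by
  refine StronglyMeasurable.integral_prod_right ?_
  refine Measurable.stronglyMeasurable ?_
  have hK := G.stronglyMeasurable_kernel.measurable
  have hl := G.measurable_lag
  simp only [loopIntegrand, Function.uncurry_def]
  generalize G.kernel = K at hK ⊢
  generalize G.lag = l at hl ⊢
  have h1 : ∀ i, Measurable fun p : (ι → ℝ) × (ι → Space) => a (p.1 i) (p.2 i) := fun i => by
    have h : Measurable fun p : (ι → ℝ) × (ι → Space) => (p.1 i, p.2 i) := by fun_prop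
    exact ha.comp h
  have h2 : ∀ i, Measurable fun p : (ι → ℝ) × (ι → Space) =>
      K (l (p.1 i) (p.1 (τ i))) (p.2 i - p.2 (τ i)) := fun i => by
    have h : Measurable fun p : (ι → ℝ) × (ι → Space) => (p.1 i, p.1 (τ i)) := by fun_prop
    have h' : Measurable fun p : (ι → ℝ) × (ι → Space) =>
        (l (p.1 i) (p.1 (τ i)), p.2 i - p.2 (τ i)) :=
      Measurable.prodMk (hl.comp h) (by fun_prop)
    exact hK.comp h'
  exact (Finset.measurable_prod _ fun i _ => h1 i).mul (Finset.measurable_prod _ fun i _ => h2 i)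

/-- The permutation of Wick squares underlying a full contraction. -/
def loopMap (σ : Empty ⊕ ι ≃ Empty ⊕ ι) (i : ι) : ι := Equiv.emptySum Empty ι (σ (.inr i))

lemma val_eq_sum_loopIntegrand (a c : Empty → ℝ × OneParticle) (s : ι → ℝ × C_c(Space, ℂ)) :
    G.val a c s = open Classical in ∑ σ : Empty ⊕ ι ≃ Empty ⊕ ι,
      ∫ x, G.loopIntegrand (fun i => (s i).2) (fun i => (s i).1) (loopMap σ) x := by
  classical
  rw [val]
  refine Finset.sum_equiv (Equiv.refl _) (by simp) fun σ _ => ?_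
  rw [term]
  refine integral_congr_ae (Filter.Eventually.of_forall fun x => ?_)
  simp only [integrand, loopIntegrand, Fintype.prod_sum_type, Finset.univ_eq_empty,
    Finset.prod_empty, one_mul]
  congr 1
  refine Finset.prod_congr rfl fun i _ => ?_
  obtain ⟨j, hj⟩ : ∃ j, σ (.inr i) = .inr j := by
    rcases σ (.inr i) with e | j
    · exact e.elim
    · exact ⟨j, rfl⟩
  simp only [Equiv.refl_apply, loopMap, hj, entry, Equiv.emptySum_apply_inr]

end Loops

end BoseGas

/-! ### Regularity of the external field, and of paths as functions of the times -/

namespace BoseGas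

variable (G : BoseGas)

/-- The assumptions on the external field: it is jointly continuous, with a common compact
support. -/
structure Regular (A : ℝ → C_c(Space, ℂ)) : Prop where
  continuousOn : ContinuousOn (fun p : ℝ × Space => A p.1 p.2) (Set.Icc 0 G.β ×ˢ Set.univ)
  support : ∃ S : Set Space, IsCompact S ∧ ∀ u ∈ Set.Icc 0 G.β, tsupport (A u) ⊆ S

section Regular

variable {G} {A : ℝ → C_c(Space, ℂ)} (hA : G.Regular A)
include hA

lemma Regular.star : G.Regular fun u => star (A u) := by
  obtain ⟨S, hS, hAS⟩ := hA.support
  refine ⟨hA.continuousOn.star, S, hS, fun u hu => ?_⟩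
  refine (closure_mono fun x hx => ?_).trans (hAS u hu)
  rw [Function.mem_support] at hx ⊢
  intro h
  exact hx (by simp [h])

lemma Regular.exists_bound : ∃ (S : Set Space) (M : ℝ), IsCompact S ∧ 0 ≤ M ∧
    ∀ u ∈ Set.Icc 0 G.β, (∀ x, ‖A u x‖ ≤ M) ∧ tsupport (A u) ⊆ S ∧ ∀ x ∉ S, A u x = 0 := by
  obtain ⟨S, hS, hAS⟩ := hA.support
  obtain ⟨C, hC⟩ := (isCompact_Icc.prod hS).exists_bound_of_continuousOn
    (hA.continuousOn.mono (Set.prod_mono subset_rfl (Set.subset_univ S)))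
  have h0 : ∀ u ∈ Set.Icc 0 G.β, ∀ x ∉ S, A u x = 0 := fun u hu x hx => by
    by_contra h
    exact hx (hAS u hu (subset_tsupport _ h))
  refine ⟨S, max C 0, hS, le_max_right _ _, fun u hu => ⟨fun x => ?_, hAS u hu, h0 u hu⟩⟩
  by_cases hx : x ∈ S
  · exact (hC (u, x) ⟨hu, hx⟩).trans (le_max_left _ _)
  · rw [h0 u hu x hx, norm_zero]; exact le_max_right _ _

/-- Uniform continuity on [0, β] × S, with `S` the common compact support, controls the supremum
norm of differences and thereby the operator norm. -/
lemma Regular.continuousOn_mulOp : ContinuousOn (fun u => mulOp (A u)) (Set.Icc 0 G.β) := by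
  obtain ⟨S, M, hS, -, hAS⟩ := hA.exists_bound
  have hu := (isCompact_Icc.prod hS).uniformContinuousOn_of_continuous
    (hA.continuousOn.mono (Set.prod_mono subset_rfl (Set.subset_univ S)))
  rw [Metric.uniformContinuousOn_iff] at hu
  rw [Metric.continuousOn_iff]
  intro u hmu η hη
  obtain ⟨δ, hδ, h⟩ := hu (η / 2) (half_pos hη)
  refine ⟨δ, hδ, fun v hv hvu => ?_⟩
  rw [dist_eq_norm, mulOp_sub (memLp_top_cc _) (memLp_top_cc _)]
  refine (norm_mulOp_le (half_pos hη).le fun x => ?_).trans_lt (half_lt_self hη)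
  by_cases hx : x ∈ S
  · have := h (v, x) ⟨hv, hx⟩ (u, x) ⟨hmu, hx⟩ (by simpa [Prod.dist_eq, hδ] using hvu)
    rw [dist_eq_norm] at this
    exact this.le
  · rw [Pi.sub_apply, (hAS v hv).2.2 x hx, (hAS u hmu).2.2 x hx, sub_zero, norm_zero]
    exact (half_pos hη).le

lemma Regular.exists_toL2_eq : ∃ e : OneParticle, ∀ u ∈ Set.Icc 0 G.β,
    toL2 (A u) = mulOp (A u) e := by
  obtain ⟨S, hS, hAS⟩ := hA.support
  refine ⟨indicatorConstLp 2 hS.isClosed.measurableSet hS.measure_lt_top.ne 1, fun u hu => ?_⟩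
  refine toL2_eq_mulOp _ _ ?_
  filter_upwards [indicatorConstLp_coeFn (p := 2) (hs := hS.isClosed.measurableSet)
    (hμs := hS.measure_lt_top.ne) (c := (1 : ℂ))] with x hx hxA
  rw [hx, Set.indicator_of_mem (hAS u hu hxA)]

lemma Regular.continuousOn_toL2 : ContinuousOn (fun u => toL2 (A u)) (Set.Icc 0 G.β) := by
  obtain ⟨e, he⟩ := hA.exists_toL2_eq
  exact (hA.continuousOn_mulOp.clm_apply continuousOn_const).congr he

lemma Regular.exists_norm_le : ∃ M : ℝ, 0 ≤ M ∧ ∀ u ∈ Set.Icc 0 G.β, ‖mulOp (A u)‖ ≤ M ∧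
    ‖toL2 (A u)‖ ≤ M := by
  obtain ⟨C, hC⟩ := isCompact_Icc.exists_bound_of_continuousOn hA.continuousOn_mulOp
  obtain ⟨C', hC'⟩ := isCompact_Icc.exists_bound_of_continuousOn hA.continuousOn_toL2
  exact ⟨max (max C C') 0, le_max_right _ _, fun u hu =>
    ⟨(hC u hu).trans ((le_max_left _ _).trans (le_max_left _ _)),
    (hC' u hu).trans ((le_max_right _ _).trans (le_max_left _ _))⟩⟩

lemma Regular.measurable_indicator : Measurable fun p : ℝ × Space =>
    (Set.Icc 0 G.β).indicator (fun u => A u p.2) p.1 := by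
  classical
  have h := hA.continuousOn.measurable_piecewise (g := fun _ => 0) continuousOn_const
    (measurableSet_Icc.prod MeasurableSet.univ)
  convert h using 1
  ext p
  by_cases hp : p.1 ∈ Set.Icc 0 G.β
  · rw [Set.indicator_of_mem hp, Set.piecewise_eq_of_mem _ _ _ (Set.mk_mem_prod hp (Set.mem_univ _))]
  · rw [Set.indicator_of_notMem hp, Set.piecewise_eq_of_notMem _ _ _ fun h => hp h.1]

end Regular

section Continuity

/-- The periodic extension can jump only at multiples of β. This is why paths are studied at times
that differ modulo β. -/
lemma continuousAt_thermal {u : ℝ} (h : G.wrap u ≠ 0) : ContinuousAt G.thermal u := by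
  have hβ := G.β_pos
  have h0 : 0 < G.wrap u := lt_of_le_of_ne (G.wrap_nonneg u) h.symm
  have h1 : ContinuousAt G.wrap u := by
    refine continuousAt_const.mul ?_
    have h2 : ContinuousAt Int.fract (u / G.β) := by
      refine continuousAt_fract fun h' => h ?_
      rw [wrap, Int.fract, sub_eq_zero.2 h', mul_zero]
    exact h2.comp (f := fun u => u / G.β) (continuousAt_id.div_const _)
  exact ((G.continuousOn_propagator.continuousAt (Ioi_mem_nhds h0)).comp h1 :)

variable {X : Type*} [TopologicalSpace X] {D : Set X} {N : Type*} {V : X → Vertices N}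

lemma continuousOn_thermal {v s : X → ℝ} (hv : ContinuousOn v D) (hs : ContinuousOn s D)
    (h : ∀ x ∈ D, G.Apart (s x) (v x)) : ContinuousOn (fun x => G.thermal (v x - s x)) D :=
  fun x hx => (G.continuousAt_thermal (h x hx)).comp_continuousWithinAt (f := fun x => v x - s x)
    ((hv x hx).sub (hs x hx))

variable (hu : ∀ i, ContinuousOn (fun x => (V x).u i) D)
  (hop : ∀ i, ContinuousOn (fun x => (V x).op i) D)
include hu hop

lemma continuousOn_chain {v s : X → ℝ} (hv : ContinuousOn v D) (hs : ContinuousOn s D) (l : List N)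
    (hl : l.Nodup) (hV : ∀ x ∈ D, ∀ i ∈ l, ∀ j ∈ l, i ≠ j → G.Apart ((V x).u i) ((V x).u j))
    (hvs : ContinuousOn (fun x => G.thermal (v x - s x)) D)
    (hsi : ∀ x ∈ D, ∀ i ∈ l, G.Apart (s x) ((V x).u i))
    (hvi : ∀ x ∈ D, ∀ i ∈ l, G.Apart ((V x).u i) (v x)) :
    ContinuousOn (fun x => G.chain (V x) (v x) (s x) l) D := by
  induction l generalizing s with
  | nil => exact hvs
  | cons i l ih =>
    rw [List.nodup_cons] at hl
    refine (G.continuousOn_thermal (hu i) hs fun x hx => hsi x hx i (by simp)).clm_comp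
      ((hop i).clm_comp (ih (hu i) hl.2 ?_ ?_ ?_ ?_))
    · exact fun x hx i hi j hj => hV x hx i (List.mem_cons_of_mem _ hi) j (List.mem_cons_of_mem _ hj)
    · exact G.continuousOn_thermal hv (hu i) fun x hx => hvi x hx i (by simp)
    · exact fun x hx j hj => hV x hx i (by simp) j (by simp [hj]) fun h => hl.1 (h ▸ hj)
    · exact fun x hx j hj => hvi x hx j (by simp [hj])

omit [TopologicalSpace X] hu hop in
lemma norm_chain_le (W : Vertices N) {M : ℝ} (hM : 0 ≤ M) (v s : ℝ) (l : List N)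
    (h : ∀ i ∈ l, ‖W.op i‖ ≤ M) : ‖G.chain W v s l‖ ≤ G.bound * (M * G.bound) ^ l.length := by
  have hb := G.bound_pos.le
  induction l generalizing s with
  | nil => simpa [chain] using G.norm_thermal_le _
  | cons i l ih =>
    have h1 := ih (W.u i) fun j hj => h j (by simp [hj])
    have h2 := h i (by simp)
    have h3 := G.norm_thermal_le (W.u i - s)
    rw [chain, List.length_cons, pow_succ']
    calc _ ≤ ‖G.thermal (W.u i - s)‖ * (‖W.op i‖ * ‖G.chain W v (W.u i) l‖) :=
          (ContinuousLinearMap.opNorm_comp_le _ _).trans (mul_le_mul_of_nonneg_left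
            (ContinuousLinearMap.opNorm_comp_le _ _) (norm_nonneg _))
      _ ≤ G.bound * (M * (G.bound * (M * G.bound) ^ l.length)) := by gcongr
      _ = _ := by ring

variable [MeasurableSpace X] [OpensMeasurableSpace X] (μ : Measure X)
  (hD : MeasurableSet D) {M : ℝ} (hM : 0 ≤ M) {v s : X → ℝ} (hv : ContinuousOn v D)
  (hs : ContinuousOn s D) {h f : X → OneParticle} (hh : ContinuousOn h D) (hf : ContinuousOn f D)
  (hhM : ∀ x ∈ D, ‖h x‖ ≤ M) (hfM : ∀ x ∈ D, ‖f x‖ ≤ M)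
  (hopM : ∀ x ∈ D, ∀ i, ‖(V x).op i‖ ≤ M)
  (hvs : ContinuousOn (fun x => G.thermal (v x - s x)) D)
include hD hM hv hs hh hf hhM hfM hopM hvs

/-- Continuity on `D` provides measurability, and the uniform bound on the propagators provides
boundedness. The propagator over `v - s` is assumed continuous because for an external pair both
times are 0, where `v` and `s` are not apart. -/
lemma memLp_inner_chain (l : List N) (hl : l.Nodup)
    (hV : ∀ x ∈ D, ∀ i ∈ l, ∀ j ∈ l, i ≠ j → G.Apart ((V x).u i) ((V x).u j))
    (hsi : ∀ x ∈ D, ∀ i ∈ l, G.Apart (s x) ((V x).u i))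
    (hvi : ∀ x ∈ D, ∀ i ∈ l, G.Apart ((V x).u i) (v x)) :
    MemLp (fun x => inner ℂ (f x) (G.chain (V x) (v x) (s x) l (h x))) ∞ (μ.restrict D) := by
  have hc : ContinuousOn (fun x => G.chain (V x) (v x) (s x) l) D :=
    G.continuousOn_chain hu hop hv hs l hl hV hvs hsi hvi
  refine memLp_top_of_bound ((hf.inner (𝕜 := ℂ) (hc.clm_apply hh)).aestronglyMeasurable hD)
    (M * ((G.bound * (M * G.bound) ^ l.length) * M)) ?_
  filter_upwards [ae_restrict_mem hD] with x hx
  have h1 := G.norm_chain_le (V x) hM (v x) (s x) l fun i _ => hopM x hx i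
  have h2 := hfM x hx
  have h3 := hhM x hx
  have hb := G.bound_pos.le
  calc _ ≤ ‖f x‖ * (‖G.chain (V x) (v x) (s x) l‖ * ‖h x‖) :=
        (norm_inner_le_norm _ _).trans (mul_le_mul_of_nonneg_left
          (ContinuousLinearMap.le_opNorm _ _) (norm_nonneg _))
    _ ≤ _ := by gcongr

lemma memLp_link (S : Finset N) (hV : ∀ x ∈ D, G.ApartOn (V x) S)
    (hsi : ∀ x ∈ D, ∀ i ∈ S, G.Apart (s x) ((V x).u i))
    (hvi : ∀ x ∈ D, ∀ i ∈ S, G.Apart ((V x).u i) (v x)) :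
    MemLp (fun x => G.link (V x) (v x) (h x) (s x) (f x) S) ∞ (μ.restrict D) := by
  have heq : (fun x => G.link (V x) (v x) (h x) (s x) (f x) S) = fun x =>
      ∑ l ∈ orderings S, inner ℂ (f x) (G.chain (V x) (v x) (s x) l (h x)) := by
    ext x
    rw [link, chainSum, sum_apply, inner_sum]
  rw [heq]
  refine memLp_finsetSum _ fun l hl => ?_
  rw [mem_orderings] at hl
  have hl2 : ∀ i ∈ l, i ∈ S := fun i hi => by rw [← Finset.mem_val, hl]; simpa using hi
  exact G.memLp_inner_chain hu hop μ hD hM hv hs hh hf hhM hfM hopM hvs l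
    (Multiset.coe_nodup.1 (hl ▸ S.nodup))
    (fun x hx i hi j hj => hV x hx i (hl2 i hi) j (hl2 j hj))
    (fun x hx i hi => hsi x hx i (hl2 i hi)) (fun x hx i hi => hvi x hx i (hl2 i hi))

end Continuity

end BoseGas

/-- The vertices of the interaction with the external field `A`, at times `u`. -/
def vertices {N : Type*} (A : ℝ → C_c(Space, ℂ)) (p q : N → ℂ) (u : N → ℝ) : Vertices N where
  u := u
  g i := A (u i)
  p := p
  q := q
  r _ := 1

lemma vertices_op {N : Type*} (A : ℝ → C_c(Space, ℂ)) (p q : N → ℂ) (u : N → ℝ) (i : N) :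
    (vertices A p q u).op i = mulOp (A (u i)) := one_smul _ _

lemma vertices_adj_op {N : Type*} (A : ℝ → C_c(Space, ℂ)) (p q : N → ℂ) (u : N → ℝ) (i : N) :
    (vertices A p q u).adj.op i = mulOp (star (A (u i))) := by
  change starRingEnd ℂ 1 • _ = _
  rw [map_one, one_smul]
  rfl

namespace BoseGas

variable (G : BoseGas)

lemma memLp_tail {X : Type*} [TopologicalSpace X] {D : Set X} {N : Type*} [DecidableEq N]
    {V : X → Vertices N} (hu : ∀ i, ContinuousOn (fun x => (V x).u i) D)
    (hop : ∀ i, ContinuousOn (fun x => (V x).op i) D)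
    (hg : ∀ i, ContinuousOn (fun x => toL2 ((V x).g i)) D) {q : N → ℂ} (hq : ∀ x, (V x).q = q)
    [MeasurableSpace X] [OpensMeasurableSpace X] (μ : Measure X)
    (hD : MeasurableSet D) {M : ℝ} (hM : 0 ≤ M) {s : X → ℝ} (hs : ContinuousOn s D)
    {f : X → OneParticle} (hf : ContinuousOn f D) (hfM : ∀ x ∈ D, ‖f x‖ ≤ M) (S : Finset N)
    (hopM : ∀ x ∈ D, ∀ i, ‖(V x).op i‖ ≤ M) (hgM : ∀ x ∈ D, ∀ i, ‖toL2 ((V x).g i)‖ ≤ M)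
    (hV : ∀ x ∈ D, G.ApartOn (V x) S) (hsi : ∀ x ∈ D, ∀ i ∈ S, G.Apart (s x) ((V x).u i)) :
    MemLp (fun x => G.tail (V x) (s x) (f x) S) ∞ (μ.restrict D) := by
  simp only [tail, hq]
  refine memLp_finsetSum _ fun k hk => MemLp.const_mul ?_ _
  refine G.memLp_link hu hop μ hD hM (hu k) hs (hg k) hf (fun x hx => hgM x hx k) hfM hopM
    (G.continuousOn_thermal (hu k) hs fun x hx => hsi x hx k hk) _
    (fun x hx => (hV x hx).mono (Finset.erase_subset _ _))
    (fun x hx i hi => hsi x hx i (Finset.mem_of_mem_erase hi)) fun x hx i hi => ?_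
  exact hV x hx i (Finset.mem_of_mem_erase hi) k hk (Finset.ne_of_mem_erase hi)

section Distinct

variable (N : Type*)

/-- Distinct times in `(0, β)`. -/
def distinct : Set (N → ℝ) := {u | (∀ i, u i ∈ Set.Ioo 0 G.β) ∧ Function.Injective u}

variable {N} {G}

lemma mem_Icc_of_distinct {u : N → ℝ} (hu : u ∈ G.distinct N) (i : N) : u i ∈ Set.Icc 0 G.β :=
  Set.Ioo_subset_Icc_self (hu.1 i)

lemma apart_of_distinct {u : N → ℝ} (hu : u ∈ G.distinct N) {i j : N} (hij : i ≠ j) :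
    G.Apart (u i) (u j) :=
  G.apart_of_mem (Set.Ioo_subset_Ico_self (hu.1 i)) (Set.Ioo_subset_Ico_self (hu.1 j))
    (hu.2.ne hij)

lemma zero_apart_of_mem {u : ℝ} (hu : u ∈ Set.Ioo 0 G.β) : G.Apart 0 u :=
  G.apart_of_mem ⟨le_rfl, G.β_pos⟩ (Set.Ioo_subset_Ico_self hu) hu.1.ne

lemma apartOn_vertices (A : ℝ → C_c(Space, ℂ)) (p q : N → ℂ) {u : N → ℝ} (hu : u ∈ G.distinct N)
    (S : Finset N) : G.ApartOn (vertices A p q u) S :=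
  fun _ _ _ _ hij => apart_of_distinct hu hij

lemma apartOn_vertices_adj (A : ℝ → C_c(Space, ℂ)) (p q : N → ℂ) {u : N → ℝ}
    (hu : u ∈ G.distinct N) (S : Finset N) : G.ApartOn (vertices A p q u).adj S :=
  fun _ _ _ _ hij => (apart_of_distinct hu hij).neg

variable (G) in
lemma measurableSet_distinct [Countable N] : MeasurableSet (G.distinct N) := by
  have h : G.distinct N = {u : N → ℝ | ∀ i, u i ∈ Set.Ioo 0 G.β} ∩
      {u : N → ℝ | Function.Injective u} := rfl
  rw [h]
  refine MeasurableSet.inter ?_ ?_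
  · rw [Set.ofPred_forall]
    exact MeasurableSet.iInter fun i => measurableSet_Ioo.preimage (measurable_pi_apply i)
  · have : {u : N → ℝ | Function.Injective u} = ⋂ i, ⋂ j, {u | u i = u j → i = j} := by
      ext u; simp [Function.Injective]
    rw [this]
    refine MeasurableSet.iInter fun i => MeasurableSet.iInter fun j => ?_
    by_cases hij : i = j
    · simp [hij]
    · simp only [hij, imp_false]
      exact (measurableSet_eq_fun (measurable_pi_apply i) (measurable_pi_apply j)).compl

lemma ae_linear_ne_zero {E : Type*} [NormedAddCommGroup E] [NormedSpace ℝ E] [MeasurableSpace E]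
    [BorelSpace E] [FiniteDimensional ℝ E] (μ : Measure E) [μ.IsAddHaarMeasure] (φ : E →ₗ[ℝ] ℝ)
    (hφ : φ ≠ 0) : ∀ᵐ x ∂μ, φ x ≠ 0 := by
  rw [ae_iff]
  simp only [not_not]
  exact Measure.addHaar_submodule μ (LinearMap.ker φ) fun h => hφ (LinearMap.ker_eq_top.1 h)

lemma ae_injective [Fintype N] : ∀ᵐ u : N → ℝ, Function.Injective u := by
  classical
  have h : ∀ i j : N, ∀ᵐ u : N → ℝ, u i = u j → i = j := by
    intro i j
    by_cases hij : i = j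
    · simp [hij]
    · have := ae_linear_ne_zero (volume : Measure (N → ℝ))
        (LinearMap.proj (R := ℝ) (φ := fun _ : N => ℝ) i - LinearMap.proj j) (fun h => by
          have := LinearMap.congr_fun h (Pi.single i 1)
          simp [hij] at this)
      filter_upwards [this] with u hu h
      exact absurd (by simpa [sub_eq_zero] using h) hu
  filter_upwards [ae_all_iff.2 fun i => ae_all_iff.2 (h i)] with u hu i j hij
  exact hu i j hij

variable (G) in
lemma distinct_ae_eq_cube (n : ℕ) : G.distinct (Fin n) =ᵐ[volume] G.cube n := by
  filter_upwards [ae_injective (N := Fin n)] with u hu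
  refine propext ⟨fun h => ?_, fun h => ?_⟩
  · exact fun i _ => h.1 i
  · exact ⟨fun i => h i trivial, hu⟩

variable (G) in
lemma restrict_distinct (n : ℕ) :
    (volume : Measure (Fin n → ℝ)).restrict (G.distinct (Fin n)) = volume.restrict (G.cube n) :=
  Measure.restrict_congr_set (G.distinct_ae_eq_cube n)

lemma continuousOn_comp_time {Y : Type*} [TopologicalSpace Y] {F : ℝ → Y}
    (hF : ContinuousOn F (Set.Icc 0 G.β)) (i : N) :
    ContinuousOn (fun u : N → ℝ => F (u i)) (G.distinct N) :=
  hF.comp (continuous_apply i).continuousOn fun _ hu => mem_Icc_of_distinct hu i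

end Distinct

section Bounded

variable {G} {A : ℝ → C_c(Space, ℂ)} (hA : G.Regular A) {N : Type*} [Fintype N]
include hA

lemma Regular.memLp_tail [DecidableEq N] (p q : N → ℂ) {s : (N → ℝ) → ℝ}
    (hs : ContinuousOn s (G.distinct N)) {f : (N → ℝ) → OneParticle}
    (hf : ContinuousOn f (G.distinct N)) {M : ℝ} (hfM : ∀ u ∈ G.distinct N, ‖f u‖ ≤ M)
    (S : Finset N) (hsi : ∀ u ∈ G.distinct N, ∀ i ∈ S, G.Apart (s u) (u i)) :
    MemLp (fun u => G.tail (vertices A p q u) (s u) (f u) S) ∞ (volume.restrict (G.distinct N)) := by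
  obtain ⟨M', hM', h⟩ := hA.exists_norm_le
  refine G.memLp_tail (V := fun u => vertices A p q u) (q := q)
    (fun i => (continuous_apply i).continuousOn) (fun i => ?_)
    (fun i => continuousOn_comp_time hA.continuousOn_toL2 i) (fun _ => rfl) volume
    G.measurableSet_distinct (le_max_of_le_right hM' : 0 ≤ max M M') hs hf
    (fun u hu => (hfM u hu).trans (le_max_left _ _)) S (fun u hu i => ?_)
    (fun u hu i => ((h _ (mem_Icc_of_distinct hu i)).2).trans (le_max_right _ _))
    (fun u hu => apartOn_vertices A p q hu S) hsi
  · simp only [vertices_op]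
    exact continuousOn_comp_time hA.continuousOn_mulOp i
  · simp only [vertices_op]
    exact ((h _ (mem_Icc_of_distinct hu i)).1).trans (le_max_right _ _)

lemma Regular.memLp_tailStar [DecidableEq N] (p q : N → ℂ) {v : (N → ℝ) → ℝ}
    (hv : ContinuousOn v (G.distinct N)) {f : (N → ℝ) → OneParticle}
    (hf : ContinuousOn f (G.distinct N)) {M : ℝ} (hfM : ∀ u ∈ G.distinct N, ‖f u‖ ≤ M)
    (S : Finset N) (hvi : ∀ u ∈ G.distinct N, ∀ i ∈ S, G.Apart (v u) (u i)) :
    MemLp (fun u => G.tailStar (vertices A p q u) (v u) (f u) S) ∞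
      (volume.restrict (G.distinct N)) := by
  obtain ⟨M', hM', h⟩ := hA.star.exists_norm_le
  refine MemLp.star (R := ℂ) ?_
  refine G.memLp_tail (V := fun u => (vertices A p q u).adj) (q := fun i => starRingEnd ℂ (p i))
    (fun i => (continuous_apply i).continuousOn.neg) (fun i => ?_)
    (fun i => continuousOn_comp_time hA.star.continuousOn_toL2 i) (fun _ => rfl) volume
    G.measurableSet_distinct (le_max_of_le_right hM' : 0 ≤ max M M') hv.neg hf
    (fun u hu => (hfM u hu).trans (le_max_left _ _)) S (fun u hu i => ?_)
    (fun u hu i => ((h _ (mem_Icc_of_distinct hu i)).2).trans (le_max_right _ _))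
    (fun u hu => apartOn_vertices_adj A p q hu S) (fun u hu i hi => (hvi u hu i hi).neg)
  · simp only [vertices_adj_op]
    exact continuousOn_comp_time hA.star.continuousOn_mulOp i
  · simp only [vertices_adj_op]
    exact ((h _ (mem_Icc_of_distinct hu i)).1).trans (le_max_right _ _)

/-- Without linear fields all contractions close up to loops. Operator norms do not suffice here,
and the estimate on kernels enters. -/
lemma Regular.memLp_gauss_sq (I : Finset N) :
    MemLp (fun u => G.gauss (∏ i ∈ I, MvPolynomial.X (.sq (u i) (A (u i))))) ∞
      (volume.restrict (G.distinct N)) := by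
  classical
  obtain ⟨S, M, hS, -, hM⟩ := hA.exists_bound
  have h1 : ∀ u : N → ℝ, G.gauss (∏ i ∈ I, MvPolynomial.X (.sq (u i) (A (u i)))) =
      ∑ σ : Empty ⊕ I ≃ Empty ⊕ I, ∫ x, G.loopIntegrand (fun i : I => A (u i)) (fun i : I => u i)
        (loopMap σ) x := by
    intro u
    have h := G.gauss_eq_val (fun i : Empty => i.elim) (fun i : Empty => i.elim)
      (fun i : I => (u i, A (u i)))
    simp only [Finset.univ_eq_empty, Finset.prod_empty, one_mul, FieldGen.mkSq] at h
    rw [Finset.prod_coe_sort I (fun i => (MvPolynomial.X (.sq (u i) (A (u i))) :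
      MvPolynomial FieldGen ℂ)), val_eq_sum_loopIntegrand] at h
    rw [h]
    exact Finset.sum_equiv (Equiv.refl _) (by simp) fun _ _ => rfl
  simp only [h1]
  refine memLp_finsetSum _ fun σ _ => ?_
  obtain ⟨C, hC⟩ := G.exists_lintegral_loopIntegrand_le hS M (loopMap σ)
  -- Nothing is known of `A` outside [0, β]; cutting it off there makes it jointly measurable
  -- without changing the integrand at admissible times.
  let a : ℝ → Space → ℂ := fun u x => (Set.Icc 0 G.β).indicator (fun u => A u x) u
  have hae : (fun u : N → ℝ => ∫ x, G.loopIntegrand (fun i : I => a (u i)) (fun i : I => u i)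
      (loopMap σ) x) =ᵐ[volume.restrict (G.distinct N)] fun u =>
      ∫ x, G.loopIntegrand (fun i : I => A (u i)) (fun i : I => u i) (loopMap σ) x := by
    filter_upwards [ae_restrict_mem G.measurableSet_distinct] with u hu
    have : ∀ i : I, a (u i) = A (u i) := fun i => by
      ext x
      exact Set.indicator_of_mem (mem_Icc_of_distinct hu _) _
    simp only [this]
  refine memLp_top_of_bound ?_ (max C 0) ?_
  · refine AEStronglyMeasurable.congr ?_ hae
    refine StronglyMeasurable.aestronglyMeasurable ?_
    exact (G.stronglyMeasurable_integral_loopIntegrand (ι := I) a hA.measurable_indicator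
      (loopMap σ)).comp_measurable
      (measurable_pi_lambda (fun (u : N → ℝ) (i : I) => u i) fun i => measurable_pi_apply _)
  · filter_upwards [ae_restrict_mem G.measurableSet_distinct] with u hu
    have h2 := (enorm_integral_le_lintegral_enorm _).trans (hC (fun i : I => A (u i))
      (fun i : I => u i) (fun i => (hM _ (mem_Icc_of_distinct hu i)).1)
      (fun i => (hM _ (mem_Icc_of_distinct hu i)).2.2) (fun i => hu.1 i)
      (fun i j hij => Subtype.ext (hu.2 hij)))
    rw [← ofReal_norm, ENNReal.ofReal_le_ofReal_iff'] at h2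
    exact le_max_iff.2 h2

end Bounded

end BoseGas

/-! ### Boundedness of the correlation functions of the interaction -/

namespace BoseGas

variable {G : BoseGas}

section Bounded

variable {A : ℝ → C_c(Space, ℂ)} {N : Type*} [DecidableEq N]

lemma gauss_prod_add_mul (G : BoseGas) {I : Finset N} {i : N} (hi : i ∈ I)
    (a b : N → MvPolynomial FieldGen ℂ) (z : ℂ) (x : MvPolynomial FieldGen ℂ)
    (hne : ∀ j, j ≠ i → a j = b j) (h : a i = MvPolynomial.C z * x + b i) :
    G.gauss (∏ j ∈ I, a j) = G.gauss (∏ j ∈ I, b j) + z * G.gauss (x * ∏ j ∈ I.erase i, a j) := by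
  rw [← Finset.mul_prod_erase I a hi, ← Finset.mul_prod_erase I b hi, h,
    Finset.prod_congr rfl fun j hj => hne j (Finset.ne_of_mem_erase hj), add_mul, map_add, add_comm,
    mul_assoc, ← MvPolynomial.smul_eq_C_mul, map_smul, smul_eq_mul]

omit [DecidableEq N] in
lemma vertices_poly (A : ℝ → C_c(Space, ℂ)) (p q : N → ℂ) (u : N → ℝ) (i : N) :
    (vertices A p q u).poly i =
      MvPolynomial.C (p i) * MvPolynomial.X (.ann (u i) (toL2 (star (A (u i))))) +
      MvPolynomial.C (q i) * MvPolynomial.X (.cre (u i) (toL2 (A (u i)))) +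
      MvPolynomial.X (.sq (u i) (A (u i))) := by
  have h : (vertices A p q u).poly i =
      MvPolynomial.C (p i) * MvPolynomial.X (.ann (u i) (toL2 (star (A (u i))))) +
      MvPolynomial.C (q i) * MvPolynomial.X (.cre (u i) (toL2 (A (u i)))) +
      MvPolynomial.C 1 * MvPolynomial.X (.sq (u i) (A (u i))) := rfl
  rw [h, map_one, one_mul]

/-- The correlation function is affine in the coefficient `p i`. Its slope contains a field Ψ times
the other vertices, and the path expansion reduces this to fewer vertices. -/
lemma gauss_vertices_update_left (p q : N → ℂ) {u : N → ℝ} (hu : u ∈ G.distinct N) {I : Finset N}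
    {i : N} (hi : i ∈ I) :
    G.gauss (∏ j ∈ I, (vertices A p q u).poly j) =
      G.gauss (∏ j ∈ I, (vertices A (Function.update p i 0) q u).poly j) +
      p i * ∑ S ∈ (I.erase i).powerset,
        G.tail (vertices A p q u) (u i) (toL2 (star (A (u i)))) S *
          G.gauss (∏ j ∈ I.erase i \ S, (vertices A p q u).poly j) := by
  rw [← gauss_ann_mul G (vertices A p q u) _ _ (apartOn_vertices A p q hu _)]
  refine gauss_prod_add_mul G hi _ _ _ _ (fun j hj => ?_) ?_
  · rw [vertices_poly, vertices_poly, Function.update_of_ne hj]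
  · rw [vertices_poly, vertices_poly, Function.update_self, map_zero, zero_mul, zero_add, add_assoc]

lemma gauss_vertices_update_right (p q : N → ℂ) {u : N → ℝ} (hu : u ∈ G.distinct N) {I : Finset N}
    {i : N} (hi : i ∈ I) :
    G.gauss (∏ j ∈ I, (vertices A p q u).poly j) =
      G.gauss (∏ j ∈ I, (vertices A p (Function.update q i 0) u).poly j) +
      q i * ∑ S ∈ (I.erase i).powerset,
        G.tailStar (vertices A p q u) (u i) (toL2 (A (u i))) S *
          G.gauss (∏ j ∈ I.erase i \ S, (vertices A p q u).poly j) := by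
  rw [← gauss_cre_mul G (vertices A p q u) _ _ (apartOn_vertices A p q hu _)]
  refine gauss_prod_add_mul G hi _ _ _ _ (fun j hj => ?_) ?_
  · rw [vertices_poly, vertices_poly, Function.update_of_ne hj]
  · rw [vertices_poly, vertices_poly, Function.update_self, map_zero, zero_mul, add_zero,
      add_left_comm, add_assoc]

variable [Fintype N] (hA : G.Regular A)
include hA

omit [DecidableEq N] [Fintype N] in
lemma Regular.exists_norm_toL2_le : ∃ M : ℝ, ∀ u ∈ G.distinct N, ∀ i, ‖toL2 (A (u i))‖ ≤ M := by
  obtain ⟨M, -, h⟩ := hA.exists_norm_le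
  exact ⟨M, fun u hu i => (h _ (mem_Icc_of_distinct hu i)).2⟩

/-- Correlation functions of the interaction are bounded and measurable in the times. -/
lemma Regular.memLp_gauss (p q : N → ℂ) (I : Finset N) :
    MemLp (fun u => G.gauss (∏ i ∈ I, (vertices A p q u).poly i)) ∞
      (volume.restrict (G.distinct N)) := by
  induction I using Finset.strongInduction generalizing p q with
  | H I ih =>
    have hmem := ae_restrict_mem (μ := volume) (measurableSet_distinct (G := G) (N := N))
    have hsum : ∀ (i : N), i ∈ I → ∀ (p q : N → ℂ) (T : Finset N → (N → ℝ) → ℂ),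
        (∀ S ⊆ I.erase i, MemLp (T S) ∞ (volume.restrict (G.distinct N))) →
        MemLp (fun u => ∑ S ∈ (I.erase i).powerset, T S u *
          G.gauss (∏ j ∈ I.erase i \ S, (vertices A p q u).poly j)) ∞
          (volume.restrict (G.distinct N)) := by
      intro i hi p q T hT
      refine memLp_finsetSum _ fun S hS => ?_
      exact (ih (I.erase i \ S)
        (Finset.sdiff_subset.trans_ssubset (Finset.erase_ssubset hi)) p q).mul
        (hT S (Finset.mem_powerset.1 hS))
    have h0 : ∀ i, ∀ S ⊆ I.erase i, ∀ j ∈ S, i ≠ j := fun i S hS j hj h =>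
      Finset.notMem_erase i I (h ▸ hS hj)
    -- The Ψ* parts are switched on one vertex at a time, starting from squares only. Each
    -- difference involves correlation functions of strictly fewer vertices, known from the outer
    -- induction.
    have hq : ∀ Q : Finset N, ∀ q : N → ℂ, (∀ i ∉ Q, q i = 0) →
        MemLp (fun u => G.gauss (∏ i ∈ I, (vertices A 0 q u).poly i)) ∞
          (volume.restrict (G.distinct N)) := by
      intro Q
      induction Q using Finset.induction_on with
      | empty =>
        intro q hq
        refine (hA.memLp_gauss_sq I).ae_eq (Filter.Eventually.of_forall fun u => ?_)
        simp [vertices_poly, hq]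
      | insert i Q _ ihQ =>
        intro q hq
        have hq' : MemLp (fun u => G.gauss (∏ j ∈ I, (vertices A 0 (Function.update q i 0) u).poly j))
            ∞ (volume.restrict (G.distinct N)) := ihQ _ fun j hj => by
          by_cases hji : j = i
          · rw [hji, Function.update_self]
          · rw [Function.update_of_ne hji]
            exact hq j (by simp [hji, hj])
        by_cases hi : i ∈ I
        · obtain ⟨M, hM⟩ := hA.exists_norm_toL2_le (N := N)
          refine (hq'.add ((hsum i hi 0 q _ fun S hS => hA.memLp_tailStar 0 q (v := fun u => u i)
            (continuous_apply i).continuousOn (continuousOn_comp_time hA.continuousOn_toL2 i)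
            (fun u hu => hM u hu i) S
            fun u hu j hj => apart_of_distinct hu (h0 i S hS j hj)).const_mul (q i))).ae_eq ?_
          filter_upwards [hmem] with u hu
          exact (gauss_vertices_update_right 0 q hu hi).symm
        · refine hq'.ae_eq (Filter.Eventually.of_forall fun u => ?_)
          refine congrArg G.gauss (Finset.prod_congr rfl fun j hj => ?_)
          rw [vertices_poly, vertices_poly, Function.update_of_ne (show j ≠ i from fun h => hi (h ▸ hj))]
    -- The same for the Ψ parts, now with `q` arbitrary.
    have hp : ∀ P : Finset N, ∀ p : N → ℂ, (∀ i ∉ P, p i = 0) →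
        MemLp (fun u => G.gauss (∏ i ∈ I, (vertices A p q u).poly i)) ∞
          (volume.restrict (G.distinct N)) := by
      intro P
      induction P using Finset.induction_on with
      | empty =>
        intro p hp
        obtain rfl : p = 0 := funext fun i => hp i (Finset.notMem_empty i)
        exact hq Finset.univ q fun i hi => absurd (Finset.mem_univ i) hi
      | insert i P _ ihP =>
        intro p hp
        have hp' : MemLp (fun u => G.gauss (∏ j ∈ I, (vertices A (Function.update p i 0) q u).poly j))
            ∞ (volume.restrict (G.distinct N)) := ihP _ fun j hj => by
          by_cases hji : j = i
          · rw [hji, Function.update_self]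
          · rw [Function.update_of_ne hji]
            exact hp j (by simp [hji, hj])
        by_cases hi : i ∈ I
        · obtain ⟨M, hM⟩ := hA.star.exists_norm_toL2_le (N := N)
          refine (hp'.add ((hsum i hi p q _ fun S hS => hA.memLp_tail p q (s := fun u => u i)
            (continuous_apply i).continuousOn (continuousOn_comp_time hA.star.continuousOn_toL2 i)
            (fun u hu => hM u hu i) S
            fun u hu j hj => apart_of_distinct hu (h0 i S hS j hj)).const_mul (p i))).ae_eq ?_
          filter_upwards [hmem] with u hu
          exact (gauss_vertices_update_left p q hu hi).symm
        · refine hp'.ae_eq (Filter.Eventually.of_forall fun u => ?_)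
          refine congrArg G.gauss (Finset.prod_congr rfl fun j hj => ?_)
          rw [vertices_poly, vertices_poly, Function.update_of_ne (show j ≠ i from fun h => hi (h ▸ hj))]
    exact hp Finset.univ p fun i hi => absurd (Finset.mem_univ i) hi

end Bounded

end BoseGas

/-! ### Correlation functions and connected functions in terms of paths -/

lemma Q_eq_observable {N : Type*} (φ₀ : ℝ) (A : ℝ → C_c(Space, ℂ)) (u : N → ℝ) (i : N) :
    Q φ₀ A (u i) = (vertices A (fun _ => (φ₀ : ℂ)) (fun _ => (φ₀ : ℂ)) u).observable i := by
  have h : (vertices A (fun _ => (φ₀ : ℂ)) (fun _ => (φ₀ : ℂ)) u).observable i =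
    (φ₀ : ℂ) • obs (.ann (u i) (toL2 (star (A (u i))))) + (φ₀ : ℂ) • obs (.cre (u i) (toL2 (A (u i)))) +
    (1 : ℂ) • obs (.sq (u i) (A (u i))) := rfl
  rw [h, Q, Q1, Q2, smul_add, one_smul]

lemma Q2_eq_observable {N : Type*} (A : ℝ → C_c(Space, ℂ)) (u : N → ℝ) (i : N) :
    Q2 A (u i) = (vertices A 0 0 u).observable i := by
  have h : (vertices A 0 0 u).observable i =
    (0 : ℂ) • obs (.ann (u i) (toL2 (star (A (u i))))) + (0 : ℂ) • obs (.cre (u i) (toL2 (A (u i)))) +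
    (1 : ℂ) • obs (.sq (u i) (A (u i))) := rfl
  rw [h, Q2, zero_smul, zero_smul, zero_add, zero_add, one_smul]

/-- Quadratic vertices followed by one linear vertex. -/
def snocVertices {n : ℕ} (φ₀ : ℝ) (A : ℝ → C_c(Space, ℂ)) (u : Fin n → ℝ) (u₀ : ℝ) :
    Vertices (Fin (n + 1)) where
  u := Fin.snoc u u₀
  g i := A ((Fin.snoc u u₀ : Fin (n + 1) → ℝ) i)
  p := Fin.snoc 0 (φ₀ : ℂ)
  q := Fin.snoc 0 (φ₀ : ℂ)
  r := Fin.snoc 1 0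

lemma ofFn_snocVertices {n : ℕ} (φ₀ : ℝ) (A : ℝ → C_c(Space, ℂ)) (u : Fin n → ℝ) (u₀ : ℝ) :
    List.ofFn (snocVertices φ₀ A u u₀).observable =
      List.ofFn (fun i => Q2 A (u i)) ++ [Q1 φ₀ A u₀] := by
  rw [List.ofFn_succ', List.concat_eq_append]
  have h1 : ∀ i, (snocVertices φ₀ A u u₀).observable (Fin.castSucc i) = Q2 A (u i) := by
    intro i
    rw [Q2_eq_observable]
    simp [Vertices.observable, snocVertices, vertices]
  have h2 : (snocVertices φ₀ A u u₀).observable (Fin.last n) = Q1 φ₀ A u₀ := by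
    simp [Vertices.observable, snocVertices, Q1]
  simp only [h1, h2]

namespace BoseGas

variable (G : BoseGas)

lemma link_map {M N : Type*} [DecidableEq M] [DecidableEq N] (V : Vertices N) (W : Vertices M)
    (e : M ↪ N) (v : ℝ) (h : OneParticle) (s : ℝ) (f : OneParticle) (S : Finset M)
    (hu : ∀ i ∈ S, V.u (e i) = W.u i) (hop : ∀ i ∈ S, V.op (e i) = W.op i) :
    G.link V v h s f (S.map e) = G.link W v h s f S := by
  rw [link, link, chainSum_map G V W e v s S hu hop]

/-- All contractions of `Ψ(f)` at time `0` through the quadratic vertices with the field `Ψ*` of a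
linear vertex. -/
def annLine (A : ℝ → C_c(Space, ℂ)) (f : OneParticle) {N : Type*} [Fintype N] (u₀ : ℝ)
    (u : N → ℝ) : ℂ :=
  G.link (vertices A 0 0 u) u₀ (toL2 (A u₀)) 0 f Finset.univ

/-- All contractions of `Ψ*(h)` at time `0` through the quadratic vertices with the field `Ψ` of a
linear vertex. -/
def creLine (A : ℝ → C_c(Space, ℂ)) (h : OneParticle) {N : Type*} [Fintype N] (u₀ : ℝ)
    (u : N → ℝ) : ℂ :=
  starRingEnd ℂ
    (G.link (vertices A 0 0 u).adj (-u₀) (toL2 (star (A u₀))) (-0) h Finset.univ)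

lemma univ_erase_last (n : ℕ) : (Finset.univ : Finset (Fin (n + 1))).erase (Fin.last n) =
    Finset.univ.map Fin.castSuccEmb := by
  ext i
  refine Fin.lastCases ?_ (fun i => ?_) i
  · simp
  · simp

lemma univ_erase_eq_map {n : ℕ} (k : Fin (n + 1)) :
    (Finset.univ : Finset (Fin (n + 1))).erase k = Finset.univ.map (Fin.succAboveEmb k) := by
  ext i
  simp only [Finset.mem_erase, Finset.mem_univ, and_true, Finset.mem_map, true_and,
    Fin.coe_succAboveEmb, Fin.exists_succAbove_eq_iff]

/-- A path can end only where the coefficient of Ψ* is nonzero, that is at the last vertex; it must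
pass all the others before. -/
lemma tail_snocVertices {n : ℕ} (φ₀ : ℝ) (A : ℝ → C_c(Space, ℂ)) (u : Fin n → ℝ) (u₀ : ℝ)
    (f : OneParticle) :
    G.tail (snocVertices φ₀ A u u₀) 0 f Finset.univ = φ₀ * G.annLine A f u₀ u := by
  rw [tail, Fin.sum_univ_castSucc]
  have h1 : ∀ i : Fin n, (snocVertices φ₀ A u u₀).q (Fin.castSucc i) = 0 := fun i => by
    simp [snocVertices]
  have h2 : (snocVertices φ₀ A u u₀).q (Fin.last n) = φ₀ := by simp [snocVertices]
  have h3 : (snocVertices φ₀ A u u₀).u (Fin.last n) = u₀ := by simp [snocVertices]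
  have h4 : (snocVertices φ₀ A u u₀).g (Fin.last n) = A u₀ := by simp [snocVertices]
  simp only [h1, zero_mul, Finset.sum_const_zero, zero_add]
  rw [h2, h3, h4, univ_erase_last, annLine, G.link_map _ (vertices A 0 0 u)]
  · intro i _; simp [snocVertices, vertices]
  · intro i _; simp [Vertices.op, snocVertices, vertices]

lemma tailStar_snocVertices {n : ℕ} (φ₀ : ℝ) (A : ℝ → C_c(Space, ℂ)) (u : Fin n → ℝ) (u₀ : ℝ)
    (h : OneParticle) :
    G.tailStar (snocVertices φ₀ A u u₀) 0 h Finset.univ = φ₀ * G.creLine A h u₀ u := by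
  rw [tailStar, tail, Fin.sum_univ_castSucc]
  have h1 : ∀ i : Fin n, (snocVertices φ₀ A u u₀).adj.q (Fin.castSucc i) = 0 := fun i => by
    simp [snocVertices, Vertices.adj]
  have h2 : (snocVertices φ₀ A u u₀).adj.q (Fin.last n) = φ₀ := by
    simp [snocVertices, Vertices.adj]
  have h3 : (snocVertices φ₀ A u u₀).adj.u (Fin.last n) = -u₀ := by
    simp [snocVertices, Vertices.adj]
  have h4 : (snocVertices φ₀ A u u₀).adj.g (Fin.last n) = star (A u₀) := by
    simp [snocVertices, Vertices.adj]
  simp only [h1, zero_mul, Finset.sum_const_zero, zero_add]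
  rw [h2, h3, h4, univ_erase_last, creLine, G.link_map _ (vertices A 0 0 u).adj, map_mul,
    Complex.conj_ofReal]
  · intro i _; simp [snocVertices, vertices, Vertices.adj]
  · intro i _; simp [Vertices.op, snocVertices, vertices, Vertices.adj]

/-- With the full interaction any vertex may serve as the linear end of the path. The remaining ones
enter through their quadratic parts only. -/
lemma tail_vertices (A : ℝ → C_c(Space, ℂ)) (p : ℂ) {n : ℕ} (u : Fin (n + 1) → ℝ)
    (f : OneParticle) :
    G.tail (vertices A (fun _ => p) (fun _ => p) u) 0 f Finset.univ =
      ∑ k, p * G.annLine A f (u k) fun i => u (k.succAbove i) := by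
  rw [tail]
  refine Finset.sum_congr rfl fun k _ => ?_
  rw [univ_erase_eq_map, annLine, G.link_map _ (vertices A 0 0 fun i => u (k.succAbove i))]
  · rfl
  · intro i _; rfl
  · intro i _; rw [vertices_op, vertices_op]; rfl

lemma tailStar_vertices (A : ℝ → C_c(Space, ℂ)) (φ₀ : ℝ) {n : ℕ} (u : Fin (n + 1) → ℝ)
    (h : OneParticle) :
    G.tailStar (vertices A (fun _ => (φ₀ : ℂ)) (fun _ => (φ₀ : ℂ)) u) 0 h Finset.univ =
      ∑ k, φ₀ * G.creLine A h (u k) fun i => u (k.succAbove i) := by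
  rw [tailStar, tail, map_sum]
  refine Finset.sum_congr rfl fun k _ => ?_
  rw [univ_erase_eq_map, creLine, G.link_map _ (vertices A 0 0 fun i => u (k.succAbove i)).adj,
    map_mul]
  · refine congrArg₂ (· * ·) ?_ rfl
    exact Complex.conj_conj _
  · intro i _; rfl
  · intro i _; rw [vertices_adj_op, vertices_adj_op]; rfl

section Formulas

variable {G} (φ₀ : ℝ) (A : ℝ → C_c(Space, ℂ)) {n : ℕ} {u : Fin n → ℝ} (hu : u ∈ G.distinct (Fin n))
include hu

lemma vertexCorr_of (w₀ : FreeMonoid FieldGen) (hw₀ : w₀.toList.Pairwise G.Ordered)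
    (h₀ : ∀ b ∈ w₀.toList, b.time = 0) :
    G.vertexCorr φ₀ A (MonoidAlgebra.of ℂ (FreeMonoid FieldGen) w₀) n u =
      G.gauss ((w₀.toList.map MvPolynomial.X).prod *
        ∏ i, (vertices A (fun _ => (φ₀ : ℂ)) (fun _ => (φ₀ : ℂ)) u).poly i) := by
  have h := G.state_mul_prod_observable
    (vertices A (fun _ => (φ₀ : ℂ)) (fun _ => (φ₀ : ℂ)) u) w₀ hw₀ (List.nodup_finRange n)
    (apartOn_vertices A _ _ hu _)
    (fun b hb i _ => by rw [h₀ b hb]; exact zero_apart_of_mem (hu.1 i))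
  rw [List.toFinset_finRange] at h
  rw [← h, vertexCorr, List.ofFn_eq_map]
  simp only [Q_eq_observable]

lemma vertexCorr_one : G.vertexCorr φ₀ A 1 n u =
    G.gauss (∏ i, (vertices A (fun _ => (φ₀ : ℂ)) (fun _ => (φ₀ : ℂ)) u).poly i) := by
  have h := vertexCorr_of φ₀ A hu 1 List.Pairwise.nil (fun b hb => by cases hb)
  rw [map_one] at h
  simpa using h

lemma vertexCorr_Psi (f : OneParticle) : G.vertexCorr φ₀ A (Psi f) n u =
    ∑ S ∈ Finset.univ.powerset,
      G.tail (vertices A (fun _ => (φ₀ : ℂ)) (fun _ => (φ₀ : ℂ)) u) 0 f S *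
      G.gauss (∏ i ∈ Finset.univ \ S,
        (vertices A (fun _ => (φ₀ : ℂ)) (fun _ => (φ₀ : ℂ)) u).poly i) := by
  rw [← gauss_ann_mul G _ _ _ (apartOn_vertices A _ _ hu _)]
  refine (vertexCorr_of φ₀ A hu (FreeMonoid.of (.ann 0 f)) (List.pairwise_singleton _ _)
    (fun b hb => ?_)).trans ?_
  · rw [FreeMonoid.toList_of, List.mem_singleton] at hb; rw [hb]; rfl
  · rw [FreeMonoid.toList_of, List.map_singleton, List.prod_singleton]

lemma vertexCorr_PsiStar (h : OneParticle) : G.vertexCorr φ₀ A (PsiStar h) n u =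
    ∑ S ∈ Finset.univ.powerset,
      G.tailStar (vertices A (fun _ => (φ₀ : ℂ)) (fun _ => (φ₀ : ℂ)) u) 0 h S *
      G.gauss (∏ i ∈ Finset.univ \ S,
        (vertices A (fun _ => (φ₀ : ℂ)) (fun _ => (φ₀ : ℂ)) u).poly i) := by
  rw [← gauss_cre_mul G _ _ _ (apartOn_vertices A _ _ hu _)]
  refine (vertexCorr_of φ₀ A hu (FreeMonoid.of (.cre 0 h)) (List.pairwise_singleton _ _)
    (fun b hb => ?_)).trans ?_
  · rw [FreeMonoid.toList_of, List.mem_singleton] at hb; rw [hb]; rfl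
  · rw [FreeMonoid.toList_of, List.map_singleton, List.prod_singleton]

omit hu in
lemma Psi_mul_PsiStar (f h : OneParticle) : Psi f * PsiStar h =
    MonoidAlgebra.of ℂ (FreeMonoid FieldGen)
      (FreeMonoid.of (.ann 0 f) * FreeMonoid.of (.cre 0 h)) := by
  rw [map_mul]; rfl

omit hu in
variable (G) in
lemma pairwise_ordered_ann_cre (f h : OneParticle) :
    (FreeMonoid.of (FieldGen.ann 0 f) * FreeMonoid.of (FieldGen.cre 0 h)).toList.Pairwise
      G.Ordered ∧ ∀ b ∈ (FreeMonoid.of (FieldGen.ann 0 f) *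
        FreeMonoid.of (FieldGen.cre 0 h)).toList, b.time = 0 := by
  constructor
  · exact List.pairwise_pair.2 (Or.inr ⟨trivial, trivial, rfl⟩)
  · intro b hb
    rcases List.mem_pair.1 hb with rfl | rfl <;> rfl

/-- In the link both linear coefficients may be set to 0, since a joining path uses nothing of a
vertex but its square. This is where φ₀ leaves the truncated function. -/
lemma vertexCorr_Psi_mul_PsiStar (f h : OneParticle) :
    G.vertexCorr φ₀ A (Psi f * PsiStar h) n u =
    ∑ S ∈ Finset.univ.powerset,
      G.link (vertices A 0 0 u) 0 h 0 f S *
      G.gauss (∏ i ∈ Finset.univ \ S,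
        (vertices A (fun _ => (φ₀ : ℂ)) (fun _ => (φ₀ : ℂ)) u).poly i) +
    ∑ S ∈ Finset.univ.powerset,
      G.tail (vertices A (fun _ => (φ₀ : ℂ)) (fun _ => (φ₀ : ℂ)) u) 0 f S *
      G.gauss (MvPolynomial.X (.cre 0 h) * ∏ i ∈ Finset.univ \ S,
        (vertices A (fun _ => (φ₀ : ℂ)) (fun _ => (φ₀ : ℂ)) u).poly i) := by
  have h1 : ∀ S : Finset (Fin n), G.link (vertices A 0 0 u) 0 h 0 f S =
      G.link (vertices A (fun _ => (φ₀ : ℂ)) (fun _ => (φ₀ : ℂ)) u) 0 h 0 f S := by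
    intro S
    rw [← G.link_map (vertices A (fun _ => (φ₀ : ℂ)) (fun _ => (φ₀ : ℂ)) u) (vertices A 0 0 u)
      (Function.Embedding.refl _), Finset.map_refl]
    · intro i _; rfl
    · intro i _; rw [vertices_op, vertices_op]; rfl
  simp only [h1]
  rw [← gauss_ann_mul_cre_mul G _ _ _ _ _ (apartOn_vertices A _ _ hu _), Psi_mul_PsiStar]
  obtain ⟨h2, h3⟩ := G.pairwise_ordered_ann_cre f h
  rw [vertexCorr_of φ₀ A hu _ h2 h3]
  refine congrArg G.gauss ?_
  rw [← mul_assoc]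
  refine congrArg₂ (· * ·) ?_ rfl
  simp

/-- With purely quadratic vertices no path can end at a vertex, so all tails vanish and only the
joining paths remain. -/
lemma connected_Psi_mul_PsiStar (f h : OneParticle) :
    G.connected ((Psi f * PsiStar h) :: List.ofFn (fun i => Q2 A (u i))) =
      G.link (vertices A 0 0 u) 0 h 0 f Finset.univ := by
  obtain ⟨h2, h3⟩ := G.pairwise_ordered_ann_cre f h
  simp only [Q2_eq_observable]
  rw [Psi_mul_PsiStar]
  refine G.connected_cons_observable (vertices A 0 0 u) _ h2 (apartOn_vertices A _ _ hu _)
    (fun b hb i => by rw [h3 b hb]; exact zero_apart_of_mem (hu.1 i))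
    (G.link (vertices A 0 0 u) 0 h 0 f) fun J => ?_
  have h4 := gauss_ann_mul_cre_mul G (vertices A 0 0 u) 0 f 0 h (I := J)
    (apartOn_vertices A _ _ hu _)
  have h5 : ∀ S, G.tail (vertices A 0 0 u) 0 f S = 0 := fun S => by simp [tail, vertices]
  simp only [h5, zero_mul, Finset.sum_const_zero, add_zero] at h4
  rw [← h4]
  refine congrArg G.gauss ?_
  rw [← mul_assoc]
  refine congrArg₂ (· * ·) ?_ rfl
  simp

variable {u₀ : ℝ} (hu₀ : u₀ ∈ Set.Ioo 0 G.β) (hne : ∀ i, u i ≠ u₀)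
include hu₀ hne

lemma snoc_mem_distinct : (Fin.snoc u u₀ : Fin (n + 1) → ℝ) ∈ G.distinct (Fin (n + 1)) := by
  refine ⟨fun i => ?_, fun i j => ?_⟩
  · refine Fin.lastCases ?_ (fun i => ?_) i
    · simpa using hu₀
    · simpa using hu.1 i
  · refine Fin.lastCases ?_ (fun i => ?_) i <;> refine Fin.lastCases ?_ (fun j => ?_) j
    · simp
    · intro h; simp only [Fin.snoc_last, Fin.snoc_castSucc] at h; exact absurd h.symm (hne j)
    · intro h; simp only [Fin.snoc_last, Fin.snoc_castSucc] at h; exact absurd h (hne i)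
    · intro h; simp only [Fin.snoc_castSucc] at h; rw [hu.2 h]

lemma connected_Psi (f : OneParticle) :
    G.connected (Psi f :: (List.ofFn (fun i => Q2 A (u i)) ++ [Q1 φ₀ A u₀])) =
      φ₀ * G.annLine A f u₀ u := by
  have hd := snoc_mem_distinct hu hu₀ hne
  have hV : ∀ S, G.ApartOn (snocVertices φ₀ A u u₀) S := fun S i _ j _ hij =>
    apart_of_distinct hd hij
  rw [← ofFn_snocVertices, ← tail_snocVertices]
  refine G.connected_cons_observable _ (FreeMonoid.of (.ann 0 f)) (List.pairwise_singleton _ _)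
    (hV _) (fun b hb i => ?_) (G.tail (snocVertices φ₀ A u u₀) 0 f) fun J => ?_
  · rw [FreeMonoid.toList_of, List.mem_singleton] at hb
    rw [hb]
    exact zero_apart_of_mem (hd.1 i)
  · rw [← gauss_ann_mul G _ _ _ (hV J), FreeMonoid.toList_of, List.map_singleton,
      List.prod_singleton]

lemma connected_PsiStar (h : OneParticle) :
    G.connected (PsiStar h :: (List.ofFn (fun i => Q2 A (u i)) ++ [Q1 φ₀ A u₀])) =
      φ₀ * G.creLine A h u₀ u := by
  have hd := snoc_mem_distinct hu hu₀ hne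
  have hV : ∀ S, G.ApartOn (snocVertices φ₀ A u u₀) S := fun S i _ j _ hij =>
    apart_of_distinct hd hij
  rw [← ofFn_snocVertices, ← tailStar_snocVertices]
  refine G.connected_cons_observable _ (FreeMonoid.of (.cre 0 h)) (List.pairwise_singleton _ _)
    (hV _) (fun b hb i => ?_) (G.tailStar (snocVertices φ₀ A u u₀) 0 h) fun J => ?_
  · rw [FreeMonoid.toList_of, List.mem_singleton] at hb
    rw [hb]
    exact zero_apart_of_mem (hd.1 i)
  · rw [← gauss_cre_mul G _ _ _ (hV J), FreeMonoid.toList_of, List.map_singleton,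
      List.prod_singleton]

end Formulas

end BoseGas

/-! ### Formal power series: factorisation and division by ω(U) -/

namespace BoseGas

variable (G : BoseGas)

instance isFiniteMeasure_restrict_cube (n : ℕ) :
    IsFiniteMeasure ((volume : Measure (Fin n → ℝ)).restrict (G.cube n)) := by
  refine ⟨?_⟩
  rw [Measure.restrict_apply_univ, cube, volume_pi_pi]
  exact ENNReal.prod_lt_top fun _ _ => by simp

section Split

/-- Splitting of an integral over times into the integrals over two complementary groups. -/
lemma setIntegral_cube_mul {n k m : ℕ} (e : Fin k ⊕ Fin m ≃ Fin n) (x : (Fin k → ℝ) → ℂ)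
    (y : (Fin m → ℝ) → ℂ) :
    ∫ u in G.cube n, x (fun i => u (e (.inl i))) * y (fun j => u (e (.inr j))) =
      (∫ u in G.cube k, x u) * ∫ u in G.cube m, y u := by
  have h1 := volume_measurePreserving_sumPiEquivProdPi_symm (fun _ : Fin k ⊕ Fin m => ℝ)
  have h2 := volume_measurePreserving_piCongrLeft (fun _ : Fin n => ℝ) e
  have h3 := h2.comp h1
  have hemb := (MeasurableEquiv.piCongrLeft (fun _ : Fin n => ℝ) e).measurableEmbedding.comp
    (MeasurableEquiv.sumPiEquivProdPi (fun _ : Fin k ⊕ Fin m => ℝ)).symm.measurableEmbedding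
  rw [← h3.setIntegral_preimage_emb hemb]
  have hval : ∀ (p : (Fin k → ℝ) × (Fin m → ℝ)) (i : Fin k ⊕ Fin m),
      (MeasurableEquiv.piCongrLeft (fun _ : Fin n => ℝ) e)
        ((MeasurableEquiv.sumPiEquivProdPi (fun _ : Fin k ⊕ Fin m => ℝ)).symm p) (e i) =
      Sum.elim p.1 p.2 i := by
    intro p i
    rw [MeasurableEquiv.piCongrLeft_apply_apply]
    rcases i with i | i <;> rfl
  have hpre : (MeasurableEquiv.piCongrLeft (fun _ : Fin n => ℝ) e) ∘
      (MeasurableEquiv.sumPiEquivProdPi (fun _ : Fin k ⊕ Fin m => ℝ)).symm ⁻¹' G.cube n =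
      G.cube k ×ˢ G.cube m := by
    ext p
    simp only [cube, Set.mem_preimage, Set.mem_univ_pi, Set.mem_prod, Function.comp_apply]
    constructor
    · intro h
      refine ⟨fun i => ?_, fun i => ?_⟩
      · simpa only [hval, Sum.elim_inl] using h (e (.inl i))
      · simpa only [hval, Sum.elim_inr] using h (e (.inr i))
    · rintro ⟨hp1, hp2⟩ i
      obtain ⟨i, rfl⟩ := e.surjective i
      rw [hval]
      rcases i with i | i
      · exact hp1 i
      · exact hp2 i
  rw [hpre]
  simp only [Function.comp_apply, hval, Sum.elim_inl, Sum.elim_inr]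
  exact setIntegral_prod_mul x y (G.cube k) (G.cube m)

/-- The formal power series with the coefficients `(-1)ⁿ / n! ∫ F_n`. -/
def series (F : ∀ n, (Fin n → ℝ) → ℂ) : PowerSeries ℂ :=
  PowerSeries.mk fun n => (-1) ^ n / (n.factorial : ℂ) * ∫ u in G.cube n, F n u

lemma withU_eq_series (φ₀ : ℝ) (A : ℝ → C_c(Space, ℂ)) (B : Observable) :
    G.withU φ₀ A B = G.series (G.vertexCorr φ₀ A B) := rfl

lemma series_add {F F' : ∀ n, (Fin n → ℝ) → ℂ} (hF : ∀ n, IntegrableOn (F n) (G.cube n))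
    (hF' : ∀ n, IntegrableOn (F' n) (G.cube n)) :
    G.series (fun n u => F n u + F' n u) = G.series F + G.series F' := by
  ext n
  simp only [series, PowerSeries.coeff_mk, map_add]
  rw [integral_add (hF n) (hF' n), mul_add]

lemma series_congr {F F' : ∀ n, (Fin n → ℝ) → ℂ}
    (h : ∀ n, ∀ᵐ u ∂(volume.restrict (G.cube n)), F n u = F' n u) : G.series F = G.series F' := by
  ext n
  simp only [series, PowerSeries.coeff_mk]
  rw [integral_congr_ae (h n)]

/-- The exponential formula: a sum over subsets of the vertices becomes a product. -/
lemma series_sum_powerset {X Y : ∀ n, Finset (Fin n) → (Fin n → ℝ) → ℂ}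
    (hX : ∀ {k n : ℕ} (e : Fin k ↪ Fin n) (u : Fin n → ℝ),
      X n (Finset.univ.map e) u = X k Finset.univ fun i => u (e i))
    (hY : ∀ {k n : ℕ} (e : Fin k ↪ Fin n) (u : Fin n → ℝ),
      Y n (Finset.univ.map e) u = Y k Finset.univ fun i => u (e i))
    (hint : ∀ n S, IntegrableOn (fun u => X n S u * Y n (Finset.univ \ S) u) (G.cube n)) :
    G.series (fun n u => ∑ S ∈ Finset.univ.powerset, X n S u * Y n (Finset.univ \ S) u) =
      G.series (fun n => X n Finset.univ) * G.series (fun n => Y n Finset.univ) := by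
  ext n
  -- `X` depends only on the times in `S` and `Y` only on the others, so the integral factorises and
  -- depends on `S` through its cardinality alone.
  have h1 : ∀ S : Finset (Fin n), ∫ u in G.cube n, X n S u * Y n (Finset.univ \ S) u =
      (∫ u in G.cube S.card, X _ Finset.univ u) *
        ∫ u in G.cube (n - S.card), Y _ Finset.univ u := by
    intro S
    have hc : Sᶜ.card = n - S.card := by rw [Finset.card_compl, Fintype.card_fin]
    rw [← G.setIntegral_cube_mul (finSumEquivOfFinset rfl hc)]
    refine integral_congr_ae (Filter.Eventually.of_forall fun u => ?_)
    simp only [finSumEquivOfFinset_inl, finSumEquivOfFinset_inr]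
    have h2 := hX (S.orderEmbOfFin rfl).toEmbedding u
    have h3 := hY (Sᶜ.orderEmbOfFin hc).toEmbedding u
    rw [Finset.map_orderEmbOfFin_univ] at h2 h3
    rw [← Finset.compl_eq_univ_sdiff, h2, h3]
    rfl
  simp only [series, PowerSeries.coeff_mul, PowerSeries.coeff_mk]
  rw [integral_finsetSum _ fun S _ => hint n S, Finset.sum_congr rfl fun S _ => h1 S,
    Finset.sum_powerset_apply_card (fun k => (∫ u in G.cube k, X _ Finset.univ u) *
        ∫ u in G.cube (n - k), Y _ Finset.univ u), Finset.card_univ, Fintype.card_fin,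
    Finset.Nat.sum_antidiagonal_eq_sum_range_succ_mk, Finset.mul_sum]
  refine Finset.sum_congr rfl fun k hk => ?_
  have hkn : k ≤ n := Nat.lt_succ_iff.1 (Finset.mem_range.1 hk)
  -- The number of subsets of cardinality `k` turns 1/n! into the factors 1/k! and 1/(n - k)! of the
  -- Cauchy product.
  have h4 : ((n.choose k : ℕ) : ℂ) * (k.factorial * (n - k).factorial) = n.factorial := by
    rw [← mul_assoc]; exact_mod_cast Nat.choose_mul_factorial_mul_factorial hkn
  have h5 : ((-1 : ℂ)) ^ n = (-1) ^ k * (-1) ^ (n - k) := by rw [← pow_add, Nat.add_sub_cancel' hkn]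
  have h6 : (k.factorial : ℂ) ≠ 0 := by exact_mod_cast k.factorial_ne_zero
  have h7 : ((n - k).factorial : ℂ) ≠ 0 := by exact_mod_cast (n - k).factorial_ne_zero
  have h8 : (n.choose k : ℂ) ≠ 0 := by exact_mod_cast (Nat.choose_pos hkn).ne'
  rw [nsmul_eq_mul, ← h4, h5]
  field_simp

end Split

section Natural

lemma tail_map {M N : Type*} [DecidableEq M] [DecidableEq N] (V : Vertices N) (W : Vertices M)
    (e : M ↪ N) (s : ℝ) (f : OneParticle) (S : Finset M) (hu : ∀ i, V.u (e i) = W.u i)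
    (hop : ∀ i, V.op (e i) = W.op i) (hq : ∀ i, V.q (e i) = W.q i) (hg : ∀ i, V.g (e i) = W.g i) :
    G.tail V s f (S.map e) = G.tail W s f S := by
  rw [tail, tail, Finset.sum_map]
  refine Finset.sum_congr rfl fun k _ => ?_
  rw [← Finset.map_erase, hu, hq, hg, G.link_map V W e _ _ _ _ _ (fun i _ => hu i) fun i _ => hop i]

variable (A : ℝ → C_c(Space, ℂ)) (p q : ℂ) {k n : ℕ} (e : Fin k ↪ Fin n) (u : Fin n → ℝ)

lemma tail_vertices_map (f : OneParticle) :
    G.tail (vertices A (fun _ => p) (fun _ => q) u) 0 f (Finset.univ.map e) =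
      G.tail (vertices A (fun _ => p) (fun _ => q) fun i => u (e i)) 0 f Finset.univ :=
  G.tail_map _ _ e _ _ _ (fun _ => rfl)
    (fun _ => by rw [vertices_op, vertices_op]) (fun _ => rfl) (fun _ => rfl)

lemma tailStar_vertices_map (h : OneParticle) :
    G.tailStar (vertices A (fun _ => p) (fun _ => q) u) 0 h (Finset.univ.map e) =
      G.tailStar (vertices A (fun _ => p) (fun _ => q) fun i => u (e i)) 0 h Finset.univ :=
  congrArg (starRingEnd ℂ) <| G.tail_map _ _ e _ _ _ (fun _ => rfl)
    (fun _ => by rw [vertices_adj_op, vertices_adj_op]) (fun _ => rfl) (fun _ => rfl)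

lemma link_vertices_map (f h : OneParticle) :
    G.link (vertices A 0 0 u) 0 h 0 f (Finset.univ.map e) =
      G.link (vertices A 0 0 fun i => u (e i)) 0 h 0 f Finset.univ :=
  G.link_map _ _ e _ _ _ _ _ (fun _ _ => rfl) (fun _ _ => by rw [vertices_op, vertices_op])

lemma gauss_vertices_map (x : MvPolynomial FieldGen ℂ) :
    G.gauss (x * ∏ i ∈ Finset.univ.map e, (vertices A (fun _ => p) (fun _ => q) u).poly i) =
      G.gauss (x * ∏ i, (vertices A (fun _ => p) (fun _ => q) fun i => u (e i)).poly i) := by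
  rw [Finset.prod_map]
  rfl

lemma gauss_prod_vertices_map :
    G.gauss (∏ i ∈ Finset.univ.map e, (vertices A (fun _ => p) (fun _ => q) u).poly i) =
      G.gauss (∏ i, (vertices A (fun _ => p) (fun _ => q) fun i => u (e i)).poly i) := by
  rw [Finset.prod_map]
  rfl

end Natural

lemma ae_distinct (n : ℕ) :
    ∀ᵐ u ∂((volume : Measure (Fin n → ℝ)).restrict (G.cube n)), u ∈ G.distinct (Fin n) := by
  rw [← G.restrict_distinct]
  exact ae_restrict_mem G.measurableSet_distinct

variable {G} in
lemma integrableOn_of_memLp {n : ℕ} {F : (Fin n → ℝ) → ℂ} (hF : MemLp F ∞ (volume.restrict (G.cube n))) :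
    IntegrableOn F (G.cube n) := hF.integrable (by simp)

section Integrability

variable {G} {A : ℝ → C_c(Space, ℂ)} (hA : G.Regular A) {n : ℕ} (φ₀ : ℝ)
include hA

lemma Regular.memLp_gauss_cube (p q : Fin n → ℂ) (I : Finset (Fin n)) :
    MemLp (fun u => G.gauss (∏ i ∈ I, (vertices A p q u).poly i)) ∞
      (volume.restrict (G.cube n)) := G.restrict_distinct n ▸ hA.memLp_gauss p q I

lemma Regular.memLp_tail_cube (p q : Fin n → ℂ) (f : OneParticle) (S : Finset (Fin n)) :
    MemLp (fun u => G.tail (vertices A p q u) 0 f S) ∞ (volume.restrict (G.cube n)) :=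
  G.restrict_distinct n ▸ hA.memLp_tail p q continuousOn_const continuousOn_const
    (fun _ _ => le_rfl) S fun _ hu i _ => zero_apart_of_mem (hu.1 i)

lemma Regular.memLp_tailStar_cube (p q : Fin n → ℂ) (f : OneParticle) (S : Finset (Fin n)) :
    MemLp (fun u => G.tailStar (vertices A p q u) 0 f S) ∞ (volume.restrict (G.cube n)) :=
  G.restrict_distinct n ▸ hA.memLp_tailStar p q continuousOn_const continuousOn_const
    (fun _ _ => le_rfl) S fun _ hu i _ => zero_apart_of_mem (hu.1 i)

lemma Regular.memLp_inner_chain_cube (f h : OneParticle) (l : List (Fin n)) (hl : l.Nodup) :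
    MemLp (fun u => inner ℂ f (G.chain (vertices A 0 0 u) 0 0 l h)) ∞
      (volume.restrict (G.cube n)) := by
  rw [← G.restrict_distinct]
  obtain ⟨M, hM, hAM⟩ := hA.exists_norm_le
  refine G.memLp_inner_chain (V := fun u => vertices A 0 0 u) (M := max M (max ‖f‖ ‖h‖))
    (v := fun _ => 0) (s := fun _ => 0) (h := fun _ => h) (f := fun _ => f)
    (fun i => (continuous_apply i).continuousOn) (fun i => ?_) volume G.measurableSet_distinct
    (hM.trans (le_max_left _ _)) continuousOn_const continuousOn_const continuousOn_const
    continuousOn_const (fun _ _ => (le_max_right _ _).trans (le_max_right _ _))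
    (fun _ _ => (le_max_left _ _).trans (le_max_right _ _)) (fun u hu i => ?_)
    continuousOn_const l hl (fun u hu i _ j _ hij => apart_of_distinct hu hij)
    (fun u hu i _ => zero_apart_of_mem (hu.1 i)) (fun u hu i _ => (zero_apart_of_mem (hu.1 i)).symm)
  · simp only [vertices_op]
    exact continuousOn_comp_time hA.continuousOn_mulOp i
  · simp only [vertices_op]
    exact ((hAM _ (mem_Icc_of_distinct hu i)).1).trans (le_max_left _ _)

lemma Regular.memLp_link_cube (f h : OneParticle) (S : Finset (Fin n)) :
    MemLp (fun u => G.link (vertices A 0 0 u) 0 h 0 f S) ∞ (volume.restrict (G.cube n)) := by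
  have heq : (fun u => G.link (vertices A 0 0 u) 0 h 0 f S) = fun u =>
      ∑ l ∈ orderings S, inner ℂ f (G.chain (vertices A 0 0 u) 0 0 l h) := by
    ext x
    rw [link, chainSum, sum_apply, inner_sum]
  rw [heq]
  refine memLp_finsetSum _ fun l hl => hA.memLp_inner_chain_cube f h l ?_
  rw [mem_orderings] at hl
  exact Multiset.coe_nodup.1 (hl ▸ S.nodup)

lemma Regular.memLp_gauss_cre_cube (p q : Fin n → ℂ) (h : OneParticle) (I : Finset (Fin n)) :
    MemLp (fun u => G.gauss (MvPolynomial.X (.cre 0 h) * ∏ i ∈ I, (vertices A p q u).poly i)) ∞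
      (volume.restrict (G.cube n)) := by
  have h1 : MemLp (fun u => ∑ S ∈ I.powerset, G.tailStar (vertices A p q u) 0 h S *
      G.gauss (∏ i ∈ I \ S, (vertices A p q u).poly i)) ∞ (volume.restrict (G.cube n)) :=
    memLp_finsetSum _ fun S _ => (hA.memLp_gauss_cube p q _).mul (hA.memLp_tailStar_cube p q h S)
  refine h1.ae_eq ?_
  filter_upwards [G.ae_distinct n] with u hu
  exact (gauss_cre_mul G _ _ _ (apartOn_vertices A _ _ hu _)).symm

end Integrability

section Expansion

variable {G} {A : ℝ → C_c(Space, ℂ)} (hA : G.Regular A) (φ₀ : ℝ) (f h : OneParticle)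
include hA

lemma Regular.memLp_vertexCorr_one (n : ℕ) :
    MemLp (G.vertexCorr φ₀ A 1 n) ∞ (volume.restrict (G.cube n)) := by
  refine (hA.memLp_gauss_cube (fun _ => (φ₀ : ℂ)) (fun _ => (φ₀ : ℂ)) Finset.univ).ae_eq ?_
  filter_upwards [G.ae_distinct n] with u hu
  exact (vertexCorr_one φ₀ A hu).symm

lemma Regular.memLp_vertexCorr_Psi (n : ℕ) :
    MemLp (G.vertexCorr φ₀ A (Psi f) n) ∞ (volume.restrict (G.cube n)) := by
  refine (memLp_finsetSum Finset.univ.powerset fun S _ =>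
    (hA.memLp_gauss_cube (fun _ => (φ₀ : ℂ)) (fun _ => (φ₀ : ℂ)) (Finset.univ \ S)).mul
    (hA.memLp_tail_cube (fun _ => (φ₀ : ℂ)) (fun _ => (φ₀ : ℂ)) f S)).ae_eq ?_
  filter_upwards [G.ae_distinct n] with u hu
  exact (vertexCorr_Psi φ₀ A hu f).symm

lemma Regular.memLp_vertexCorr_PsiStar (n : ℕ) :
    MemLp (G.vertexCorr φ₀ A (PsiStar h) n) ∞ (volume.restrict (G.cube n)) := by
  refine (memLp_finsetSum Finset.univ.powerset fun S _ =>
    (hA.memLp_gauss_cube (fun _ => (φ₀ : ℂ)) (fun _ => (φ₀ : ℂ)) (Finset.univ \ S)).mul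
    (hA.memLp_tailStar_cube (fun _ => (φ₀ : ℂ)) (fun _ => (φ₀ : ℂ)) h S)).ae_eq ?_
  filter_upwards [G.ae_distinct n] with u hu
  exact (vertexCorr_PsiStar φ₀ A hu h).symm

lemma Regular.memLp_vertexCorr_Psi_mul_PsiStar (n : ℕ) :
    MemLp (G.vertexCorr φ₀ A (Psi f * PsiStar h) n) ∞ (volume.restrict (G.cube n)) := by
  refine ((memLp_finsetSum Finset.univ.powerset fun S _ =>
    (hA.memLp_gauss_cube (fun _ => (φ₀ : ℂ)) (fun _ => (φ₀ : ℂ)) (Finset.univ \ S)).mul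
    (hA.memLp_link_cube f h S)).add (memLp_finsetSum Finset.univ.powerset fun S _ =>
    (hA.memLp_gauss_cre_cube (fun _ => (φ₀ : ℂ)) (fun _ => (φ₀ : ℂ)) h (Finset.univ \ S)).mul
    (hA.memLp_tail_cube (fun _ => (φ₀ : ℂ)) (fun _ => (φ₀ : ℂ)) f S))).ae_eq ?_
  filter_upwards [G.ae_distinct n] with u hu
  exact (vertexCorr_Psi_mul_PsiStar φ₀ A hu f h).symm

omit hA in
lemma withU_one_eq : G.withU φ₀ A 1 = G.series fun _ u =>
    G.gauss (∏ i, (vertices A (fun _ => (φ₀ : ℂ)) (fun _ => (φ₀ : ℂ)) u).poly i) := by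
  rw [withU_eq_series]
  refine G.series_congr fun n => ?_
  filter_upwards [G.ae_distinct n] with u hu
  exact vertexCorr_one φ₀ A hu

lemma Regular.withU_Psi : G.withU φ₀ A (Psi f) =
    G.series (fun _ u => G.tail (vertices A (fun _ => (φ₀ : ℂ)) (fun _ => (φ₀ : ℂ)) u) 0 f
      Finset.univ) * G.withU φ₀ A 1 := by
  rw [withU_one_eq, ← G.series_sum_powerset
    (X := fun n S u => G.tail (vertices A (fun _ => (φ₀ : ℂ)) (fun _ => (φ₀ : ℂ)) u) 0 f S)
    (Y := fun n S u => G.gauss (∏ i ∈ S,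
      (vertices A (fun _ => (φ₀ : ℂ)) (fun _ => (φ₀ : ℂ)) u).poly i))
    (fun e u => G.tail_vertices_map A _ _ e u f) (fun e u => G.gauss_prod_vertices_map A _ _ e u)
    fun n S => integrableOn_of_memLp ((hA.memLp_gauss_cube _ _ _).mul (hA.memLp_tail_cube _ _ f S))]
  refine G.series_congr fun n => ?_
  filter_upwards [G.ae_distinct n] with u hu
  exact vertexCorr_Psi φ₀ A hu f

lemma Regular.series_cre : G.series (fun _ u => G.gauss (MvPolynomial.X (.cre 0 h) *
      ∏ i, (vertices A (fun _ => (φ₀ : ℂ)) (fun _ => (φ₀ : ℂ)) u).poly i)) =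
    G.series (fun _ u => G.tailStar (vertices A (fun _ => (φ₀ : ℂ)) (fun _ => (φ₀ : ℂ)) u) 0 h
      Finset.univ) * G.withU φ₀ A 1 := by
  rw [withU_one_eq, ← G.series_sum_powerset
    (X := fun n S u => G.tailStar (vertices A (fun _ => (φ₀ : ℂ)) (fun _ => (φ₀ : ℂ)) u) 0 h S)
    (Y := fun n S u => G.gauss (∏ i ∈ S,
      (vertices A (fun _ => (φ₀ : ℂ)) (fun _ => (φ₀ : ℂ)) u).poly i))
    (fun e u => G.tailStar_vertices_map A _ _ e u h) (fun e u => G.gauss_prod_vertices_map A _ _ e u)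
    fun n S => integrableOn_of_memLp
      ((hA.memLp_gauss_cube _ _ _).mul (hA.memLp_tailStar_cube _ _ h S))]
  refine G.series_congr fun n => ?_
  filter_upwards [G.ae_distinct n] with u hu
  exact gauss_cre_mul G _ _ _ (apartOn_vertices A _ _ hu _)

lemma Regular.withU_PsiStar : G.withU φ₀ A (PsiStar h) =
    G.series (fun _ u => G.tailStar (vertices A (fun _ => (φ₀ : ℂ)) (fun _ => (φ₀ : ℂ)) u) 0 h
      Finset.univ) * G.withU φ₀ A 1 := by
  rw [← hA.series_cre, withU_eq_series]
  refine G.series_congr fun n => ?_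
  filter_upwards [G.ae_distinct n] with u hu
  rw [vertexCorr_PsiStar φ₀ A hu h]
  exact (gauss_cre_mul G _ _ _ (apartOn_vertices A _ _ hu _)).symm

lemma Regular.series_tail_mul (x : MvPolynomial FieldGen ℂ)
    (hx : ∀ n (I : Finset (Fin n)), MemLp (fun u => G.gauss (x * ∏ i ∈ I,
      (vertices A (fun _ => (φ₀ : ℂ)) (fun _ => (φ₀ : ℂ)) u).poly i)) ∞
        (volume.restrict (G.cube n))) :
    G.series (fun _ u => ∑ S ∈ Finset.univ.powerset,
      G.tail (vertices A (fun _ => (φ₀ : ℂ)) (fun _ => (φ₀ : ℂ)) u) 0 f S *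
      G.gauss (x * ∏ i ∈ Finset.univ \ S,
        (vertices A (fun _ => (φ₀ : ℂ)) (fun _ => (φ₀ : ℂ)) u).poly i)) =
    G.series (fun _ u => G.tail (vertices A (fun _ => (φ₀ : ℂ)) (fun _ => (φ₀ : ℂ)) u) 0 f
      Finset.univ) * G.series (fun _ u => G.gauss (x *
        ∏ i, (vertices A (fun _ => (φ₀ : ℂ)) (fun _ => (φ₀ : ℂ)) u).poly i)) :=
  G.series_sum_powerset
    (X := fun _ S u => G.tail (vertices A (fun _ => (φ₀ : ℂ)) (fun _ => (φ₀ : ℂ)) u) 0 f S)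
    (Y := fun _ S u => G.gauss (x * ∏ i ∈ S,
      (vertices A (fun _ => (φ₀ : ℂ)) (fun _ => (φ₀ : ℂ)) u).poly i))
    (fun e u => G.tail_vertices_map A _ _ e u f) (fun e u => G.gauss_vertices_map A _ _ e u x)
    fun n S => integrableOn_of_memLp ((hx n _).mul (hA.memLp_tail_cube _ _ f S))

lemma Regular.withU_Psi_mul_PsiStar : G.withU φ₀ A (Psi f * PsiStar h) =
    G.series (fun _ u => G.link (vertices A 0 0 u) 0 h 0 f Finset.univ) * G.withU φ₀ A 1 +
    G.series (fun _ u => G.tail (vertices A (fun _ => (φ₀ : ℂ)) (fun _ => (φ₀ : ℂ)) u) 0 f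
      Finset.univ) * G.withU φ₀ A (PsiStar h) := by
  have h1 := G.series_sum_powerset
    (X := fun n S u => G.link (vertices A 0 0 u) 0 h 0 f S)
    (Y := fun n S u => G.gauss (∏ i ∈ S,
      (vertices A (fun _ => (φ₀ : ℂ)) (fun _ => (φ₀ : ℂ)) u).poly i))
    (fun e u => G.link_vertices_map A e u f h) (fun e u => G.gauss_prod_vertices_map A _ _ e u)
    (fun n S => integrableOn_of_memLp
      ((hA.memLp_gauss_cube _ _ _).mul (hA.memLp_link_cube f h S)))
  have h2 := hA.series_tail_mul φ₀ f (MvPolynomial.X (.cre 0 h))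
    fun n I => hA.memLp_gauss_cre_cube _ _ h I
  rw [hA.withU_PsiStar, ← hA.series_cre, withU_one_eq, ← h1, ← h2, ← G.series_add]
  · refine G.series_congr fun n => ?_
    filter_upwards [G.ae_distinct n] with u hu
    exact vertexCorr_Psi_mul_PsiStar φ₀ A hu f h
  · exact fun n => integrableOn_of_memLp (memLp_finsetSum _ fun S _ =>
      (hA.memLp_gauss_cube _ _ _).mul (hA.memLp_link_cube f h S))
  · exact fun n => integrableOn_of_memLp (memLp_finsetSum _ fun S _ =>
      (hA.memLp_gauss_cre_cube _ _ h _).mul (hA.memLp_tail_cube _ _ f S))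

omit hA in
lemma integral_cube_zero (F : (Fin 0 → ℝ) → ℂ) : ∫ u in G.cube 0, F u = F ![] := by
  have h : G.cube 0 = Set.univ := by
    ext u; simp [cube]
  rw [h, setIntegral_univ, integral_unique]
  have h1 : (volume : Measure (Fin 0 → ℝ)).real Set.univ = 1 := by
    simp [Measure.real, volume_pi]
  rw [h1, one_smul]
  exact congrArg F (Subsingleton.elim _ _)

omit hA in
lemma constantCoeff_withU_one : PowerSeries.constantCoeff (G.withU φ₀ A 1) = 1 := by
  rw [← PowerSeries.coeff_zero_eq_constantCoeff_apply, withU, PowerSeries.coeff_mk,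
    integral_cube_zero]
  simp [vertexCorr, state_one]

lemma Regular.perturbedState_Psi : G.perturbedState φ₀ A (Psi f) =
    G.series (fun _ u => G.tail (vertices A (fun _ => (φ₀ : ℂ)) (fun _ => (φ₀ : ℂ)) u) 0 f
      Finset.univ) := by
  rw [perturbedState, hA.withU_Psi, mul_assoc, PowerSeries.mul_inv_cancel _
    (by rw [constantCoeff_withU_one]; exact one_ne_zero), mul_one]

lemma Regular.perturbedState_PsiStar : G.perturbedState φ₀ A (PsiStar h) =
    G.series (fun _ u => G.tailStar (vertices A (fun _ => (φ₀ : ℂ)) (fun _ => (φ₀ : ℂ)) u) 0 h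
      Finset.univ) := by
  rw [perturbedState, hA.withU_PsiStar, mul_assoc, PowerSeries.mul_inv_cancel _
    (by rw [constantCoeff_withU_one]; exact one_ne_zero), mul_one]

/-- After division by ω(U), the paths that miss Ψ*(h) give the series of tails, which is the
one-point function of Ψ(f), times the perturbed value of Ψ*(h). This is precisely the subtracted
product. -/
lemma Regular.truncated_eq : G.truncated φ₀ A f h =
    G.series (fun _ u => G.link (vertices A 0 0 u) 0 h 0 f Finset.univ) := by
  have h1 := PowerSeries.mul_inv_cancel (G.withU φ₀ A 1)
    (by rw [constantCoeff_withU_one]; exact one_ne_zero)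
  rw [truncated, hA.perturbedState_Psi, perturbedState, perturbedState,
    hA.withU_Psi_mul_PsiStar, add_mul, mul_assoc, h1, mul_one, mul_assoc, add_sub_cancel_right]

end Expansion

end BoseGas

/-! ### One-point functions with one linear vertex, and the Dyson series -/

namespace BoseGas

variable {G : BoseGas} {A : ℝ → C_c(Space, ℂ)} (hA : G.Regular A)

section Lines

variable (G) in
/-- Distinct times in `(0, β)`, one of which is singled out. -/
def distinctPair (n : ℕ) : Set (ℝ × (Fin n → ℝ)) :=
  {p | p.1 ∈ Set.Ioo 0 G.β ∧ p.2 ∈ G.distinct (Fin n) ∧ ∀ i, p.2 i ≠ p.1}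

variable (G) in
lemma measurableSet_distinctPair (n : ℕ) : MeasurableSet (G.distinctPair n) := by
  have h : G.distinctPair n = Prod.fst ⁻¹' Set.Ioo 0 G.β ∩ (Prod.snd ⁻¹' G.distinct (Fin n) ∩
      ⋂ i, {p : ℝ × (Fin n → ℝ) | p.2 i = p.1}ᶜ) := by
    ext p
    simp [distinctPair]
  rw [h]
  refine (measurable_fst measurableSet_Ioo).inter
    ((measurable_snd G.measurableSet_distinct).inter (MeasurableSet.iInter fun i => ?_))
  exact (measurableSet_eq_fun (by fun_prop) (by fun_prop)).compl

variable (G) in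
lemma distinctPair_ae_eq (n : ℕ) :
    G.distinctPair n =ᵐ[volume] (Set.Ioo 0 G.β ×ˢ G.cube n : Set (ℝ × (Fin n → ℝ))) := by
  have h1 : ∀ᵐ p : ℝ × (Fin n → ℝ), Function.Injective p.2 := by
    rw [Measure.volume_eq_prod]
    exact Measure.quasiMeasurePreserving_snd.ae ae_injective
  have h2 : ∀ i : Fin n, ∀ᵐ p : ℝ × (Fin n → ℝ), p.2 i ≠ p.1 := by
    intro i
    have := ae_linear_ne_zero ((volume : Measure ℝ).prod (volume : Measure (Fin n → ℝ)))
      (LinearMap.proj (R := ℝ) (φ := fun _ : Fin n => ℝ) i ∘ₗ LinearMap.snd ℝ ℝ (Fin n → ℝ) -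
        LinearMap.fst ℝ ℝ (Fin n → ℝ)) (fun h => by
          have := LinearMap.congr_fun h (1, 0)
          simp at this)
    rw [Measure.volume_eq_prod]
    filter_upwards [this] with p hp h
    exact hp (by simp [h])
  filter_upwards [h1, ae_all_iff.2 h2] with p hp1 hp2
  refine propext ⟨fun h => ?_, fun h => ?_⟩
  · exact ⟨h.1, fun i _ => h.2.1.1 i⟩
  · exact ⟨h.1, ⟨fun i => h.2 i trivial, hp1⟩, hp2⟩

variable (G) in
lemma restrict_distinctPair (n : ℕ) : volume.restrict (G.distinctPair n) =
    (volume : Measure (ℝ × (Fin n → ℝ))).restrict (Set.Ioo 0 G.β ×ˢ G.cube n) :=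
  Measure.restrict_congr_set (G.distinctPair_ae_eq n)

variable (G) in
lemma ae_distinctPair (n : ℕ) : ∀ᵐ p ∂((volume : Measure (ℝ × (Fin n → ℝ))).restrict
    (Set.Ioo 0 G.β ×ˢ G.cube n)), p ∈ G.distinctPair n := by
  rw [← restrict_distinctPair]
  exact ae_restrict_mem (G.measurableSet_distinctPair n)

lemma continuousOn_fst_distinctPair {Y : Type*} [TopologicalSpace Y] {F : ℝ → Y}
    (hF : ContinuousOn F (Set.Icc 0 G.β)) (n : ℕ) :
    ContinuousOn (fun p : ℝ × (Fin n → ℝ) => F p.1) (G.distinctPair n) :=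
  hF.comp continuousOn_fst fun _ hp => Set.Ioo_subset_Icc_self hp.1

lemma continuousOn_snd_distinctPair {Y : Type*} [TopologicalSpace Y] {F : ℝ → Y}
    (hF : ContinuousOn F (Set.Icc 0 G.β)) {n : ℕ} (i : Fin n) :
    ContinuousOn (fun p : ℝ × (Fin n → ℝ) => F (p.2 i)) (G.distinctPair n) :=
  hF.comp ((continuous_apply i).comp continuous_snd).continuousOn fun _ hp =>
    mem_Icc_of_distinct hp.2.1 i

lemma apart_of_distinctPair {n : ℕ} {p : ℝ × (Fin n → ℝ)} (hp : p ∈ G.distinctPair n) (i : Fin n) :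
    G.Apart (p.2 i) p.1 :=
  G.apart_of_mem (Set.Ioo_subset_Ico_self (hp.2.1.1 i)) (Set.Ioo_subset_Ico_self hp.1) (hp.2.2 i)

instance isFiniteMeasure_restrict_prod_cube (n : ℕ) :
    IsFiniteMeasure ((volume : Measure (ℝ × (Fin n → ℝ))).restrict
      (Set.Ioo 0 G.β ×ˢ G.cube n)) := by
  rw [Measure.volume_eq_prod, ← Measure.prod_restrict]
  infer_instance

include hA

lemma Regular.integrableOn_annLine (f : OneParticle) (n : ℕ) :
    IntegrableOn (fun p : ℝ × (Fin n → ℝ) => G.annLine A f p.1 p.2)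
      (Set.Ioo 0 G.β ×ˢ G.cube n) := by
  obtain ⟨M, hM, hAM⟩ := hA.exists_norm_le
  have h : MemLp (fun p : ℝ × (Fin n → ℝ) => G.annLine A f p.1 p.2) ∞
      (volume.restrict (G.distinctPair n)) := by
    refine G.memLp_link (V := fun p : ℝ × (Fin n → ℝ) => vertices A 0 0 p.2) (M := max M ‖f‖)
      (v := fun p => p.1) (s := fun _ => 0) (h := fun p => toL2 (A p.1)) (f := fun _ => f)
      (fun i => ((continuous_apply i).comp continuous_snd).continuousOn) (fun i => ?_) volume
      (G.measurableSet_distinctPair n) (hM.trans (le_max_left _ _)) continuousOn_fst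
      continuousOn_const (continuousOn_fst_distinctPair hA.continuousOn_toL2 n) continuousOn_const
      (fun p hp => ((hAM _ (Set.Ioo_subset_Icc_self hp.1)).2).trans (le_max_left _ _))
      (fun _ _ => le_max_right _ _) (fun p hp i => ?_)
      (G.continuousOn_thermal continuousOn_fst continuousOn_const
        fun p hp => zero_apart_of_mem hp.1) _ (fun p hp => apartOn_vertices A _ _ hp.2.1 _)
      (fun p hp i _ => zero_apart_of_mem (hp.2.1.1 i)) (fun p hp i _ => apart_of_distinctPair hp i)
    · simp only [vertices_op]
      exact continuousOn_snd_distinctPair hA.continuousOn_mulOp i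
    · simp only [vertices_op]
      exact ((hAM _ (mem_Icc_of_distinct hp.2.1 i)).1).trans (le_max_left _ _)
  rw [restrict_distinctPair] at h
  exact h.integrable (by simp)

lemma Regular.integrableOn_creLine (f : OneParticle) (n : ℕ) :
    IntegrableOn (fun p : ℝ × (Fin n → ℝ) => G.creLine A f p.1 p.2)
      (Set.Ioo 0 G.β ×ˢ G.cube n) := by
  obtain ⟨M, hM, hAM⟩ := hA.star.exists_norm_le
  have h : MemLp (fun p : ℝ × (Fin n → ℝ) => G.creLine A f p.1 p.2) ∞
      (volume.restrict (G.distinctPair n)) := by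
    refine MemLp.star (R := ℂ) ?_
    refine G.memLp_link (V := fun p : ℝ × (Fin n → ℝ) => (vertices A 0 0 p.2).adj)
      (M := max M ‖f‖)
      (v := fun p => -p.1) (s := fun _ => -0) (h := fun p => toL2 (Star.star (A p.1))) (f := fun _ => f)
      (fun i => ((continuous_apply i).comp continuous_snd).continuousOn.neg) (fun i => ?_) volume
      (G.measurableSet_distinctPair n) (hM.trans (le_max_left _ _)) continuousOn_fst.neg
      continuousOn_const (continuousOn_fst_distinctPair hA.star.continuousOn_toL2 n)
      continuousOn_const
      (fun p hp => ((hAM _ (Set.Ioo_subset_Icc_self hp.1)).2).trans (le_max_left _ _))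
      (fun _ _ => le_max_right _ _) (fun p hp i => ?_)
      (G.continuousOn_thermal continuousOn_fst.neg continuousOn_const
        fun p hp => (zero_apart_of_mem hp.1).neg) _
      (fun p hp => apartOn_vertices_adj A _ _ hp.2.1 _)
      (fun p hp i _ => (zero_apart_of_mem (hp.2.1.1 i)).neg)
      (fun p hp i _ => (apart_of_distinctPair hp i).neg)
    · simp only [vertices_adj_op]
      exact continuousOn_snd_distinctPair hA.star.continuousOn_mulOp i
    · simp only [vertices_adj_op]
      exact ((hAM _ (mem_Icc_of_distinct hp.2.1 i)).1).trans (le_max_left _ _)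
  rw [restrict_distinctPair] at h
  exact h.integrable (by simp)

omit hA in
lemma preimage_piFinSuccAbove_cube {n : ℕ} (k : Fin (n + 1)) :
    MeasurableEquiv.piFinSuccAbove (fun _ => ℝ) k ⁻¹' (Set.Ioo 0 G.β ×ˢ G.cube n) =
      G.cube (n + 1) := by
  ext u
  simp only [cube, Set.mem_preimage, Set.mem_prod, Set.mem_univ_pi]
  rw [Fin.forall_iff_succAbove k]
  rfl

omit hA in
lemma setIntegral_cube_succ {n : ℕ} (k : Fin (n + 1)) (F : ℝ × (Fin n → ℝ) → ℂ) :
    ∫ u in G.cube (n + 1), F (u k, fun i => u (k.succAbove i)) =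
      ∫ p in Set.Ioo 0 G.β ×ˢ G.cube n, F p := by
  rw [← (volume_preserving_piFinSuccAbove (fun _ => ℝ) k).setIntegral_preimage_emb
    (MeasurableEquiv.measurableEmbedding _), preimage_piFinSuccAbove_cube]
  rfl

omit hA in
lemma integrableOn_cube_succ {n : ℕ} (k : Fin (n + 1)) {F : ℝ × (Fin n → ℝ) → ℂ}
    (hF : IntegrableOn F (Set.Ioo 0 G.β ×ˢ G.cube n)) :
    IntegrableOn (fun u : Fin (n + 1) → ℝ => F (u k, fun i => u (k.succAbove i)))
      (G.cube (n + 1)) := by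
  have h := ((volume_preserving_piFinSuccAbove (fun _ => ℝ) k).integrableOn_comp_preimage
    (MeasurableEquiv.measurableEmbedding _) (f := F) (s := Set.Ioo 0 G.β ×ˢ G.cube n)).2 hF
  rw [preimage_piFinSuccAbove_cube] at h
  exact h

omit hA in
/-- The coefficients of a series of sums over one distinguished vertex. -/
lemma coeff_series_sum_succAbove (φ₀ : ℝ) {F : ∀ n, (Fin n → ℝ) → ℂ} {L C : ℝ → (Fin n → ℝ) → ℂ}
    (hF : ∀ u, F (n + 1) u = ∑ k, φ₀ * L (u k) fun i => u (k.succAbove i))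
    (hL : IntegrableOn (fun p : ℝ × (Fin n → ℝ) => L p.1 p.2) (Set.Ioo 0 G.β ×ˢ G.cube n))
    (hC : ∀ p ∈ G.distinctPair n, C p.1 p.2 = φ₀ * L p.1 p.2) :
    IntegrableOn (fun p : ℝ × (Fin n → ℝ) => C p.1 p.2) (Set.Ioo 0 G.β ×ˢ G.cube n) ∧
    PowerSeries.coeff (n + 1) (G.series F) = -((-1) ^ n / (n.factorial : ℂ)) *
      ∫ u₀ in Set.Ioo 0 G.β, ∫ u in G.cube n, C u₀ u := by
  have hCL : (fun p : ℝ × (Fin n → ℝ) => φ₀ * L p.1 p.2) =ᵐ[volume.restrict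
      (Set.Ioo 0 G.β ×ˢ G.cube n)] fun p => C p.1 p.2 := by
    filter_upwards [G.ae_distinctPair n] with p hp
    exact (hC p hp).symm
  have hCi : IntegrableOn (fun p : ℝ × (Fin n → ℝ) => C p.1 p.2) (Set.Ioo 0 G.β ×ˢ G.cube n) :=
    Integrable.congr (hL.const_mul (φ₀ : ℂ)) hCL
  refine ⟨hCi, ?_⟩
  have h1 : ∫ u₀ in Set.Ioo 0 G.β, ∫ u in G.cube n, C u₀ u =
      ∫ p in Set.Ioo 0 G.β ×ˢ G.cube n, φ₀ * L p.1 p.2 := by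
    rw [integral_congr_ae hCL]
    exact (setIntegral_prod (fun p : ℝ × (Fin n → ℝ) => C p.1 p.2) hCi).symm
  rw [h1, series, PowerSeries.coeff_mk]
  simp only [hF]
  -- The n + 1 choices of the linear vertex have equal integrals, and (n + 1)/(n + 1)! = 1/n!; the
  -- additional sign comes from (-1)^(n+1).
  rw [integral_finsetSum _ fun k _ => integrableOn_cube_succ k
    (F := fun p => φ₀ * L p.1 p.2) (hL.const_mul (φ₀ : ℂ)),
    Finset.sum_congr rfl fun k _ => setIntegral_cube_succ k fun p => φ₀ * L p.1 p.2,
    Finset.sum_const, Finset.card_univ, Fintype.card_fin, nsmul_eq_mul, Nat.factorial_succ]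
  have h2 : (n.factorial : ℂ) ≠ 0 := by exact_mod_cast n.factorial_ne_zero
  have h3 : ((n + 1 : ℕ) : ℂ) ≠ 0 := by exact_mod_cast n.succ_ne_zero
  rw [Nat.cast_mul, pow_succ]
  field_simp

end Lines

section Dyson

lemma chain_vertices_eq_dysonChain (G : BoseGas) (A : ℝ → C_c(Space, ℂ)) {N : Type*} (u : N → ℝ)
    (s : ℝ) (l : List N) :
    G.chain (vertices A 0 0 u) 0 s l = G.dysonChain A s (l.map u) := by
  induction l generalizing s with
  | nil => rw [chain, List.map_nil, dysonChain, zero_sub]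
  | cons i l ih =>
    rw [chain, ih, vertices_op]
    rfl

lemma sum_orderings_univ {n : ℕ} (F : List (Fin n) → ℂ) :
    ∑ l ∈ orderings (Finset.univ : Finset (Fin n)), F l =
      ∑ π : Equiv.Perm (Fin n), F (List.ofFn π) := by
  symm
  refine Finset.sum_bij (fun π _ => List.ofFn π) ?_ ?_ ?_ ?_
  · intro π _
    rw [mem_orderings]
    have h : (List.ofFn π).Nodup := List.nodup_ofFn.2 π.injective
    refine (Multiset.Nodup.ext Finset.univ.nodup (Multiset.coe_nodup.2 h)).2 fun i => ?_
    simpa using ⟨π.symm i, by simp⟩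
  · intro π _ ρ _ h
    exact Equiv.coe_fn_injective (List.ofFn_injective h)
  · intro l hl
    rw [mem_orderings] at hl
    have hn : l.Nodup := Multiset.coe_nodup.1 (hl ▸ Finset.univ.nodup)
    have hlen : l.length = n := by
      have := congrArg Multiset.card hl
      simpa using this.symm
    let π : Equiv.Perm (Fin n) := Equiv.ofBijective (fun i => l.get (i.cast hlen.symm))
      (Finite.injective_iff_bijective.1 ((List.nodup_iff_injective_get.1 hn).comp
        (Fin.cast_injective _)))
    refine ⟨π, Finset.mem_univ _, List.ext_getElem (by simp [hlen]) fun i _ _ => ?_⟩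
    rw [List.getElem_ofFn]
    rfl
  · intro π _; rfl

lemma link_univ_eq (G : BoseGas) (A : ℝ → C_c(Space, ℂ)) {n : ℕ} (f h : OneParticle)
    (u : Fin n → ℝ) :
    G.link (vertices A 0 0 u) 0 h 0 f Finset.univ =
      ∑ π : Equiv.Perm (Fin n), inner ℂ f (G.dysonTerm A n (fun i => u (π i)) h) := by
  rw [link, chainSum, sum_apply, inner_sum,
    sum_orderings_univ fun l => inner ℂ f (G.chain (vertices A 0 0 u) 0 0 l h)]
  refine Finset.sum_congr rfl fun π _ => ?_
  rw [chain_vertices_eq_dysonChain, List.map_ofFn]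
  rfl

lemma setIntegral_cube_perm {n : ℕ} (π : Equiv.Perm (Fin n)) (F : (Fin n → ℝ) → ℂ) :
    ∫ u in G.cube n, F (fun i => u (π i)) = ∫ u in G.cube n, F u := by
  have h := volume_measurePreserving_piCongrLeft (fun _ : Fin n => ℝ) π
  rw [← h.setIntegral_preimage_emb (MeasurableEquiv.measurableEmbedding _)]
  have hval : ∀ (u : Fin n → ℝ) (i : Fin n),
      MeasurableEquiv.piCongrLeft (fun _ : Fin n => ℝ) π u (π i) = u i := fun u i =>
    MeasurableEquiv.piCongrLeft_apply_apply _ _ _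
  have hpre : MeasurableEquiv.piCongrLeft (fun _ : Fin n => ℝ) π ⁻¹' G.cube n = G.cube n := by
    ext u
    simp only [cube, Set.mem_preimage, Set.mem_univ_pi]
    rw [← π.forall_congr_right]
    simp only [hval]
  rw [hpre]
  simp only [hval]

lemma thermal_zero (G : BoseGas) : G.thermal 0 = G.Omega0 := by
  rw [thermal, wrap_zero, propagator, Omega0]
  congr 1
  ext ξ
  simp [symbol]

include hA

lemma Regular.integrableOn_dysonTerm (f h : OneParticle) (n : ℕ) :
    IntegrableOn (fun u : Fin n → ℝ => inner ℂ f (G.dysonTerm A n u h)) (G.cube n) := by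
  have h1 := integrableOn_of_memLp (hA.memLp_inner_chain_cube f h _ (List.nodup_finRange n))
  simpa only [chain_vertices_eq_dysonChain, dysonTerm, List.ofFn_eq_map] using h1

lemma Regular.integrableOn_dysonTerm_perm (f h : OneParticle) {n : ℕ} (π : Equiv.Perm (Fin n)) :
    IntegrableOn (fun u : Fin n → ℝ => inner ℂ f (G.dysonTerm A n (fun i => u (π i)) h))
      (G.cube n) := by
  have h1 := integrableOn_of_memLp (hA.memLp_inner_chain_cube f h (List.ofFn π)
    (List.nodup_ofFn.2 π.injective))
  simp only [chain_vertices_eq_dysonChain, List.map_ofFn] at h1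
  exact h1

/-- The cube is invariant under permutations of the times, so the n! orderings of a path contribute
equally and cancel the factorial. -/
lemma Regular.coeff_truncated (φ₀ : ℝ) (f h : OneParticle) (n : ℕ) :
    PowerSeries.coeff n (G.truncated φ₀ A f h) =
      (-1) ^ n * ∫ u in G.cube n, inner ℂ f (G.dysonTerm A n u h) := by
  rw [hA.truncated_eq, series, PowerSeries.coeff_mk]
  simp only [link_univ_eq]
  rw [integral_finsetSum _ fun π _ => hA.integrableOn_dysonTerm_perm f h π,
    Finset.sum_congr rfl fun π _ => setIntegral_cube_perm π fun u =>
      inner ℂ f (G.dysonTerm A n u h), Finset.sum_const, Finset.card_univ, Fintype.card_perm,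
    Fintype.card_fin, nsmul_eq_mul]
  have h2 : (n.factorial : ℂ) ≠ 0 := by exact_mod_cast n.factorial_ne_zero
  field_simp

end Dyson

end BoseGas

/-! ### Assembly of the proposition -/

theorem mainTheorem10 (G : BoseGas) (φ₀ : ℝ) (A : ℝ → C_c(Space, ℂ))
    (hA_cont : ContinuousOn (fun p : ℝ × Space => A p.1 p.2) (Set.Icc 0 G.β ×ˢ Set.univ))
    (hA_supp : ∃ S : Set Space, IsCompact S ∧ ∀ u ∈ Set.Icc 0 G.β, tsupport (A u) ⊆ S)
    (f h : OneParticle) :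
    -- every order of the series which define the perturbed state is an absolutely
    -- convergent integral
    (∀ B ∈ ({1, Psi f, PsiStar h, Psi f * PsiStar h} : Set Observable), ∀ n : ℕ,
      IntegrableOn (G.vertexCorr φ₀ A B n) (G.cube n)) ∧
    -- the one-point function of `Ψ(f)`
    (PowerSeries.coeff 0 (G.perturbedState φ₀ A (Psi f)) = 0 ∧
      ∀ n : ℕ,
        IntegrableOn (fun p : ℝ × (Fin n → ℝ) => G.connected
          (Psi f :: (List.ofFn (fun i => Q2 A (p.2 i)) ++ [Q1 φ₀ A p.1])))
          (Set.Ioo 0 G.β ×ˢ G.cube n) ∧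
        PowerSeries.coeff (n + 1) (G.perturbedState φ₀ A (Psi f)) =
          -((-1) ^ n / (n.factorial : ℂ)) * ∫ u₀ in Set.Ioo 0 G.β, ∫ u in G.cube n,
            G.connected (Psi f :: (List.ofFn (fun i => Q2 A (u i)) ++ [Q1 φ₀ A u₀]))) ∧
    -- the one-point function of `Ψ*(h)`
    (PowerSeries.coeff 0 (G.perturbedState φ₀ A (PsiStar h)) = 0 ∧
      ∀ n : ℕ,
        IntegrableOn (fun p : ℝ × (Fin n → ℝ) => G.connected
          (PsiStar h :: (List.ofFn (fun i => Q2 A (p.2 i)) ++ [Q1 φ₀ A p.1])))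
          (Set.Ioo 0 G.β ×ˢ G.cube n) ∧
        PowerSeries.coeff (n + 1) (G.perturbedState φ₀ A (PsiStar h)) =
          -((-1) ^ n / (n.factorial : ℂ)) * ∫ u₀ in Set.Ioo 0 G.β, ∫ u in G.cube n,
            G.connected (PsiStar h :: (List.ofFn (fun i => Q2 A (u i)) ++ [Q1 φ₀ A u₀]))) ∧
    -- the truncated two-point function, through connected correlations of quadratic terms only
    (∀ n : ℕ,
      IntegrableOn (fun u : Fin n → ℝ => G.connected
        ((Psi f * PsiStar h) :: List.ofFn (fun i => Q2 A (u i)))) (G.cube n) ∧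
      PowerSeries.coeff n (G.truncated φ₀ A f h) =
        (-1) ^ n / (n.factorial : ℂ) * ∫ u in G.cube n,
          G.connected ((Psi f * PsiStar h) :: List.ofFn (fun i => Q2 A (u i)))) ∧
    -- the linear part of `Q_A` has no influence on `Ω`
    G.truncated φ₀ A f h = G.truncated 0 A f h ∧
    -- the Dyson series
    (PowerSeries.coeff 0 (G.truncated φ₀ A f h) = inner ℂ f (G.Omega0 h) ∧
      ∀ n : ℕ, 1 ≤ n →
        IntegrableOn (fun u : Fin n → ℝ => inner ℂ f (G.dysonTerm A n u h)) (G.cube n) ∧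
        PowerSeries.coeff n (G.truncated φ₀ A f h) =
          (-1) ^ n * ∫ u in G.cube n, inner ℂ f (G.dysonTerm A n u h)) := by
  have hA : G.Regular A := ⟨hA_cont, hA_supp⟩
  refine ⟨?_, ⟨?_, fun n => ?_⟩, ⟨?_, fun n => ?_⟩, fun n => ?_, ?_, ?_, fun n _ => ?_⟩
  · rintro B (rfl | rfl | rfl | rfl) n
    · exact BoseGas.integrableOn_of_memLp (hA.memLp_vertexCorr_one φ₀ n)
    · exact BoseGas.integrableOn_of_memLp (hA.memLp_vertexCorr_Psi φ₀ f n)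
    · exact BoseGas.integrableOn_of_memLp (hA.memLp_vertexCorr_PsiStar φ₀ h n)
    · exact BoseGas.integrableOn_of_memLp (hA.memLp_vertexCorr_Psi_mul_PsiStar φ₀ f h n)
  -- At order zero there is no vertex at which the path could end.
  · rw [hA.perturbedState_Psi, BoseGas.series, PowerSeries.coeff_mk]
    simp [BoseGas.tail]
  · rw [hA.perturbedState_Psi]
    exact BoseGas.coeff_series_sum_succAbove φ₀ (fun u => G.tail_vertices A φ₀ u f)
      (hA.integrableOn_annLine f n)
      (C := fun u₀ u => G.connected (Psi f :: (List.ofFn (fun i => Q2 A (u i)) ++ [Q1 φ₀ A u₀])))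
      fun p hp => BoseGas.connected_Psi φ₀ A hp.2.1 hp.1 hp.2.2 f
  · rw [hA.perturbedState_PsiStar, BoseGas.series, PowerSeries.coeff_mk]
    simp [BoseGas.tailStar, BoseGas.tail]
  · rw [hA.perturbedState_PsiStar]
    exact BoseGas.coeff_series_sum_succAbove φ₀ (fun u => G.tailStar_vertices A φ₀ u h)
      (hA.integrableOn_creLine h n)
      (C := fun u₀ u => G.connected
        (PsiStar h :: (List.ofFn (fun i => Q2 A (u i)) ++ [Q1 φ₀ A u₀])))
      fun p hp => BoseGas.connected_PsiStar φ₀ A hp.2.1 hp.1 hp.2.2 h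
  -- Paths and connected functions are compared only at distinct times; coinciding times form a null
  -- set.
  · have hae : (fun u : Fin n → ℝ => G.link (vertices A 0 0 u) 0 h 0 f Finset.univ)
        =ᵐ[volume.restrict (G.cube n)] fun u => G.connected
          ((Psi f * PsiStar h) :: List.ofFn (fun i => Q2 A (u i))) := by
      filter_upwards [G.ae_distinct n] with u hu
      exact (BoseGas.connected_Psi_mul_PsiStar A hu f h).symm
    refine ⟨(BoseGas.integrableOn_of_memLp (hA.memLp_link_cube f h _)).congr hae, ?_⟩
    rw [hA.truncated_eq, BoseGas.series, PowerSeries.coeff_mk, integral_congr_ae hae]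
  -- The sum over joining paths does not contain φ₀.
  · rw [hA.truncated_eq, hA.truncated_eq]
  · rw [hA.coeff_truncated, BoseGas.integral_cube_zero, pow_zero, one_mul, BoseGas.dysonTerm,
      List.ofFn_zero, BoseGas.dysonChain, neg_zero, BoseGas.thermal_zero]
  · exact ⟨hA.integrableOn_dysonTerm f h n, hA.coeff_truncated φ₀ f h n⟩

end
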